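/- Let $T>0$, $d\in\mathbb N_0$, $\gamma\in[0,1]$ with $\gamma\neq\frac12$, $p\in(2,3)$, and let $\pi=(\pi^n)_{n\in\mathbb N}$, $\pi^n=\{0=t^n_0<\dots<t^n_{N_n}=T\}$, be a sequence of partitions of $[0,T]$ with mesh size $|\pi^n|\to0$. Write $X_{s,t}=X_t-X_s$, $\Delta_T=\{(s,t):0\le s\le t\le T\}$, $|\cdot|$ for Euclidean norms, and $\|A\|_r=\big(\sup_{\mathcal P}\sum_{[u,v]\in\mathcal P}|A_{u,v}|^r\big)^{1/r}$ (supremum over all partitions $\mathcal P$ of $[0,T]$) for the $r$-variation of a two-parameter function $A$ on $\Delta_T$ or of the increments $A_{u,v}$ of a path. **Rough paths.** $\mathcal C^p([0,T];\mathbb R^m)$ is the set of pairs $\mathbf X=(X,\mathbb X^{(2)})$ of continuous functions $X:[0,T]\to\mathbb R^m$, $\mathbb X^{(2)}:\Delta_T\to\mathbb R^{m\times m}$ with $\|X\|_p<\infty$, $\|\mathbb X^{(2)}\|_{p/2}<\infty$ and $\mathbb X^{(2)}_{s,t}=\mathbb X^{(2)}_{s,u}+\mathbb X^{(2)}_{u,t}+X_{s,u}\otimes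 X_{u,t}$ for $0\le s\le u\le t\le T$. It carries the seminorm $\|\mathbf X\|_p=\|X\|_p+\|\mathbb X^{(2)}\|_{p/2}$ and the topology of the pseudometric $\|X-Y\|_p+\|\mathbb X^{(2)}-\mathbb Y^{(2)}\|_{p/2}$. The bracket of $\mathbf X$ is $[\mathbf X]_t=X_{0,t}\otimes X_{0,t}-\mathbb X^{(2)}_{0,t}-(\mathbb X^{(2)}_{0,t})^\top$. Let $\hat d=1+d+\frac{d(d+1)}2$, and let $\widehat{\mathcal C}^p([0,T];\mathbb R^{\hat d})\subset\mathcal C^p([0,T];\mathbb R^{\hat d})$ be the set of the canonical extensions $(\widehat X,\widehat{\mathbb X}^{(2)})$ of the rough paths $\mathbf X\in\mathcal C^p([0,T];\mathbb R^d)$: $\widehat X_t=(t,X_t,([\mathbf X]^{ij}_t)_{i\le j})$, the block of $\widehat{\mathbb X}^{(2)}$ belonging to the coordinates of $X$ is $\mathbb X^{(2)}$, and every other entry is the Young integral $(\widehat{\mathbb X}^{(2)}_{s,t})^{ab}=\int_s^t\widehat X^a_{s,r}\,\mathrm d\widehat X^b_r$. **$\gamma$-integrals.** For real functions $F,G$ on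 $[0,T]$ let $$\int_0^tF\,\mathrm d^{\gamma,\pi^n}G=\sum_{k=0}^{N_n-1}\big(F_{t^n_k}+\gamma F_{t^n_k,t^n_{k+1}}\big)\,G_{t^n_k\wedge t,\,t^n_{k+1}\wedge t},\qquad \int_0^tF\,\mathrm d^{\gamma,\pi}G=\lim_{n\to\infty}\int_0^tF\,\mathrm d^{\gamma,\pi^n}G,$$ and define $\int X\otimes\mathrm d^{\gamma,\pi^n}X$, $\int X\otimes\mathrm d^{\gamma,\pi}X$ entrywise. A continuous path $X$ satisfies *Property $\gamma$-(RIE)* relative to $\gamma,p,\pi$ if $\max_k|X_{t^n_k,t^n_{k+1}}|\to0$; the sums $\int_0^tX\otimes\mathrm d^{\gamma,\pi^n}X$ converge uniformly in $t\in[0,T]$ as $n\to\infty$; and there are a control function $c$ (that is, $c:\Delta_T\to[0,\infty)$ with $c(s,u)+c(u,t)\le c(s,t)$ for $s\le u\le t$) and a constant $C$ with $|X_{s,t}|^p\le C\,c(s,t)$ on $\Delta_T$ and $\big|\big(\int_0^\cdot X\otimes\mathrm d^{\gamma,\pi^n}X\big)_{t^n_k,t^n_\ell}-X_{t^n_k}\otimes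 X_{t^n_k,t^n_\ell}\big|^{p/2}\le C\,c(t^n_k,t^n_\ell)$ for all $n$ and $0\le k<\ell\le N_n$. Put $$\mathbb X^{\gamma,\pi,(2)}_{s,t}=\int_0^tX\otimes\mathrm d^{\gamma,\pi}X-\int_0^sX\otimes\mathrm d^{\gamma,\pi}X-X_s\otimes X_{s,t},$$ $$[X^i,X^j]^{\gamma,\pi}_t=X^i_tX^j_t-X^i_0X^j_0-\int_0^tX^i\,\mathrm d^{\gamma,\pi}X^j-\int_0^tX^j\,\mathrm d^{\gamma,\pi}X^i,$$ and $[X]^{\gamma,\pi}=([X^i,X^j]^{\gamma,\pi})_{i,j}$. The *$\gamma$-signature* $\mathbb X^{\gamma,\pi}$ of an $\mathbb R^m$-valued path $X$ has, for words $I$ in the letters $1,\dots,m$, the coordinates $\langle e_\emptyset,\mathbb X^{\gamma,\pi}_t\rangle=1$, $\langle e_{(i)},\mathbb X^{\gamma,\pi}_t\rangle=X^i_{0,t}$, $\langle e_{(i,j)},\mathbb X^{\gamma,\pi}_t\rangle=\int_0^tX^i\,\mathrm d^{\gamma,\pi}X^j-X^i_0X^j_{0,t}$ and, recursively, $\langle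 e_{(I,i)},\mathbb X^{\gamma,\pi}_t\rangle=\int_0^t\langle e_I,\mathbb X^{\gamma,\pi}_r\rangle\,\mathrm d^{\gamma,\pi}X^i_r$ for words $I$ of length at least $2$. **Theorem.** Let $K\subset\widehat{\mathcal C}^p([0,T];\mathbb R^{\hat d})$ be compact and bounded with respect to the rough path seminorm, let $f:K\to\mathbb R$ be continuous, and let $L>0$. Let $K_{\gamma,\pi,L}$ be the set of those elements of $K$ that are of the form $\widehat{\mathbf X}^{\gamma,\pi}=(\widehat X,\widehat{\mathbb X}^{\gamma,\pi,(2)})$, where $\widehat X=(\cdot,X,([X^i,X^j]^{\gamma,\pi})_{i\le j})$ for a path $X:[0,T]\to\mathbb R^d$ that satisfies Property $\gamma$-(RIE) relative to $\gamma,p,\pi$, where $\widehat{\mathbb X}^{\gamma,\pi,(2)}$ is the second-level process defined above for the path $\widehat X$, and for which $$\|(\widehat X,\widehat{\mathbb X}^{\gamma,\pi,(2)})\|_p+\|[\widehat X]^{\gamma,\pi}\|_{p/2}\le L.$$ Then for every $\widehat{\mathbf X}^{\gamma,\pi}\in K_{\gamma,\pi,L}$ the $\gamma$-signature $\widehat{\mathbb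 X}^{\gamma,\pi}$ of $\widehat X$ is well defined (all limits of $\gamma$-Riemann sums in its definition exist), and for every $\varepsilon>0$ there is a linear functional $\ell=\sum_I\ell_Ie_I\in T(\mathbb R^{\hat d})=\bigoplus_{n\ge0}(\mathbb R^{\hat d})^{\otimes n}$ (finitely many nonzero coefficients) such that $$\sup_{\widehat{\mathbf X}^{\gamma,\pi}\in K_{\gamma,\pi,L}}\Big|f(\widehat{\mathbf X}^{\gamma,\pi})-\langle\ell,\widehat{\mathbb X}^{\gamma,\pi}_T\rangle\Big|<\varepsilon,\qquad\langle\ell,\widehat{\mathbb X}^{\gamma,\pi}_T\rangle=\sum_I\ell_I\langle e_I,\widehat{\mathbb X}^{\gamma,\pi}_T\rangle.$$ -/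

import Mathlib

open Filter Topology Set
open scoped ENNReal

noncomputable section

namespace GammaSig

/-! ### Partitions and `p`-variation -/

/-- A partition `s = u₀ < u₁ < ⋯ < u_N = t` of `[s, t]`; only the points `pts 0, …, pts N` matter. -/
structure Partition (s t : ℝ) where
  /-- The number of subintervals. -/
  N : ℕ
  /-- The partition points. -/
  pts : ℕ → ℝ
  pts_zero : pts 0 = s
  pts_last : pts N = t
  pts_lt : ∀ k < N, pts k < pts (k + 1)

/-- The mesh size. -/
def Partition.mesh {s t : ℝ} (P : Partition s t) : ℝ :=
  ⨆ k : Fin P.N, (P.pts (k + 1) - P.pts k)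

/-- The increment `X_{u,v} = X_v - X_u`. -/
def incr {E : Type*} [Sub E] (X : ℝ → E) (u v : ℝ) : E := X v - X u

/-- The `r`-variation of a two-parameter function over `[s, t]`. For a path `X` one
takes `A = incr X`. -/
def pVar {E : Type*} [NormedAddCommGroup E] (r : ℝ) (A : ℝ → ℝ → E) (s t : ℝ) : ℝ≥0∞ :=
  (⨆ P : Partition s t, ∑ k ∈ Finset.range P.N, ‖A (P.pts k) (P.pts (k + 1))‖ₑ ^ r) ^ (1 / r)

theorem pVar_zero {E : Type*} [NormedAddCommGroup E] {r : ℝ} (hr : 1 ≤ r) (s t : ℝ) :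
    pVar r (fun _ _ => (0 : E)) s t = 0 := by
  have h0 : 0 < r := by linarith
  simp [pVar, ENNReal.zero_rpow_of_pos h0, h0]

theorem pVar_sub_comm {E : Type*} [NormedAddCommGroup E] (r : ℝ) (A B : ℝ → ℝ → E) (s t : ℝ) :
    pVar r (fun u v => A u v - B u v) s t = pVar r (fun u v => B u v - A u v) s t := by
  unfold pVar
  simp only [← enorm_neg (A _ _ - B _ _), neg_sub]

theorem pVar_add_le {E : Type*} [NormedAddCommGroup E] {r : ℝ} (hr : 1 ≤ r)
    (A B : ℝ → ℝ → E) (s t : ℝ) :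
    pVar r (fun u v => A u v + B u v) s t ≤ pVar r A s t + pVar r B s t := by
  have h0 : 0 < r := by linarith
  conv_lhs => unfold pVar
  rw [one_div, ENNReal.rpow_inv_le_iff h0]
  refine iSup_le fun P => ?_
  rw [← ENNReal.rpow_inv_le_iff h0, ← one_div]
  have hA : (∑ k ∈ Finset.range P.N, ‖A (P.pts k) (P.pts (k + 1))‖ₑ ^ r) ^ (1 / r)
      ≤ pVar r A s t :=
    ENNReal.rpow_le_rpow (le_iSup (fun P : Partition s t =>
      ∑ k ∈ Finset.range P.N, ‖A (P.pts k) (P.pts (k + 1))‖ₑ ^ r) P) (by positivity)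
  have hB : (∑ k ∈ Finset.range P.N, ‖B (P.pts k) (P.pts (k + 1))‖ₑ ^ r) ^ (1 / r)
      ≤ pVar r B s t :=
    ENNReal.rpow_le_rpow (le_iSup (fun P : Partition s t =>
      ∑ k ∈ Finset.range P.N, ‖B (P.pts k) (P.pts (k + 1))‖ₑ ^ r) P) (by positivity)
  refine le_trans ?_ (add_le_add hA hB)
  refine le_trans ?_ (ENNReal.Lp_add_le _ _ _ hr)
  refine ENNReal.rpow_le_rpow (Finset.sum_le_sum fun k _ => ?_) (by positivity)
  exact ENNReal.rpow_le_rpow (enorm_add_le _ _) h0.le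

theorem pVar_sub_triangle {E : Type*} [NormedAddCommGroup E] {r : ℝ} (hr : 1 ≤ r)
    (A B C : ℝ → ℝ → E) (s t : ℝ) :
    pVar r (fun u v => A u v - C u v) s t ≤
      pVar r (fun u v => A u v - B u v) s t + pVar r (fun u v => B u v - C u v) s t := by
  have h := pVar_add_le hr (fun u v => A u v - B u v) (fun u v => B u v - C u v) s t
  simpa using h

/-! ### Rough paths -/

/-- The simplex `Δ_T`. -/
def simplex (T : ℝ) : Set (ℝ × ℝ) := {q | 0 ≤ q.1 ∧ q.1 ≤ q.2 ∧ q.2 ≤ T}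

/-- Continuous `p`-rough paths over `ℝ^ι` on `[0, T]`, `p ∈ [2, 3)`. The second level takes values
in `ℝ^(ι × ι)`, identified with `ℝ^ι ⊗ ℝ^ι` with its Euclidean norm. Paths are functions on `ℝ`
of which only the values on `[0, T]` (resp. `Δ_T`) are relevant. -/
structure RoughPath (T p : ℝ) (ι : Type) [Fintype ι] where
  /-- The path. -/
  path : ℝ → EuclideanSpace ℝ ι
  /-- The second-level process. -/
  lift : ℝ → ℝ → EuclideanSpace ℝ (ι × ι)
  two_le : 2 ≤ p
  lt_three : p < 3
  continuousOn_path : ContinuousOn path (Icc 0 T)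
  continuousOn_lift : ContinuousOn (fun q : ℝ × ℝ => lift q.1 q.2) (simplex T)
  pVar_path_lt_top : pVar p (incr path) 0 T < ∞
  pVar_lift_lt_top : pVar (p / 2) lift 0 T < ∞
  chen : ∀ s u t, 0 ≤ s → s ≤ u → u ≤ t → t ≤ T → ∀ i j,
    lift s t (i, j) = lift s u (i, j) + lift u t (i, j) + incr path s u i * incr path u t j

namespace RoughPath

variable {T p : ℝ} {ι : Type} [Fintype ι]

/-- The rough path seminorm `‖X‖_p + ‖𝕏‖_{p/2}` over `[0, T]`. -/
def seminorm (X : RoughPath T p ι) : ℝ≥0∞ :=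
  pVar p (incr X.path) 0 T + pVar (p / 2) X.lift 0 T

/-- The rough path (pseudo)distance `‖X - Y‖_p + ‖𝕏 - 𝕐‖_{p/2}`, and the topology it induces. -/
instance : PseudoEMetricSpace (RoughPath T p ι) where
  edist X Y :=
    pVar p (fun u v => incr X.path u v - incr Y.path u v) 0 T +
      pVar (p / 2) (fun u v => X.lift u v - Y.lift u v) 0 T
  edist_self X := by
    have h := X.two_le
    simp [pVar_zero (show (1 : ℝ) ≤ p by linarith),
      pVar_zero (show (1 : ℝ) ≤ p / 2 by linarith)]
  edist_comm X Y := by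
    rw [pVar_sub_comm p, pVar_sub_comm (p / 2)]
  edist_triangle X Y Z := by
    have h := X.two_le
    calc _ ≤ _ := add_le_add
          (pVar_sub_triangle (by linarith) (incr X.path) (incr Y.path) (incr Z.path) 0 T)
          (pVar_sub_triangle (by linarith) X.lift Y.lift Z.lift 0 T)
      _ = _ := by ring

/-- The rough path bracket `[𝐗]_t = X_{0,t} ⊗ X_{0,t} - (𝕏_{0,t} + 𝕏_{0,t}ᵀ)`. -/
def bracket (X : RoughPath T p ι) (t : ℝ) : EuclideanSpace ℝ (ι × ι) :=
  WithLp.toLp 2 fun q =>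
    incr X.path 0 t q.1 * incr X.path 0 t q.2 - (X.lift 0 t q + X.lift 0 t q.swap)

end RoughPath

/-! ### Extension by time and bracket -/

/-- The `1 + d + d(d+1)/2` coordinates of the extended path: time, the coordinates of the path,
and the bracket terms `(i, j)` with `i ≤ j`. -/
abbrev HatIdx (d : ℕ) : Type := Unit ⊕ Fin d ⊕ {q : Fin d × Fin d // q.1 ≤ q.2}

/-- The index of the `i`-th coordinate of the path in the extended path. -/
abbrev HatIdx.coord {d : ℕ} (i : Fin d) : HatIdx d := Sum.inr (Sum.inl i)

/-- The extended path `t ↦ (t, X_t, (B_t^{ij})_{i ≤ j})`. -/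
def extendPath {d : ℕ} (X : ℝ → EuclideanSpace ℝ (Fin d))
    (B : ℝ → EuclideanSpace ℝ (Fin d × Fin d)) (t : ℝ) : EuclideanSpace ℝ (HatIdx d) :=
  WithLp.toLp 2 (Sum.elim (fun _ => t) (Sum.elim (fun i => X t i) (fun q => B t q.1)))

/-- `v` is the Young integral `∫_s^t F dG`: the limit of left-point Riemann sums over all
partitions of `[s, t]` with vanishing mesh. -/
def IsYoungIntegral (F G : ℝ → ℝ) (s t v : ℝ) : Prop :=
  ∀ ε > 0, ∃ δ > 0, ∀ P : Partition s t, P.mesh < δ →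
    |∑ k ∈ Finset.range P.N, F (P.pts k) * incr G (P.pts k) (P.pts (k + 1)) - v| < ε

/-- `Y` is the canonical lift of the extension of the rough path `X` by time and its bracket: the
`X`-block of the second level is that of `X`, all other entries are Young integrals. -/
structure IsExtension {T p : ℝ} {d : ℕ} (X : RoughPath T p (Fin d))
    (Y : RoughPath T p (HatIdx d)) : Prop where
  path_eq : ∀ t ∈ Icc 0 T, Y.path t = extendPath X.path X.bracket t
  lift_coord : ∀ s t, (s, t) ∈ simplex T → ∀ i j,
    Y.lift s t (HatIdx.coord i, HatIdx.coord j) = X.lift s t (i, j)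
  lift_young : ∀ s t, (s, t) ∈ simplex T → ∀ a b : HatIdx d,
    ¬ (∃ i j, a = HatIdx.coord i ∧ b = HatIdx.coord j) →
    IsYoungIntegral (fun r => incr Y.path s r a) (fun r => Y.path r b) s t (Y.lift s t (a, b))

/-- The space of rough paths extended by time and the rough path bracket terms. -/
def extendedRoughPaths (T p : ℝ) (d : ℕ) : Set (RoughPath T p (HatIdx d)) :=
  {Y | ∃ X : RoughPath T p (Fin d), IsExtension X Y}

/-! ### `γ`-Riemann sums, Property `γ`-(RIE) and the `γ`-signature -/

/-- The `γ`-Riemann sum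
`∑_k (F_{t_k} + γ F_{t_k, t_{k+1}}) G_{t_k ∧ t, t_{k+1} ∧ t}`. -/
def gammaSum (γ : ℝ) {T : ℝ} (P : Partition 0 T) (F G : ℝ → ℝ) (t : ℝ) : ℝ :=
  ∑ k ∈ Finset.range P.N,
    (F (P.pts k) + γ * incr F (P.pts k) (P.pts (k + 1))) *
      incr G (min (P.pts k) t) (min (P.pts (k + 1)) t)

/-- The tensor-valued `γ`-Riemann sum `∫_0^t X_r ⊗ d^{γ,P} X_r`. -/
def gammaTensorSum (γ : ℝ) {T : ℝ} (P : Partition 0 T) {ι : Type} [Fintype ι]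
    (X : ℝ → EuclideanSpace ℝ ι) (t : ℝ) : EuclideanSpace ℝ (ι × ι) :=
  WithLp.toLp 2 fun q => gammaSum γ P (fun r => X r q.1) (fun r => X r q.2) t

/-- The integral `∫_0^t F_r d^{γ,π} G_r`, the limit of the `γ`-Riemann sums along `π`. -/
def gammaIntegral (γ : ℝ) {T : ℝ} (π : ℕ → Partition 0 T) (F G : ℝ → ℝ) (t : ℝ) : ℝ :=
  limUnder atTop (fun n => gammaSum γ (π n) F G t)

/-- Control functions on `Δ_T`: nonnegative and superadditive. -/
structure IsControl (T : ℝ) (c : ℝ → ℝ → ℝ) : Prop where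
  nonneg : ∀ s t, (s, t) ∈ simplex T → 0 ≤ c s t
  superadd : ∀ s u t, 0 ≤ s → s ≤ u → u ≤ t → t ≤ T → c s u + c u t ≤ c s t

/-- Property `γ`-(RIE) of `X` relative to `γ`, `p` and `π`. The bounds on quotients by the control
function are written multiplicatively, in accordance with the convention `0/0 = 0`. -/
structure GammaRIE (γ p : ℝ) {T : ℝ} (π : ℕ → Partition 0 T) {ι : Type} [Fintype ι]
    (X : ℝ → EuclideanSpace ℝ ι) : Prop where
  continuousOn : ContinuousOn X (Icc 0 T)
  osc : Tendsto (fun n => ⨆ k : Fin (π n).N, ‖incr X ((π n).pts k) ((π n).pts (k + 1))‖)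
    atTop (𝓝 0)
  converge : ∃ I : ℝ → EuclideanSpace ℝ (ι × ι),
    TendstoUniformlyOn (fun n t => gammaTensorSum γ (π n) X t) I atTop (Icc 0 T)
  control : ∃ c : ℝ → ℝ → ℝ, IsControl T c ∧ ∃ C : ℝ,
    (∀ s t, (s, t) ∈ simplex T → ‖incr X s t‖ ^ p ≤ C * c s t) ∧
    ∀ n k l, k < l → l ≤ (π n).N →
      ‖incr (gammaTensorSum γ (π n) X) ((π n).pts k) ((π n).pts l) -
          WithLp.toLp 2 (fun q : ι × ι =>
            X ((π n).pts k) q.1 * incr X ((π n).pts k) ((π n).pts l) q.2)‖ ^ (p / 2) ≤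
        C * c ((π n).pts k) ((π n).pts l)

/-- The second-level process
`𝕏^{γ,π}_{s,t} = ∫_0^t X ⊗ d^{γ,π}X - ∫_0^s X ⊗ d^{γ,π}X - X_s ⊗ X_{s,t}`. -/
def gammaLift (γ : ℝ) {T : ℝ} (π : ℕ → Partition 0 T) {ι : Type} [Fintype ι]
    (X : ℝ → EuclideanSpace ℝ ι) (s t : ℝ) : EuclideanSpace ℝ (ι × ι) :=
  WithLp.toLp 2 fun q =>
    gammaIntegral γ π (fun r => X r q.1) (fun r => X r q.2) t -
      gammaIntegral γ π (fun r => X r q.1) (fun r => X r q.2) s - X s q.1 * incr X s t q.2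

/-- The pathwise quadratic variation `[X]^{γ,π}`, which is `0` for `γ = 1/2` and otherwise
`[X^i, X^j]_t = X^i_t X^j_t - X^i_0 X^j_0 - ∫_0^t X^i d^{γ,π}X^j - ∫_0^t X^j d^{γ,π}X^i`. -/
def gammaBracket (γ : ℝ) {T : ℝ} (π : ℕ → Partition 0 T) {ι : Type} [Fintype ι]
    (X : ℝ → EuclideanSpace ℝ ι) (t : ℝ) : EuclideanSpace ℝ (ι × ι) :=
  if γ = 1 / 2 then 0 else
    WithLp.toLp 2 fun q =>
      X t q.1 * X t q.2 - X 0 q.1 * X 0 q.2 -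
        gammaIntegral γ π (fun r => X r q.1) (fun r => X r q.2) t -
        gammaIntegral γ π (fun r => X r q.2) (fun r => X r q.1) t

/-- The `γ`-signature with words read backwards: the head of the list is the last letter, i.e. the
outermost integrator. -/
def gammaSigRev (γ : ℝ) {T : ℝ} (π : ℕ → Partition 0 T) {ι : Type} [Fintype ι]
    (X : ℝ → EuclideanSpace ℝ ι) : List ι → ℝ → ℝ
  | [], _ => 1
  | [i], t => incr X 0 t i
  | [j, i], t => gammaIntegral γ π (fun r => X r i) (fun r => X r j) t - X 0 i * incr X 0 t j
  | l :: j :: i :: w, t =>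
      gammaIntegral γ π (gammaSigRev γ π X (j :: i :: w)) (fun r => X r l) t

/-- The coordinate `⟨e_I, 𝕏^{γ,π}_t⟩` of the `γ`-signature of `X` at the word `I`. -/
def gammaSig (γ : ℝ) {T : ℝ} (π : ℕ → Partition 0 T) {ι : Type} [Fintype ι]
    (X : ℝ → EuclideanSpace ℝ ι) (I : List ι) (t : ℝ) : ℝ :=
  gammaSigRev γ π X I.reverse t

/-- The `γ`-signature of `X` is well defined: all limits of `γ`-Riemann sums in its definition
exist. -/
def GammaSigExists (γ : ℝ) {T : ℝ} (π : ℕ → Partition 0 T) {ι : Type} [Fintype ι]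
    (X : ℝ → EuclideanSpace ℝ ι) : Prop :=
  (∀ i j, ∀ t ∈ Icc 0 T, ∃ v,
    Tendsto (fun n => gammaSum γ (π n) (fun r => X r i) (fun r => X r j) t) atTop (𝓝 v)) ∧
  ∀ (I : List ι) (i : ι), 2 ≤ I.length → ∀ t ∈ Icc 0 T, ∃ v,
    Tendsto (fun n => gammaSum γ (π n) (gammaSig γ π X I) (fun r => X r i) t) atTop (𝓝 v)

/-- The pairing `⟨ℓ, 𝐚⟩` of `ℓ ∈ T(ℝ^ι)` (finitely many coefficients, indexed by words) with
`𝐚 ∈ T((ℝ^ι))` (arbitrary coefficients). -/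
def pairing {ι : Type} (l : List ι →₀ ℝ) (a : List ι → ℝ) : ℝ :=
  l.sum fun I x => x * a I

/-- The subset of those elements of `K` that are of the form `(X̂, 𝕏̂^{γ,π})` with
`X̂ = (·, X, Q^{γ,π}(X))`, for `X` satisfying Property `γ`-(RIE), and
`‖(X̂, 𝕏̂^{γ,π})‖_p + ‖[X̂]^{γ,π}‖_{p/2} ≤ L`. -/
def gammaSubset {T p : ℝ} {d : ℕ} (γ : ℝ) (π : ℕ → Partition 0 T) (L : ℝ)
    (K : Set (RoughPath T p (HatIdx d))) : Set (RoughPath T p (HatIdx d)) :=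
  {Y | Y ∈ K ∧ ∃ X : ℝ → EuclideanSpace ℝ (Fin d),
    GammaRIE γ p π X ∧
    (∀ t ∈ Icc 0 T, Y.path t = extendPath X (gammaBracket γ π X) t) ∧
    (∀ s t, (s, t) ∈ simplex T → Y.lift s t = gammaLift γ π Y.path s t) ∧
    Y.seminorm + pVar (p / 2) (incr (gammaBracket γ π Y.path)) 0 T ≤ ENNReal.ofReal L}

end GammaSig

end

/-! On the set in question the γ-signature is the rough path signature in disguise, and linear
functionals of the rough path signature of extended rough paths are dense by Stone–Weierstrass.

The signature of a rough path is built word by word by sewing. If `S^w` is the coordinate of the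
word `w`, the next coordinates have the local expansion `S^{wj}_s Y^l_{s,t} + S^w_s 𝕐^{jl}_{s,t}`.
Chen's relation bounds its additivity defect by `ω(s,t)^{3/q}` for a control `ω`, and `3/q > 1`
makes sewing work. The exponent `q` lies strictly between `p` and `3`. This gap pays for an
interpolation: a uniform bound on increments and a bound on the `p`-variation make the `q`-variation
over short intervals small, uniformly near a given rough path within a bounded set. Hence one
Riemann sum approximates a coordinate on a whole neighbourhood (`exists_abs_sig_sub_riemannSum_lt`),
and coordinates are continuous on bounded sets (`continuousOn_sig_apply`).

Most later identities follow one principle: a path with increments of order `ω^{3/q}` is constant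
(`eq_of_abs_incr_le`), so two paths with the same initial value and the same local expansion up to
this order agree. For extended rough paths the product `Y^a_{s,t} Y^b_{s,t}` is `𝕐^{ab} + 𝕐^{ba}`
plus the increment of a bracket, and this bracket is itself a coordinate. Products of signature
coordinates are therefore sums of signature coordinates, indexed by the quasi-shuffle of the words
(`productFormula`), and linear functionals form an algebra. They separate points up to distance
zero: appending time letters produces iterated time integrals, whose terminal values determine a
coordinate at all times, and the coordinates of length one and two determine the increments and the
second level (`edist_eq_zero_of_sig_terminal`).

For the identification of the two signatures, γ-Riemann sums differ from second-order Riemann sums,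
up to vanishing terms, by a weighted sum of `γ Y^j Y^l - 𝕐^{jl}` over the partition intervals. If
`j` or `l` is time or a bracket, every summand is of order `3/q`. Otherwise the summands are
increments of the error of the second-level γ-sums. Property γ-(RIE) makes this error uniformly
small with bounded `p/2`-variation along the partitions. By interpolation its `q/2`-variation tends
to zero, and a discrete Young estimate removes the weighted sum (`SigBound.tendsto_sum_mul_incr`).
-/

namespace GammaSig

/-! ### The sewing lemma -/

/-- The constant of the maximal inequality for almost additive functions. -/
noncomputable def sewConst (θ : ℝ) : ℝ := 2 / (1 - 2 ^ (1 - θ))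

theorem sewConst_denom_pos {θ : ℝ} (hθ : 1 < θ) : 0 < 1 - (2 : ℝ) ^ (1 - θ) :=
  sub_pos.2 (Real.rpow_lt_one_of_one_lt_of_neg one_lt_two (by linarith))

theorem sewConst_nonneg {θ : ℝ} (hθ : 1 < θ) : 0 ≤ sewConst θ :=
  div_nonneg zero_le_two (sewConst_denom_pos hθ).le

/-- The recursion that dictates the constant: two halves of the control plus two additivity defects
must reproduce the same bound. -/
theorem sewConst_step {θ : ℝ} (hθ : 1 < θ) {x : ℝ} (hx : 0 ≤ x) :
    sewConst θ * (x / 2) ^ θ + sewConst θ * (x / 2) ^ θ + x ^ θ + x ^ θ = sewConst θ * x ^ θ := by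
  have h := (sewConst_denom_pos hθ).ne'
  have h2 : (2 : ℝ) ^ θ ≠ 0 := (Real.rpow_pos_of_pos two_pos θ).ne'
  have h1 : (x / 2) ^ θ = x ^ θ * 2 ^ (1 - θ) / 2 := by
    rw [Real.div_rpow hx zero_le_two, Real.rpow_sub two_pos, Real.rpow_one]
    field_simp
  rw [h1]
  have h3 : sewConst θ * (1 - 2 ^ (1 - θ)) = 2 := by
    unfold sewConst; field_simp
  linear_combination (-x ^ θ) * h3

/-- A discrete interval splits into two intervals carrying at most half of the
control and one elementary interval. -/
theorem exists_half_split {N : ℕ} {ω : ℕ → ℕ → ℝ} (h0 : ∀ i j, i ≤ j → j ≤ N → 0 ≤ ω i j)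
    (hs : ∀ i j k, i ≤ j → j ≤ k → k ≤ N → ω i j + ω j k ≤ ω i k)
    {a b : ℕ} (hab : a < b) (hb : b ≤ N) :
    ∃ j, a ≤ j ∧ j < b ∧ ω a j ≤ ω a b / 2 ∧ ω (j + 1) b ≤ ω a b / 2 := by
  have hdiag : ∀ i ≤ N, ω i i = 0 := fun i hi => by
    have h1 := hs i i i le_rfl le_rfl hi
    have h2 := h0 i i le_rfl hi
    linarith
  have hnn := h0 a b hab.le hb
  by_contra hcon
  push Not at hcon
  -- If no index works, a left part of at most half forces a right part of more than half, and
  -- superadditivity then keeps the next left part below half. This propagates up to `b - 1`, where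
  -- the right part is empty and has control zero.
  have key : ∀ j, a ≤ j → j < b → ω a j ≤ ω a b / 2 := by
    intro j haj
    induction j, haj using Nat.le_induction with
    | base => intro _; rw [hdiag a (by omega)]; linarith
    | succ j haj ih =>
      intro hj
      have h1 := hcon j haj (by omega) (ih (by omega))
      have h2 := hs a (j + 1) b (by omega) (by omega) hb
      linarith
  have h1 := hcon (b - 1) (by omega) (by omega) (key (b - 1) (by omega) (by omega))
  rw [Nat.sub_add_cancel (by omega), hdiag b hb] at h1
  linarith

/-- Maximal inequality for almost additive functions on a discrete interval. -/
theorem abs_sum_Ico_sub_le {θ C : ℝ} (hθ : 1 < θ) (hC : 0 ≤ C) {N : ℕ} {ω Ξ : ℕ → ℕ → ℝ}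
    (h0 : ∀ i j, i ≤ j → j ≤ N → 0 ≤ ω i j)
    (hs : ∀ i j k, i ≤ j → j ≤ k → k ≤ N → ω i j + ω j k ≤ ω i k)
    (hΞ : ∀ i j k, i ≤ j → j ≤ k → k ≤ N → |Ξ i k - Ξ i j - Ξ j k| ≤ C * ω i k ^ θ) :
    ∀ n a b, a ≤ b → b ≤ N → b - a ≤ n →
      |∑ i ∈ Finset.Ico a b, Ξ i (i + 1) - Ξ a b| ≤ C * (sewConst θ * ω a b ^ θ) := by
  have hθ0 : θ ≠ 0 := by linarith
  have hdiag : ∀ i ≤ N, ω i i = 0 := fun i hi => by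
    have h1 := hs i i i le_rfl le_rfl hi
    have h2 := h0 i i le_rfl hi
    linarith
  intro n
  induction n with
  | zero =>
    intro a b hab hb hn
    obtain rfl : a = b := by omega
    have h1 := hΞ a a a le_rfl le_rfl hb
    rw [hdiag a hb, Real.zero_rpow hθ0] at h1 ⊢
    simp only [sub_self, zero_sub, abs_neg, mul_zero, Finset.Ico_self, Finset.sum_empty] at h1 ⊢
    exact h1
  | succ n ih =>
    intro a b hab hb hn
    rcases hab.eq_or_lt with rfl | hab'
    · exact ih a a le_rfl hb (by omega)
    -- Remove the elementary interval `[j, j+1]`, which contributes no error. The outer parts carry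
    -- at most half the control each, and cutting at `j` and then at `j + 1` costs two defects.
    obtain ⟨j, haj, hjb, hl, hr⟩ := exists_half_split h0 hs hab' hb
    have e1 := ih a j haj (by omega) (by omega)
    have e2 := ih (j + 1) b (by omega) hb (by omega)
    have d1 := hΞ a j b haj hjb.le hb
    have d2 := hΞ j (j + 1) b (by omega) (by omega) hb
    have m1 : ω a j ^ θ ≤ (ω a b / 2) ^ θ :=
      Real.rpow_le_rpow (h0 _ _ haj (by omega)) hl (by linarith)
    have m2 : ω (j + 1) b ^ θ ≤ (ω a b / 2) ^ θ :=
      Real.rpow_le_rpow (h0 _ _ (by omega) hb) hr (by linarith)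
    have m3 : ω j b ^ θ ≤ ω a b ^ θ :=
      Real.rpow_le_rpow (h0 _ _ hjb.le hb)
        (by linarith [hs a j b haj hjb.le hb, h0 a j haj (by omega)]) (by linarith)
    have hK := sewConst_nonneg hθ
    have hsum : ∑ i ∈ Finset.Ico a b, Ξ i (i + 1) =
        ∑ i ∈ Finset.Ico a j, Ξ i (i + 1) + (Ξ j (j + 1) +
          ∑ i ∈ Finset.Ico (j + 1) b, Ξ i (i + 1)) := by
      rw [← Finset.sum_eq_sum_Ico_succ_bot hjb (fun i => Ξ i (i + 1)),
        Finset.sum_Ico_consecutive _ haj hjb.le]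
    have hst := sewConst_step hθ (h0 a b hab hb)
    calc |∑ i ∈ Finset.Ico a b, Ξ i (i + 1) - Ξ a b|
        = |(∑ i ∈ Finset.Ico a j, Ξ i (i + 1) - Ξ a j) +
            (∑ i ∈ Finset.Ico (j + 1) b, Ξ i (i + 1) - Ξ (j + 1) b) -
            (Ξ a b - Ξ a j - Ξ j b) - (Ξ j b - Ξ j (j + 1) - Ξ (j + 1) b)| := by
          rw [hsum]; congr 1; ring
      _ ≤ C * (sewConst θ * ω a j ^ θ) + C * (sewConst θ * ω (j + 1) b ^ θ) +
            C * ω a b ^ θ + C * ω j b ^ θ := by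
          refine (abs_sub _ _).trans (add_le_add ((abs_sub _ _).trans
            (add_le_add ((abs_add_le _ _).trans (add_le_add e1 e2)) d1)) d2)
      _ ≤ C * (sewConst θ * (ω a b / 2) ^ θ) + C * (sewConst θ * (ω a b / 2) ^ θ) +
            C * ω a b ^ θ + C * ω a b ^ θ := by gcongr
      _ = C * (sewConst θ * ω a b ^ θ) := by rw [← hst]; ring

/-- `u 0 ≤ u 1 ≤ ⋯ ≤ u N` is a (weakly increasing) subdivision of `[s, t]`. -/
structure IsSubdivision (u : ℕ → ℝ) (N : ℕ) (s t : ℝ) : Prop where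
  zero : u 0 = s
  last : u N = t
  mono : Monotone u

namespace IsSubdivision

variable {u v : ℕ → ℝ} {N M : ℕ} {s t : ℝ}

theorem le_left (h : IsSubdivision u N s t) (k : ℕ) : s ≤ u k := h.zero ▸ h.mono (Nat.zero_le k)

theorem le_right (h : IsSubdivision u N s t) {k : ℕ} (hk : k ≤ N) : u k ≤ t := h.last ▸ h.mono hk

theorem le (h : IsSubdivision u N s t) : s ≤ t := h.last ▸ h.le_left N

/-- The intersection of a subdivision with a subinterval. -/
theorem clamp (h : IsSubdivision u N s t) {a b : ℝ} (ha : s ≤ a) (hab : a ≤ b) (hb : b ≤ t) :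
    IsSubdivision (fun k => max a (min b (u k))) N a b where
  zero := by
    simp only [h.zero]
    rw [min_eq_right (ha.trans hab), max_eq_left ha]
  last := by
    simp only [h.last]
    rw [min_eq_left hb, max_eq_right hab]
  mono := fun i j hij => max_le_max le_rfl (min_le_min le_rfl (h.mono hij))

end IsSubdivision

/-- The Riemann sum of a two-parameter function along the points `u 0, …, u N`. -/
def riemannSum (Ξ : ℝ → ℝ → ℝ) (u : ℕ → ℝ) (N : ℕ) : ℝ :=
  ∑ k ∈ Finset.range N, Ξ (u k) (u (k + 1))

/-- `Ξ` is almost additive of order `θ` with respect to the control `ω`. -/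
def AlmostAdditive (T θ C : ℝ) (ω Ξ : ℝ → ℝ → ℝ) : Prop :=
  ∀ s u t, 0 ≤ s → s ≤ u → u ≤ t → t ≤ T → |Ξ s t - Ξ s u - Ξ u t| ≤ C * ω s t ^ θ

/-- The control `ω` is uniformly small on short intervals. -/
def VanishesOnDiag (T : ℝ) (ω : ℝ → ℝ → ℝ) : Prop :=
  ∀ ε > 0, ∃ δ > 0, ∀ s t, (s, t) ∈ simplex T → t - s < δ → ω s t < ε

section Sewing

variable {T θ C : ℝ} {ω Ξ : ℝ → ℝ → ℝ} {u v : ℕ → ℝ} {N M : ℕ} {s t : ℝ}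

theorem IsControl.diag (hω : IsControl T ω) {s : ℝ} (hs : 0 ≤ s) (hsT : s ≤ T) : ω s s = 0 := by
  have h1 := hω.superadd s s s hs le_rfl le_rfl hsT
  have h2 := hω.nonneg s s ⟨hs, le_rfl, hsT⟩
  linarith

theorem IsControl.mono (hω : IsControl T ω) {s s' t' t : ℝ} (h0 : 0 ≤ s) (h1 : s ≤ s')
    (h2 : s' ≤ t') (h3 : t' ≤ t) (h4 : t ≤ T) : ω s' t' ≤ ω s t := by
  have e1 := hω.superadd s s' t h0 h1 (h2.trans h3) h4
  have e2 := hω.superadd s' t' t (h0.trans h1) h2 h3 h4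
  have e3 := hω.nonneg s s' ⟨h0, h1, by linarith⟩
  have e4 := hω.nonneg t' t ⟨by linarith, h3, h4⟩
  linarith

theorem AlmostAdditive.diag (hΞ : AlmostAdditive T θ C ω Ξ) (hω : IsControl T ω) (hθ : 1 < θ)
    {s : ℝ} (hs : 0 ≤ s) (hsT : s ≤ T) : Ξ s s = 0 := by
  have h := hΞ s s s hs le_rfl le_rfl hsT
  rw [hω.diag hs hsT, Real.zero_rpow (by linarith), mul_zero, sub_self, zero_sub, abs_neg] at h
  exact abs_nonpos_iff.1 h

theorem AlmostAdditive.abs_riemannSum_sub_le (hΞ : AlmostAdditive T θ C ω Ξ) (hω : IsControl T ω)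
    (hθ : 1 < θ) (hC : 0 ≤ C) (hs : 0 ≤ s) (ht : t ≤ T) (hu : IsSubdivision u N s t) :
    |riemannSum Ξ u N - Ξ s t| ≤ C * (sewConst θ * ω s t ^ θ) := by
  have hl : ∀ k, 0 ≤ u k := fun k => hs.trans (hu.le_left k)
  have hr : ∀ k ≤ N, u k ≤ T := fun k hk => (hu.le_right hk).trans ht
  have h := abs_sum_Ico_sub_le hθ hC (N := N) (ω := fun i j => ω (u i) (u j))
    (Ξ := fun i j => Ξ (u i) (u j))
    (fun i j hij hj => hω.nonneg _ _ ⟨hl i, hu.mono hij, hr j hj⟩)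
    (fun i j k hij hjk hk => hω.superadd _ _ _ (hl i) (hu.mono hij) (hu.mono hjk) (hr k hk))
    (fun i j k hij hjk hk => hΞ _ _ _ (hl i) (hu.mono hij) (hu.mono hjk) (hr k hk))
    N 0 N (Nat.zero_le N) le_rfl le_rfl
  simpa only [riemannSum, Nat.Ico_zero_eq_range, hu.zero, hu.last] using h

/-- Comparison of a Riemann sum with the Riemann sum along a common refinement. -/
theorem AlmostAdditive.abs_riemannSum_sub_refine_le (hΞ : AlmostAdditive T θ C ω Ξ)
    (hω : IsControl T ω) (hθ : 1 < θ) (hC : 0 ≤ C) (hs : 0 ≤ s) (ht : t ≤ T)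
    (hu : IsSubdivision u N s t) (hv : IsSubdivision v M s t) :
    |∑ k ∈ Finset.range N, riemannSum Ξ (fun j => max (u k) (min (u (k + 1)) (v j))) M -
      riemannSum Ξ u N| ≤ C * (sewConst θ * riemannSum (fun a b => ω a b ^ θ) u N) := by
  unfold riemannSum
  rw [← Finset.sum_sub_distrib, Finset.mul_sum, Finset.mul_sum]
  refine (Finset.abs_sum_le_sum_abs _ _).trans (Finset.sum_le_sum fun k hk => ?_)
  have hk' : k < N := Finset.mem_range.1 hk
  exact hΞ.abs_riemannSum_sub_le hω hθ hC (hs.trans (hu.le_left k)) ((hu.le_right hk').trans ht)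
    (hv.clamp (hu.le_left k) (hu.mono (Nat.le_succ k)) (hu.le_right hk'))

/-- Both sides evaluate `Ξ` on the intersection of `[a,b]` and `[c,d]`, or on a degenerate interval
if they do not meet. Consequently the refinement of one subdivision by another gives the same sum in
either order. -/
theorem clamp_swap {a b c d : ℝ} (hab : a ≤ b) (hcd : c ≤ d)
    (h0 : ∀ x ∈ ({a, b, c, d} : Set ℝ), Ξ x x = 0) :
    Ξ (max a (min b c)) (max a (min b d)) = Ξ (max c (min d a)) (max c (min d b)) := by
  simp only [mem_insert_iff, mem_singleton_iff, forall_eq_or_imp, forall_eq] at h0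
  obtain ⟨ha, hb, hc, hd⟩ := h0
  rcases lt_or_ge b c with h | h
  · rw [min_eq_left h.le, min_eq_left (h.le.trans hcd), max_eq_right hab,
      max_eq_left ((min_le_right _ _).trans (hab.trans h.le)),
      max_eq_left ((min_le_right _ _).trans h.le), hb, hc]
  rcases lt_or_ge d a with h' | h'
  · rw [min_eq_left h'.le, min_eq_left (h'.le.trans hab), max_eq_right hcd,
      max_eq_left ((min_le_right _ _).trans (hcd.trans h'.le)),
      max_eq_left ((min_le_right _ _).trans h'.le), ha, hd]
  rw [min_eq_right h, min_eq_right h', max_comm a c, max_eq_right (le_min hab h'),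
    max_eq_right (le_min hcd h), min_comm]

/-- Comparison of the Riemann sums of an almost additive function along two subdivisions. -/
theorem AlmostAdditive.abs_riemannSum_sub_riemannSum_le (hΞ : AlmostAdditive T θ C ω Ξ)
    (hω : IsControl T ω) (hθ : 1 < θ) (hC : 0 ≤ C) (hs : 0 ≤ s) (ht : t ≤ T)
    (hu : IsSubdivision u N s t) (hv : IsSubdivision v M s t) :
    |riemannSum Ξ u N - riemannSum Ξ v M| ≤
      C * (sewConst θ * riemannSum (fun a b => ω a b ^ θ) u N) +
      C * (sewConst θ * riemannSum (fun a b => ω a b ^ θ) v M) := by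
  have h1 := hΞ.abs_riemannSum_sub_refine_le hω hθ hC hs ht hu hv
  have h2 := hΞ.abs_riemannSum_sub_refine_le hω hθ hC hs ht hv hu
  have h3 : ∑ k ∈ Finset.range N, riemannSum Ξ (fun j => max (u k) (min (u (k + 1)) (v j))) M =
      ∑ k ∈ Finset.range M, riemannSum Ξ (fun j => max (v k) (min (v (k + 1)) (u j))) N := by
    unfold riemannSum
    rw [Finset.sum_comm]
    refine Finset.sum_congr rfl fun j hj => Finset.sum_congr rfl fun k hk => ?_
    have hj' : j < M := Finset.mem_range.1 hj
    have hk' : k < N := Finset.mem_range.1 hk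
    have hu' : ∀ i ≤ N, Ξ (u i) (u i) = 0 := fun i hi =>
      hΞ.diag hω hθ (hs.trans (hu.le_left i)) ((hu.le_right hi).trans ht)
    have hv' : ∀ i ≤ M, Ξ (v i) (v i) = 0 := fun i hi =>
      hΞ.diag hω hθ (hs.trans (hv.le_left i)) ((hv.le_right hi).trans ht)
    refine clamp_swap (hu.mono (Nat.le_succ k)) (hv.mono (Nat.le_succ j)) ?_
    simp only [mem_insert_iff, mem_singleton_iff, forall_eq_or_imp, forall_eq]
    exact ⟨hu' k (by omega), hu' (k + 1) (by omega), hv' j (by omega), hv' (j + 1) (by omega)⟩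
  rw [h3] at h1
  rw [abs_le] at h1 h2 ⊢
  constructor <;> linarith

theorem IsControl.riemannSum_le (hω : IsControl T ω) (hs : 0 ≤ s) (ht : t ≤ T)
    (hu : IsSubdivision u N s t) : riemannSum ω u N ≤ ω s t := by
  have key : ∀ n ≤ N, riemannSum ω u n ≤ ω s (u n) := by
    intro n
    induction n with
    | zero =>
      intro _
      simp only [riemannSum, Finset.range_zero, Finset.sum_empty]
      exact hω.nonneg _ _ ⟨hs, hu.le_left 0, (hu.le_right (Nat.zero_le N)).trans ht⟩
    | succ n ih =>
      intro hn
      have h1 := ih (by omega)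
      have h2 := hω.superadd s (u n) (u (n + 1)) hs (hu.le_left n) (hu.mono (Nat.le_succ n))
        ((hu.le_right hn).trans ht)
      unfold riemannSum at h1 ⊢
      rw [Finset.sum_range_succ]
      linarith
  have h := key N le_rfl
  rwa [hu.last] at h

theorem rpow_le_mul_rpow_sub_one {x ε : ℝ} (hθ : 1 < θ) (hx : 0 ≤ x) (hxε : x ≤ ε) :
    x ^ θ ≤ ε ^ (θ - 1) * x := by
  rcases hx.eq_or_lt with rfl | hx'
  · rw [Real.zero_rpow (by linarith), mul_zero]
  · calc x ^ θ = x ^ (θ - 1) * x := by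
          rw [← Real.rpow_add_one hx'.ne']; congr 1; ring
      _ ≤ ε ^ (θ - 1) * x := by
          gcongr

/-- The power `θ - 1 > 0` is spent on the largest value of `ω`; superadditivity sums what is left.
This is why terms of order `θ` disappear with the mesh. -/
theorem IsControl.riemannSum_rpow_le (hω : IsControl T ω) (hθ : 1 < θ) (hs : 0 ≤ s) (ht : t ≤ T)
    (hu : IsSubdivision u N s t) {ε : ℝ} (hε : 0 ≤ ε) (h : ∀ k < N, ω (u k) (u (k + 1)) ≤ ε) :
    riemannSum (fun a b => ω a b ^ θ) u N ≤ ε ^ (θ - 1) * ω 0 T := by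
  have hst := hu.le
  calc riemannSum (fun a b => ω a b ^ θ) u N ≤ ε ^ (θ - 1) * riemannSum ω u N := by
        unfold riemannSum
        rw [Finset.mul_sum]
        refine Finset.sum_le_sum fun k hk => ?_
        have hk' : k < N := Finset.mem_range.1 hk
        exact rpow_le_mul_rpow_sub_one hθ (hω.nonneg _ _ ⟨hs.trans (hu.le_left k),
          hu.mono (Nat.le_succ k), (hu.le_right hk').trans ht⟩) (h k hk')
    _ ≤ ε ^ (θ - 1) * ω 0 T := by
        have := Real.rpow_nonneg hε (θ - 1)
        gcongr
        exact (hω.riemannSum_le hs ht hu).trans (hω.mono le_rfl hs hst ht le_rfl)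

/-- Along subdivisions with vanishing mesh, the sums of `ω ^ θ` vanish. -/
theorem IsControl.tendsto_riemannSum_rpow (hω : IsControl T ω) (hd : VanishesOnDiag T ω)
    (hθ : 1 < θ) (hs : 0 ≤ s) (ht : t ≤ T) {u : ℕ → ℕ → ℝ} {N : ℕ → ℕ}
    (hu : ∀ n, IsSubdivision (u n) (N n) s t)
    (hm : ∀ δ > 0, ∀ᶠ n in atTop, ∀ k < N n, u n (k + 1) - u n k < δ) :
    Tendsto (fun n => riemannSum (fun a b => ω a b ^ θ) (u n) (N n)) atTop (𝓝 0) := by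
  have hW : 0 ≤ ω 0 T := hω.nonneg _ _ ⟨le_rfl, hs.trans ((hu 0).le.trans ht), le_rfl⟩
  have hlim : Tendsto (fun ε : ℝ => ε ^ (θ - 1) * ω 0 T) (𝓝[>] 0) (𝓝 0) := by
    have h1 : ContinuousAt (fun ε : ℝ => ε ^ (θ - 1) * ω 0 T) 0 :=
      (Real.continuousAt_rpow_const _ _ (Or.inr (by linarith))).mul continuousAt_const
    have h2 := h1.tendsto
    simp only [Real.zero_rpow (show θ - 1 ≠ 0 by linarith), zero_mul] at h2
    exact h2.mono_left nhdsWithin_le_nhds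
  rw [Metric.tendsto_atTop']
  intro r hr
  obtain ⟨ε, hε, hεr⟩ : ∃ ε > 0, ε ^ (θ - 1) * ω 0 T < r := by
    obtain ⟨ε, h1, h2⟩ := ((hlim.eventually_lt_const hr).and self_mem_nhdsWithin).exists
    exact ⟨ε, h2, h1⟩
  obtain ⟨δ, hδ, hδω⟩ := hd ε hε
  obtain ⟨n₀, hn₀⟩ := eventually_atTop.1 (hm δ hδ)
  refine ⟨n₀, fun n hn => ?_⟩
  have hb : ∀ k < N n, (u n k, u n (k + 1)) ∈ simplex T := fun k hk =>
    ⟨hs.trans ((hu n).le_left k), (hu n).mono (Nat.le_succ k), ((hu n).le_right hk).trans ht⟩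
  have h1 := hω.riemannSum_rpow_le hθ hs ht (hu n) hε.le
    fun k hk => (hδω _ _ (hb k hk) (hn₀ n hn.le k hk)).le
  have h2 : 0 ≤ riemannSum (fun a b => ω a b ^ θ) (u n) (N n) :=
    Finset.sum_nonneg fun k hk => Real.rpow_nonneg (hω.nonneg _ _ (hb k (Finset.mem_range.1 hk))) _
  rw [Real.dist_eq, sub_zero, abs_of_nonneg h2]
  exact h1.trans_lt hεr

/-- The uniform subdivision of `[s, t]` into `n + 1` pieces. -/
noncomputable def uniformPts (s t : ℝ) (n k : ℕ) : ℝ := s + (t - s) * (k / (n + 1))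

theorem isSubdivision_uniformPts {s t : ℝ} (hst : s ≤ t) (n : ℕ) :
    IsSubdivision (uniformPts s t n) (n + 1) s t where
  zero := by simp [uniformPts]
  last := by
    have : (n : ℝ) + 1 ≠ 0 := by positivity
    simp [uniformPts, div_self this]
  mono := fun i j hij => by
    unfold uniformPts
    have := sub_nonneg.2 hst
    gcongr

theorem uniformPts_succ_sub (s t : ℝ) (n k : ℕ) :
    uniformPts s t n (k + 1) - uniformPts s t n k = (t - s) / (n + 1) := by
  unfold uniformPts
  push_cast
  ring

theorem eventually_uniformPts_succ_sub_lt (s t : ℝ) {δ : ℝ} (hδ : 0 < δ) :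
    ∀ᶠ n : ℕ in atTop, ∀ k < n + 1, uniformPts s t n (k + 1) - uniformPts s t n k < δ := by
  have h : Tendsto (fun n : ℕ => (t - s) * (1 / ((n : ℝ) + 1))) atTop (𝓝 ((t - s) * 0)) :=
    tendsto_one_div_add_atTop_nhds_zero_nat.const_mul _
  rw [mul_zero] at h
  filter_upwards [h.eventually_lt_const hδ] with n hn k _
  rw [uniformPts_succ_sub]
  rwa [mul_one_div] at hn

/-- The additive path obtained by sewing the germ `Ξ`. -/
noncomputable def sew (Ξ : ℝ → ℝ → ℝ) (t : ℝ) : ℝ :=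
  limUnder atTop fun n => riemannSum Ξ (uniformPts 0 t n) (n + 1)

theorem AlmostAdditive.tendsto_sew (hΞ : AlmostAdditive T θ C ω Ξ) (hω : IsControl T ω)
    (hd : VanishesOnDiag T ω) (hθ : 1 < θ) (hC : 0 ≤ C) (ht0 : 0 ≤ t) (ht : t ≤ T) :
    Tendsto (fun n => riemannSum Ξ (uniformPts 0 t n) (n + 1)) atTop (𝓝 (sew Ξ t)) := by
  refine CauchySeq.tendsto_limUnder ?_
  have h0 : Tendsto (fun n => C * (sewConst θ *
      riemannSum (fun a b => ω a b ^ θ) (uniformPts 0 t n) (n + 1))) atTop (𝓝 0) := by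
    simpa using ((hω.tendsto_riemannSum_rpow hd hθ le_rfl ht
      (fun n => isSubdivision_uniformPts ht0 n)
      (fun δ hδ => eventually_uniformPts_succ_sub_lt 0 t hδ)).const_mul (sewConst θ)).const_mul C
  rw [Metric.cauchySeq_iff]
  intro ε hε
  obtain ⟨n₀, hn₀⟩ := eventually_atTop.1 (h0.eventually_lt_const (half_pos hε))
  refine ⟨n₀, fun m hm n hn => ?_⟩
  have h := hΞ.abs_riemannSum_sub_riemannSum_le hω hθ hC le_rfl ht
    (isSubdivision_uniformPts ht0 m) (isSubdivision_uniformPts ht0 n)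
  rw [Real.dist_eq]
  linarith [hn₀ m hm, hn₀ n hn]

theorem sew_zero (h : Ξ 0 0 = 0) : sew Ξ 0 = 0 := by
  have : (fun n => riemannSum Ξ (uniformPts 0 0 n) (n + 1)) = fun _ => 0 := by
    funext n
    simp [riemannSum, uniformPts, h]
  rw [sew, this]
  exact tendsto_const_nhds.limUnder_eq

/-- The sewing lemma. -/
theorem AlmostAdditive.abs_incr_sew_sub_le (hΞ : AlmostAdditive T θ C ω Ξ) (hω : IsControl T ω)
    (hd : VanishesOnDiag T ω) (hθ : 1 < θ) (hC : 0 ≤ C) (hs : 0 ≤ s) (hst : s ≤ t) (ht : t ≤ T) :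
    |incr (sew Ξ) s t - Ξ s t| ≤ C * (sewConst θ * ω s t ^ θ) := by
  -- Subdivide `[0,s]` uniformly and keep `[s,t]` as a single last interval. Comparison with the
  -- uniform subdivision of `[0,t]` leaves only the error `ω s t ^ θ` of that interval in the limit.
  let w : ℕ → ℕ → ℝ := fun n k => if k ≤ n + 1 then uniformPts 0 s n k else t
  have hus := fun n => isSubdivision_uniformPts hs n
  have hwk : ∀ n k, k ≤ n + 1 → w n k = uniformPts 0 s n k := fun n k hk => if_pos hk
  have hw : ∀ n, IsSubdivision (w n) (n + 2) 0 t := fun n =>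
    { zero := by rw [hwk n 0 (Nat.zero_le _), (hus n).zero]
      last := if_neg (by omega)
      mono := fun i j hij => by
        simp only [w]
        split_ifs with h1 h2 h2
        · exact (hus n).mono hij
        · exact ((hus n).le_right h1).trans hst
        · omega
        · exact le_rfl }
  have hsum : ∀ (A : ℝ → ℝ → ℝ) n, riemannSum A (w n) (n + 2) =
      riemannSum A (uniformPts 0 s n) (n + 1) + A s t := by
    intro A n
    rw [riemannSum, Finset.sum_range_succ, riemannSum, (hw n).last, hwk n (n + 1) le_rfl,
      (hus n).last]
    congr 1
    refine Finset.sum_congr rfl fun k hk => ?_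
    have := Finset.mem_range.1 hk
    rw [hwk n k (by omega), hwk n (k + 1) (by omega)]
  have hlt := hΞ.tendsto_sew hω hd hθ hC (hs.trans hst) ht
  have hls := hΞ.tendsto_sew hω hd hθ hC hs (hst.trans ht)
  have h0 : ∀ r, 0 ≤ r → r ≤ T → Tendsto (fun n =>
      riemannSum (fun a b => ω a b ^ θ) (uniformPts 0 r n) (n + 1)) atTop (𝓝 0) := fun r hr hrT =>
    hω.tendsto_riemannSum_rpow hd hθ le_rfl hrT (fun n => isSubdivision_uniformPts hr n)
      (fun δ hδ => eventually_uniformPts_succ_sub_lt 0 r hδ)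
  have hL : Tendsto (fun n => |riemannSum Ξ (uniformPts 0 t n) (n + 1) -
      riemannSum Ξ (w n) (n + 2)|) atTop (𝓝 |sew Ξ t - (sew Ξ s + Ξ s t)|) := by
    simp only [hsum]
    exact (hlt.sub (hls.add_const _)).abs
  have hR : Tendsto (fun n => C * (sewConst θ *
        riemannSum (fun a b => ω a b ^ θ) (uniformPts 0 t n) (n + 1)) +
      C * (sewConst θ * riemannSum (fun a b => ω a b ^ θ) (w n) (n + 2))) atTop
      (𝓝 (C * (sewConst θ * 0) + C * (sewConst θ * (0 + ω s t ^ θ)))) := by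
    simp only [hsum]
    exact (((h0 t (hs.trans hst) ht).const_mul _).const_mul _).add
      ((((h0 s hs (hst.trans ht)).add_const _).const_mul _).const_mul _)
  have h := le_of_tendsto_of_tendsto' hL hR fun n =>
    hΞ.abs_riemannSum_sub_riemannSum_le hω hθ hC le_rfl ht
      (isSubdivision_uniformPts (hs.trans hst) n) (hw n)
  rw [mul_zero, mul_zero, zero_add, zero_add] at h
  rwa [incr, sub_sub]

theorem riemannSum_incr (F : ℝ → ℝ) (hu : IsSubdivision u N s t) :
    riemannSum (incr F) u N = F t - F s := by
  unfold riemannSum incr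
  rw [Finset.sum_range_sub (fun k => F (u k)), hu.zero, hu.last]

/-- Telescoping of the local errors. The bound is explicit for each subdivision, which is what
permits estimates uniform over families of rough paths. -/
theorem abs_sub_riemannSum_le {F : ℝ → ℝ} (hs : 0 ≤ s) (ht : t ≤ T)
    (hF : ∀ a b, (a, b) ∈ simplex T → |incr F a b - Ξ a b| ≤ C * ω a b ^ θ)
    (hu : IsSubdivision u N s t) :
    |F t - F s - riemannSum Ξ u N| ≤ C * riemannSum (fun a b => ω a b ^ θ) u N := by
  rw [← riemannSum_incr F hu]
  unfold riemannSum
  rw [← Finset.sum_sub_distrib, Finset.mul_sum]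
  refine (Finset.abs_sum_le_sum_abs _ _).trans (Finset.sum_le_sum fun k hk => ?_)
  exact hF _ _ ⟨hs.trans (hu.le_left k), hu.mono (Nat.le_succ k),
    (hu.le_right (Finset.mem_range.1 hk)).trans ht⟩

/-- A path whose increments are of order `ω ^ θ` with `θ > 1` is constant. -/
theorem eq_of_abs_incr_le {F : ℝ → ℝ} (hω : IsControl T ω) (hd : VanishesOnDiag T ω) (hθ : 1 < θ)
    (hF : ∀ a b, (a, b) ∈ simplex T → |incr F a b| ≤ C * ω a b ^ θ) (ht0 : 0 ≤ t) (ht : t ≤ T) :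
    F t = F 0 := by
  have h0 := (hω.tendsto_riemannSum_rpow hd hθ le_rfl ht
    (fun n => isSubdivision_uniformPts ht0 n)
    (fun δ hδ => eventually_uniformPts_succ_sub_lt 0 t hδ)).const_mul C
  rw [mul_zero] at h0
  have h1 : |F t - F 0| ≤ 0 := ge_of_tendsto' h0 fun n => by
    have h := abs_sub_riemannSum_le (Ξ := fun _ _ => 0) le_rfl ht
      (fun a b hab => by simpa using hF a b hab) (isSubdivision_uniformPts ht0 n)
    simpa [riemannSum] using h
  exact sub_eq_zero.1 (abs_nonpos_iff.1 h1)

end Sewing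

end GammaSig

namespace GammaSig

/-! ### Variation controls -/

theorem Partition.pts_le {s t : ℝ} (P : Partition s t) {i j : ℕ} (hij : i ≤ j) (hj : j ≤ P.N) :
    P.pts i ≤ P.pts j := by
  induction j, hij using Nat.le_induction with
  | base => exact le_rfl
  | succ j _ ih => exact (ih (by omega)).trans (P.pts_lt j (by omega)).le

theorem Partition.left_le {s t : ℝ} (P : Partition s t) {i : ℕ} (hi : i ≤ P.N) : s ≤ P.pts i :=
  P.pts_zero.symm.trans_le (P.pts_le (Nat.zero_le i) hi)

theorem Partition.le_right {s t : ℝ} (P : Partition s t) {i : ℕ} (hi : i ≤ P.N) : P.pts i ≤ t :=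
  (P.pts_le hi le_rfl).trans_eq P.pts_last

/-- Concatenation of partitions of adjacent intervals. -/
noncomputable def Partition.append {s u t : ℝ} (P : Partition s u) (Q : Partition u t) :
    Partition s t where
  N := P.N + Q.N
  pts k := if k ≤ P.N then P.pts k else Q.pts (k - P.N)
  pts_zero := by simp [P.pts_zero]
  pts_last := by
    split_ifs with h
    · have h1 : Q.N = 0 := by omega
      have h2 := Q.pts_last
      rw [h1, Q.pts_zero] at h2
      rw [h1, add_zero, P.pts_last, h2]
    · rw [Nat.add_sub_cancel_left, Q.pts_last]
  pts_lt k hk := by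
    split_ifs with h1 h2 h2
    · exact P.pts_lt k (by omega)
    · obtain rfl : k = P.N := by omega
      have h3 := Q.pts_lt 0 (by omega)
      rw [Q.pts_zero] at h3
      rwa [Nat.add_sub_cancel_left, P.pts_last]
    · omega
    · rw [Nat.sub_add_comm (by omega)]
      exact Q.pts_lt _ (by omega)

/-- The trivial partition of `[s, t]`. -/
def Partition.single {s t : ℝ} (h : s < t) : Partition s t where
  N := 1
  pts k := if k = 0 then s else t
  pts_zero := rfl
  pts_last := rfl
  pts_lt k hk := by
    obtain rfl : k = 0 := by omega
    simpa using h

theorem nonempty_partition {s t : ℝ} (h : s ≤ t) : Nonempty (Partition s t) := by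
  rcases h.eq_or_lt with rfl | h
  · exact ⟨⟨0, fun _ => s, rfl, rfl, fun k hk => by omega⟩⟩
  · exact ⟨Partition.single h⟩

section VarCtrl

variable {E : Type*} [NormedAddCommGroup E] {r r' : ℝ} {A : ℝ → ℝ → E} {s u t T : ℝ}

/-- The supremum of the sums of the `r`-th powers over all partitions of `[s, t]`. -/
noncomputable def varCtrl (r : ℝ) (A : ℝ → ℝ → E) (s t : ℝ) : ℝ≥0∞ :=
  ⨆ P : Partition s t, ∑ k ∈ Finset.range P.N, ‖A (P.pts k) (P.pts (k + 1))‖ₑ ^ r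

theorem varCtrl_eq_pVar_rpow (hr : 0 < r) : varCtrl r A s t = pVar r A s t ^ r := by
  rw [pVar, ← ENNReal.rpow_mul, one_div, inv_mul_cancel₀ hr.ne', ENNReal.rpow_one, varCtrl]

theorem varCtrl_add_le (hsu : s ≤ u) (hut : u ≤ t) :
    varCtrl r A s u + varCtrl r A u t ≤ varCtrl r A s t := by
  have := nonempty_partition hsu
  have := nonempty_partition hut
  refine ENNReal.iSup_add_iSup_le fun P Q => ?_
  refine le_trans (le_of_eq ?_) (le_iSup (fun P : Partition s t =>
    ∑ k ∈ Finset.range P.N, ‖A (P.pts k) (P.pts (k + 1))‖ₑ ^ r) (P.append Q))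
  simp only [Partition.append]
  rw [Finset.sum_range_add]
  congr 1
  · refine Finset.sum_congr rfl fun k hk => ?_
    have := Finset.mem_range.1 hk
    rw [if_pos (by omega), if_pos (by omega)]
  · refine Finset.sum_congr rfl fun k hk => ?_
    rw [if_neg (show ¬ P.N + k + 1 ≤ P.N by omega), show P.N + k + 1 - P.N = k + 1 by omega]
    congr 3
    split_ifs with h
    · obtain rfl : k = 0 := by omega
      rw [add_zero, P.pts_last, Q.pts_zero]
    · rw [Nat.add_sub_cancel_left]

theorem varCtrl_mono {s' t' : ℝ} (h1 : s ≤ s') (h2 : s' ≤ t') (h3 : t' ≤ t) :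
    varCtrl r A s' t' ≤ varCtrl r A s t :=
  calc varCtrl r A s' t' ≤ varCtrl r A s s' + varCtrl r A s' t' := le_add_self
    _ ≤ varCtrl r A s t' := varCtrl_add_le h1 h2
    _ ≤ varCtrl r A s t' + varCtrl r A t' t := le_self_add
    _ ≤ varCtrl r A s t := varCtrl_add_le (h1.trans h2) h3

theorem enorm_rpow_le_varCtrl (hr : 0 < r) (hst : s ≤ t) (hA : A s s = 0) :
    ‖A s t‖ₑ ^ r ≤ varCtrl r A s t := by
  rcases hst.eq_or_lt with rfl | hst
  · simp [hA, hr]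
  · refine le_trans (le_of_eq ?_) (le_iSup (fun P : Partition s t =>
      ∑ k ∈ Finset.range P.N, ‖A (P.pts k) (P.pts (k + 1))‖ₑ ^ r) (Partition.single hst))
    simp [Partition.single]

theorem enorm_le_pVar (hr : 0 < r) (hst : (s, t) ∈ simplex T) (hA : A s s = 0) :
    ‖A s t‖ₑ ≤ pVar r A 0 T := by
  have h := (enorm_rpow_le_varCtrl (r := r) hr hst.2.1 hA).trans
    (varCtrl_mono hst.1 hst.2.1 hst.2.2)
  rw [varCtrl_eq_pVar_rpow hr] at h
  exact (ENNReal.rpow_le_rpow_iff hr).1 h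

/-- Interpolation: a uniform bound improves the variation exponent. -/
theorem varCtrl_le_mul {η : ℝ≥0∞} (hr : 0 < r) (hrr' : r ≤ r')
    (hη : ∀ a b, s ≤ a → a ≤ b → b ≤ t → ‖A a b‖ₑ ≤ η) :
    varCtrl r' A s t ≤ η ^ (r' - r) * varCtrl r A s t := by
  refine iSup_le fun P => ?_
  refine le_trans ?_ (mul_le_mul_right (le_iSup (fun P : Partition s t =>
    ∑ k ∈ Finset.range P.N, ‖A (P.pts k) (P.pts (k + 1))‖ₑ ^ r) P) _)
  rw [Finset.mul_sum]
  refine Finset.sum_le_sum fun k hk => ?_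
  have hk' := Finset.mem_range.1 hk
  have h1 := hη _ _ (P.left_le hk'.le) (P.pts_lt k hk').le (P.le_right hk')
  calc ‖A (P.pts k) (P.pts (k + 1))‖ₑ ^ r'
      = ‖A (P.pts k) (P.pts (k + 1))‖ₑ ^ (r' - r) * ‖A (P.pts k) (P.pts (k + 1))‖ₑ ^ r := by
        rw [← ENNReal.rpow_add_of_nonneg _ _ (sub_nonneg.2 hrr') hr.le, sub_add_cancel]
    _ ≤ _ := by gcongr

theorem isControl_varCtrl (hfin : varCtrl r A 0 T ≠ ∞) :
    IsControl T (fun s t => (varCtrl r A s t).toReal) where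
  nonneg _ _ _ := ENNReal.toReal_nonneg
  superadd s u t h0 hsu hut hT := by
    have h : varCtrl r A s t ≠ ∞ :=
      ne_top_of_le_ne_top hfin (varCtrl_mono h0 (hsu.trans hut) hT)
    have h' := varCtrl_add_le (r := r) (A := A) hsu hut
    rw [← ENNReal.toReal_add (ne_top_of_le_ne_top h (le_self_add.trans h'))
      (ne_top_of_le_ne_top h (le_add_self.trans h'))]
    exact ENNReal.toReal_mono h h'

theorem norm_le_varCtrl_rpow (hr : 0 < r) (hfin : varCtrl r A 0 T ≠ ∞) (hst : (s, t) ∈ simplex T)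
    (hA : A s s = 0) : ‖A s t‖ ≤ (varCtrl r A s t).toReal ^ (1 / r) := by
  have h : varCtrl r A s t ≠ ∞ := ne_top_of_le_ne_top hfin (varCtrl_mono hst.1 hst.2.1 hst.2.2)
  have h' := ENNReal.toReal_mono h (enorm_rpow_le_varCtrl (r := r) hr hst.2.1 hA)
  rw [← ENNReal.toReal_rpow, toReal_enorm] at h'
  rwa [one_div, Real.le_rpow_inv_iff_of_pos (norm_nonneg _) ENNReal.toReal_nonneg hr]

end VarCtrl

/-- Used with `a` the gap between two variation exponents and `C` a power of a seminorm bound: it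
selects the uniform bound on increments needed in the interpolation. -/
theorem exists_rpow_mul_lt {a : ℝ} (ha : 0 < a) {C : ℝ≥0∞} (hC : C ≠ ∞) {ε : ℝ≥0∞} (hε : 0 < ε) :
    ∃ η : ℝ≥0∞, 0 < η ∧ η ^ a * C < ε := by
  have h1 : Tendsto (fun η : ℝ≥0∞ => η ^ a * C) (𝓝 0) (𝓝 0) := by
    have h := ENNReal.Tendsto.mul_const (b := C)
      ((ENNReal.continuous_rpow_const (y := a)).tendsto 0) (Or.inr hC)
    simpa [ENNReal.zero_rpow_of_pos ha] using h
  have h2 : ∀ᶠ η in 𝓝[>] (0 : ℝ≥0∞), η ^ a * C < ε :=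
    (h1.mono_left nhdsWithin_le_nhds).eventually_lt_const hε
  obtain ⟨η, h3, h4⟩ := (h2.and self_mem_nhdsWithin).exists
  exact ⟨η, h4, h3⟩

/-! ### The control of a rough path -/

/-- An exponent strictly between `p` and `3`. -/
noncomputable def midExp (p : ℝ) : ℝ := (p + 3) / 2

namespace RoughPath

variable {T p : ℝ} {ι : Type} [Fintype ι]

theorem lift_self (Y : RoughPath T p ι) {s : ℝ} (hs : 0 ≤ s) (hsT : s ≤ T) : Y.lift s s = 0 := by
  ext ⟨i, j⟩
  have h := Y.chen s s s hs le_rfl le_rfl hsT i j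
  simp only [incr, sub_self, PiLp.zero_apply, mul_zero, add_zero] at h ⊢
  linarith

theorem lt_midExp (Y : RoughPath T p ι) : p < midExp p := by
  have := Y.lt_three
  unfold midExp
  linarith

theorem midExp_lt (Y : RoughPath T p ι) : midExp p < 3 := by
  have := Y.lt_three
  unfold midExp
  linarith

theorem midExp_pos (Y : RoughPath T p ι) : 0 < midExp p := by
  have := Y.two_le
  have := Y.lt_midExp
  linarith

theorem one_lt_three_div (Y : RoughPath T p ι) : 1 < 3 / midExp p := by
  rw [one_lt_div Y.midExp_pos]
  exact Y.midExp_lt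

/-- The control of a rough path. -/
noncomputable def ctrl (Y : RoughPath T p ι) (s t : ℝ) : ℝ :=
  (varCtrl (midExp p) (incr Y.path) s t).toReal + (varCtrl (midExp p / 2) Y.lift s t).toReal +
    (t - s)

theorem edist_def (Y Z : RoughPath T p ι) : edist Y Z =
    pVar p (fun u v => incr Y.path u v - incr Z.path u v) 0 T +
      pVar (p / 2) (fun u v => Y.lift u v - Z.lift u v) 0 T := rfl

theorem enorm_incr_sub_le_edist (Y Z : RoughPath T p ι) {s t : ℝ} (hst : (s, t) ∈ simplex T) :
    ‖incr Y.path s t - incr Z.path s t‖ₑ ≤ edist Y Z := by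
  have h := Y.two_le
  rw [edist_def]
  exact (enorm_le_pVar (A := fun u v => incr Y.path u v - incr Z.path u v)
    (by linarith) hst (by simp [incr])).trans le_self_add

theorem enorm_lift_sub_le_edist (Y Z : RoughPath T p ι) {s t : ℝ} (hst : (s, t) ∈ simplex T) :
    ‖Y.lift s t - Z.lift s t‖ₑ ≤ edist Y Z := by
  have h := Y.two_le
  have hs : s ≤ T := hst.2.1.trans hst.2.2
  rw [edist_def]
  exact (enorm_le_pVar (A := fun u v => Y.lift u v - Z.lift u v)
    (by linarith) hst (by simp [Y.lift_self hst.1 hs, Z.lift_self hst.1 hs])).trans le_add_self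

theorem enorm_incr_le_seminorm (Y : RoughPath T p ι) {s t : ℝ} (hst : (s, t) ∈ simplex T) :
    ‖incr Y.path s t‖ₑ ≤ Y.seminorm := by
  have h := Y.two_le
  exact (enorm_le_pVar (A := incr Y.path) (by linarith) hst (by simp [incr])).trans le_self_add

theorem enorm_lift_le_seminorm (Y : RoughPath T p ι) {s t : ℝ} (hst : (s, t) ∈ simplex T) :
    ‖Y.lift s t‖ₑ ≤ Y.seminorm := by
  have h := Y.two_le
  exact (enorm_le_pVar (A := Y.lift) (by linarith) hst
    (Y.lift_self hst.1 (hst.2.1.trans hst.2.2))).trans le_add_self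

theorem seminorm_ne_top (Y : RoughPath T p ι) : Y.seminorm ≠ ∞ :=
  ENNReal.add_ne_top.2 ⟨Y.pVar_path_lt_top.ne, Y.pVar_lift_lt_top.ne⟩

theorem varCtrl_path_le (Y : RoughPath T p ι) : varCtrl p (incr Y.path) 0 T ≤ Y.seminorm ^ p := by
  have h := Y.two_le
  rw [varCtrl_eq_pVar_rpow (by linarith)]
  exact ENNReal.rpow_le_rpow le_self_add (by linarith)

theorem varCtrl_lift_le (Y : RoughPath T p ι) :
    varCtrl (p / 2) Y.lift 0 T ≤ Y.seminorm ^ (p / 2) := by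
  have h := Y.two_le
  rw [varCtrl_eq_pVar_rpow (by linarith)]
  exact ENNReal.rpow_le_rpow le_add_self (by linarith)

theorem varCtrl_path_midExp_le (Y : RoughPath T p ι) :
    varCtrl (midExp p) (incr Y.path) 0 T ≤ Y.seminorm ^ (midExp p - p) * Y.seminorm ^ p := by
  have h := Y.two_le
  refine (varCtrl_le_mul (by linarith) Y.lt_midExp.le fun a b ha hab hb =>
    Y.enorm_incr_le_seminorm ⟨ha, hab, hb⟩).trans ?_
  gcongr
  exact Y.varCtrl_path_le

theorem varCtrl_lift_midExp_le (Y : RoughPath T p ι) :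
    varCtrl (midExp p / 2) Y.lift 0 T ≤
      Y.seminorm ^ (midExp p / 2 - p / 2) * Y.seminorm ^ (p / 2) := by
  have h := Y.two_le
  have h' := Y.lt_midExp
  refine (varCtrl_le_mul (r := p / 2) (by linarith) (by linarith) fun a b ha hab hb =>
    Y.enorm_lift_le_seminorm ⟨ha, hab, hb⟩).trans ?_
  gcongr
  exact Y.varCtrl_lift_le

theorem varCtrl_path_midExp_ne_top (Y : RoughPath T p ι) :
    varCtrl (midExp p) (incr Y.path) 0 T ≠ ∞ := by
  have h := Y.two_le
  have h' := Y.lt_midExp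
  exact ne_top_of_le_ne_top (ENNReal.mul_ne_top
    (ENNReal.rpow_ne_top_of_nonneg (by linarith) Y.seminorm_ne_top)
    (ENNReal.rpow_ne_top_of_nonneg (by linarith) Y.seminorm_ne_top)) Y.varCtrl_path_midExp_le

theorem varCtrl_lift_midExp_ne_top (Y : RoughPath T p ι) :
    varCtrl (midExp p / 2) Y.lift 0 T ≠ ∞ := by
  have h := Y.two_le
  have h' := Y.lt_midExp
  exact ne_top_of_le_ne_top (ENNReal.mul_ne_top
    (ENNReal.rpow_ne_top_of_nonneg (by linarith) Y.seminorm_ne_top)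
    (ENNReal.rpow_ne_top_of_nonneg (by linarith) Y.seminorm_ne_top)) Y.varCtrl_lift_midExp_le

theorem isControl_ctrl (Y : RoughPath T p ι) : IsControl T Y.ctrl where
  nonneg s t h := add_nonneg (add_nonneg ENNReal.toReal_nonneg ENNReal.toReal_nonneg)
    (sub_nonneg.2 h.2.1)
  superadd s u t h0 hsu hut hT := by
    have h1 := (isControl_varCtrl Y.varCtrl_path_midExp_ne_top).superadd s u t h0 hsu hut hT
    have h2 := (isControl_varCtrl Y.varCtrl_lift_midExp_ne_top).superadd s u t h0 hsu hut hT
    simp only [ctrl] at h1 h2 ⊢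
    linarith

theorem abs_apply_le_norm {κ : Type*} [Fintype κ] (x : EuclideanSpace ℝ κ) (i : κ) :
    |x i| ≤ ‖x‖ := by
  rw [← Real.norm_eq_abs]
  exact PiLp.norm_apply_le x i

theorem abs_incr_le_ctrl (Y : RoughPath T p ι) {s t : ℝ} (hst : (s, t) ∈ simplex T) (i : ι) :
    |incr Y.path s t i| ≤ Y.ctrl s t ^ (1 / midExp p) := by
  refine (abs_apply_le_norm _ i).trans ((norm_le_varCtrl_rpow Y.midExp_pos
    Y.varCtrl_path_midExp_ne_top hst (by simp [incr])).trans ?_)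
  have h := Y.midExp_pos
  refine Real.rpow_le_rpow ENNReal.toReal_nonneg ?_ (by positivity)
  have h1 := hst.2.1
  have h2 : 0 ≤ (varCtrl (midExp p / 2) Y.lift s t).toReal := ENNReal.toReal_nonneg
  simp only [ctrl] at h1 ⊢
  linarith

theorem abs_lift_le_ctrl (Y : RoughPath T p ι) {s t : ℝ} (hst : (s, t) ∈ simplex T) (q : ι × ι) :
    |Y.lift s t q| ≤ Y.ctrl s t ^ (2 / midExp p) := by
  have h := Y.midExp_pos
  refine (abs_apply_le_norm _ q).trans ((norm_le_varCtrl_rpow (half_pos h)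
    Y.varCtrl_lift_midExp_ne_top hst (Y.lift_self hst.1 (hst.2.1.trans hst.2.2))).trans ?_)
  rw [one_div_div]
  refine Real.rpow_le_rpow ENNReal.toReal_nonneg ?_ (by positivity)
  have h1 := hst.2.1
  have h2 : 0 ≤ (varCtrl (midExp p) (incr Y.path) s t).toReal := ENNReal.toReal_nonneg
  simp only [ctrl] at h1 ⊢
  linarith

/-- The purpose of the summand `t - s` in the control: it dominates the increments of the time
coordinate. -/
theorem sub_le_ctrl (Y : RoughPath T p ι) (s t : ℝ) : t - s ≤ Y.ctrl s t := by
  have h1 : 0 ≤ (varCtrl (midExp p / 2) Y.lift s t).toReal := ENNReal.toReal_nonneg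
  have h2 : 0 ≤ (varCtrl (midExp p) (incr Y.path) s t).toReal := ENNReal.toReal_nonneg
  simp only [ctrl]
  linarith

/-- The controls of rough paths in a bounded set are uniformly bounded. -/
theorem exists_ctrl_le (T p : ℝ) (ι : Type) [Fintype ι] {M : ℝ≥0∞} (hM : M ≠ ∞) :
    ∃ W, ∀ Y : RoughPath T p ι, Y.seminorm ≤ M → Y.ctrl 0 T ≤ W := by
  refine ⟨(M ^ (midExp p - p) * M ^ p).toReal +
    (M ^ (midExp p / 2 - p / 2) * M ^ (p / 2)).toReal + (T - 0), fun Y hY => ?_⟩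
  have h := Y.two_le
  have h' := Y.lt_midExp
  unfold ctrl
  gcongr
  · exact ENNReal.mul_ne_top (ENNReal.rpow_ne_top_of_nonneg (by linarith) hM)
      (ENNReal.rpow_ne_top_of_nonneg (by linarith) hM)
  · refine Y.varCtrl_path_midExp_le.trans ?_
    gcongr
  · exact ENNReal.mul_ne_top (ENNReal.rpow_ne_top_of_nonneg (by linarith) hM)
      (ENNReal.rpow_ne_top_of_nonneg (by linarith) hM)
  · refine Y.varCtrl_lift_midExp_le.trans ?_
    gcongr
    · linarith

theorem isCompact_simplex (T : ℝ) : IsCompact (simplex T) := by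
  refine (isCompact_Icc (a := ((0 : ℝ), (0 : ℝ))) (b := (T, T))).of_isClosed_subset ?_ ?_
  · simp only [simplex, ofPred_and]
    exact (isClosed_le continuous_const continuous_fst).inter
      ((isClosed_le continuous_fst continuous_snd).inter
        (isClosed_le continuous_snd continuous_const))
  · rintro ⟨s, t⟩ ⟨h1, h2, h3⟩
    exact ⟨⟨h1, h1.trans h2⟩, ⟨h2.trans h3, h3⟩⟩

theorem exists_enorm_incr_le (Y : RoughPath T p ι) {η : ℝ≥0∞} (hη : 0 < η) :
    ∃ δ > 0, ∀ s t, (s, t) ∈ simplex T → t - s < δ → ‖incr Y.path s t‖ₑ ≤ η := by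
  have h := isCompact_Icc.uniformContinuousOn_of_continuous Y.continuousOn_path
  rw [EMetric.uniformContinuousOn_iff] at h
  obtain ⟨δ, hδ, h⟩ := h η hη
  obtain ⟨δ', hδ'0, hδ'⟩ := ENNReal.lt_iff_exists_real_btwn.1 hδ
  refine ⟨δ', by simpa using hδ'.1, fun s t hst hlt => ?_⟩
  obtain ⟨h1, h2, h3⟩ := hst
  simp only at h1 h2 h3
  have h4 := h (a := t) ⟨h1.trans h2, h3⟩ (b := s) ⟨h1, h2.trans h3⟩
    (lt_of_le_of_lt (by rw [edist_dist, Real.dist_eq, abs_of_nonneg (by linarith)]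
                        exact ENNReal.ofReal_le_ofReal hlt.le) hδ'.2)
  rw [edist_eq_enorm_sub] at h4
  exact h4.le

theorem exists_enorm_lift_le (Y : RoughPath T p ι) {η : ℝ≥0∞} (hη : 0 < η) :
    ∃ δ > 0, ∀ s t, (s, t) ∈ simplex T → t - s < δ → ‖Y.lift s t‖ₑ ≤ η := by
  have h := (isCompact_simplex T).uniformContinuousOn_of_continuous Y.continuousOn_lift
  rw [EMetric.uniformContinuousOn_iff] at h
  obtain ⟨δ, hδ, h⟩ := h η hη
  obtain ⟨δ', hδ'0, hδ'⟩ := ENNReal.lt_iff_exists_real_btwn.1 hδ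
  refine ⟨δ', by simpa using hδ'.1, fun s t hst hlt => ?_⟩
  have hs : s ≤ T := hst.2.1.trans hst.2.2
  have h4 := h (a := (s, t)) hst (b := (s, s)) ⟨hst.1, le_rfl, hs⟩
    (lt_of_le_of_lt (by rw [Prod.edist_eq, edist_self, max_eq_right zero_le, edist_dist,
                          Real.dist_eq, abs_of_nonneg (sub_nonneg.2 hst.2.1)]
                        exact ENNReal.ofReal_le_ofReal hlt.le) hδ'.2)
  simp only [Y.lift_self hst.1 hs, edist_zero_right] at h4
  exact h4.le

/-- The controls of rough paths near `Y` are uniformly small on short intervals. -/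
theorem exists_ctrl_lt (Y : RoughPath T p ι) {M : ℝ≥0∞} (hM : M ≠ ∞) {ε : ℝ} (hε : 0 < ε) :
    ∃ ρ > 0, ∃ δ > 0, ∀ Z : RoughPath T p ι, Z.seminorm ≤ M → edist Z Y < ρ →
      ∀ s t, (s, t) ∈ simplex T → t - s < δ → Z.ctrl s t < ε := by
  have hp := Y.two_le
  have hq := Y.lt_midExp
  have hε3 : 0 < ENNReal.ofReal (ε / 3) := by simpa using by positivity
  -- Interpolation bounds the two variation terms by `η₁ ^ (q - p) * M ^ p` and its analogue for the
  -- second level, with `q = midExp p`. Half of each `η` is allotted to the modulus of continuity of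
  -- `Y`, the other half to the distance of `Z` from `Y`.
  obtain ⟨η₁, hη₁, h₁⟩ := exists_rpow_mul_lt (a := midExp p - p) (by linarith)
    (ENNReal.rpow_ne_top_of_nonneg (y := p) (by linarith) hM) hε3
  obtain ⟨η₂, hη₂, h₂⟩ := exists_rpow_mul_lt (a := midExp p / 2 - p / 2) (by linarith)
    (ENNReal.rpow_ne_top_of_nonneg (y := p / 2) (by linarith) hM) hε3
  obtain ⟨δ₁, hδ₁, k₁⟩ := Y.exists_enorm_incr_le (ENNReal.half_pos hη₁.ne')
  obtain ⟨δ₂, hδ₂, k₂⟩ := Y.exists_enorm_lift_le (ENNReal.half_pos hη₂.ne')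
  refine ⟨min (η₁ / 2) (η₂ / 2), lt_min (ENNReal.half_pos hη₁.ne') (ENNReal.half_pos hη₂.ne'),
    min (min δ₁ δ₂) (ε / 3), lt_min (lt_min hδ₁ hδ₂) (by positivity), ?_⟩
  intro Z hZM hZY s t hst hlt
  have hlt1 : t - s < δ₁ := hlt.trans_le ((min_le_left _ _).trans (min_le_left _ _))
  have hlt2 : t - s < δ₂ := hlt.trans_le ((min_le_left _ _).trans (min_le_right _ _))
  have hlt3 : t - s < ε / 3 := hlt.trans_le (min_le_right _ _)
  have hsub : ∀ a b, s ≤ a → a ≤ b → b ≤ t → (a, b) ∈ simplex T := fun a b h1 h2 h3 =>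
    ⟨hst.1.trans h1, h2, h3.trans hst.2.2⟩
  have e₁ : varCtrl (midExp p) (incr Z.path) s t < ENNReal.ofReal (ε / 3) := by
    refine lt_of_le_of_lt ((varCtrl_le_mul (r := p) (η := η₁) (by linarith) hq.le ?_).trans ?_) h₁
    · intro a b h1 h2 h3
      calc ‖incr Z.path a b‖ₑ
          = ‖(incr Z.path a b - incr Y.path a b) + incr Y.path a b‖ₑ := by rw [sub_add_cancel]
        _ ≤ ‖incr Z.path a b - incr Y.path a b‖ₑ + ‖incr Y.path a b‖ₑ := enorm_add_le _ _
        _ ≤ η₁ / 2 + η₁ / 2 := add_le_add ((Z.enorm_incr_sub_le_edist Y (hsub a b h1 h2 h3)).trans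
            (hZY.le.trans (min_le_left _ _))) (k₁ a b (hsub a b h1 h2 h3) (by linarith))
        _ = η₁ := ENNReal.add_halves _
    · gcongr
      exact (varCtrl_mono hst.1 hst.2.1 hst.2.2).trans (Z.varCtrl_path_le.trans
        (ENNReal.rpow_le_rpow hZM (by linarith)))
  have e₂ : varCtrl (midExp p / 2) Z.lift s t < ENNReal.ofReal (ε / 3) := by
    refine lt_of_le_of_lt ((varCtrl_le_mul (r := p / 2) (η := η₂) (by linarith)
      (by linarith) ?_).trans ?_) h₂
    · intro a b h1 h2 h3
      calc ‖Z.lift a b‖ₑ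
          = ‖(Z.lift a b - Y.lift a b) + Y.lift a b‖ₑ := by rw [sub_add_cancel]
        _ ≤ ‖Z.lift a b - Y.lift a b‖ₑ + ‖Y.lift a b‖ₑ := enorm_add_le _ _
        _ ≤ η₂ / 2 + η₂ / 2 := add_le_add ((Z.enorm_lift_sub_le_edist Y (hsub a b h1 h2 h3)).trans
            (hZY.le.trans (min_le_right _ _))) (k₂ a b (hsub a b h1 h2 h3) (by linarith))
        _ = η₂ := ENNReal.add_halves _
    · gcongr
      exact (varCtrl_mono hst.1 hst.2.1 hst.2.2).trans (Z.varCtrl_lift_le.trans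
        (ENNReal.rpow_le_rpow hZM (by linarith)))
  have e₁' := ENNReal.toReal_lt_of_lt_ofReal e₁
  have e₂' := ENNReal.toReal_lt_of_lt_ofReal e₂
  unfold ctrl
  linarith

theorem vanishesOnDiag_ctrl (Y : RoughPath T p ι) : VanishesOnDiag T Y.ctrl := by
  intro ε hε
  obtain ⟨ρ, hρ, δ, hδ, h⟩ := Y.exists_ctrl_lt Y.seminorm_ne_top hε
  exact ⟨δ, hδ, h Y le_rfl (by rwa [edist_self])⟩

end RoughPath

end GammaSig

namespace GammaSig

/-! ### The signature of a rough path -/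

section Rpow

variable {q x W : ℝ}

theorem rpow_one_mul_two (hx : 0 ≤ x) (hq : 0 < q) :
    x ^ (1 / q) * x ^ (2 / q) = x ^ (3 / q) := by
  rw [← Real.rpow_add_of_nonneg hx (by positivity) (by positivity)]
  congr 1
  ring

theorem rpow_one_mul_one (hx : 0 ≤ x) (hq : 0 < q) :
    x ^ (1 / q) * x ^ (1 / q) = x ^ (2 / q) := by
  rw [← Real.rpow_add_of_nonneg hx (by positivity) (by positivity)]
  congr 1
  ring

theorem rpow_three_le (hx : 0 ≤ x) (hxW : x ≤ W) (hq : 0 < q) :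
    x ^ (3 / q) ≤ W ^ (1 / q) * x ^ (2 / q) := by
  rw [← rpow_one_mul_two hx hq]
  gcongr

theorem rpow_two_le (hx : 0 ≤ x) (hxW : x ≤ W) (hq : 0 < q) :
    x ^ (2 / q) ≤ W ^ (1 / q) * x ^ (1 / q) := by
  rw [← rpow_one_mul_one hx hq]
  gcongr

theorem rpow_one_le (hx : 0 ≤ x) (hxW : x ≤ W) (hq : 0 < q) : x ^ (1 / q) ≤ W ^ (1 / q) :=
  Real.rpow_le_rpow hx hxW (by positivity)

end Rpow

namespace RoughPath

variable {T p : ℝ} {ι : Type} [Fintype ι]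

/-- The signature of a rough path, started at time `0`, with words read backwards: the head of the
list is the last letter. -/
noncomputable def sig (Y : RoughPath T p ι) : List ι → ℝ → ℝ
  | [] => fun _ => 1
  | [l] => fun t => incr Y.path 0 t l
  | l :: j :: w => sew fun s t =>
      sig Y (j :: w) s * incr Y.path s t l + sig Y w s * Y.lift s t (j, l)

/-- The first-order local approximation of the signature. -/
noncomputable def sigLead (Y : RoughPath T p ι) : List ι → ℝ → ℝ → ℝ
  | [], _, _ => 0
  | l :: w, s, t => Y.sig w s * incr Y.path s t l

/-- The second-order correction in the local approximation of the signature. -/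
noncomputable def sigCorr (Y : RoughPath T p ι) : List ι → ℝ → ℝ → ℝ
  | [], _, _ => 0
  | [_], _, _ => 0
  | l :: j :: w, s, t => Y.sig w s * Y.lift s t (j, l)

/-- The second-order local approximation of the signature. -/
noncomputable def sigGerm (Y : RoughPath T p ι) (w : List ι) (s t : ℝ) : ℝ :=
  Y.sigLead w s t + Y.sigCorr w s t

/-- The signature coordinate `w` is bounded and locally approximated up to order `3 / q`, with
constant `C`. -/
structure SigBound (Y : RoughPath T p ι) (w : List ι) (C : ℝ) : Prop where
  bound : ∀ t ∈ Icc 0 T, |Y.sig w t| ≤ C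
  germ : ∀ s t, (s, t) ∈ simplex T →
    |incr (Y.sig w) s t - Y.sigGerm w s t| ≤ C * Y.ctrl s t ^ (3 / midExp p)
  lead : ∀ s t, (s, t) ∈ simplex T →
    |incr (Y.sig w) s t - Y.sigLead w s t| ≤ C * Y.ctrl s t ^ (2 / midExp p)
  incr_le : ∀ s t, (s, t) ∈ simplex T →
    |incr (Y.sig w) s t| ≤ C * Y.ctrl s t ^ (1 / midExp p)

variable {Y : RoughPath T p ι} {w : List ι} {C C' : ℝ}

theorem incr_path_apply (Y : RoughPath T p ι) (s t : ℝ) (i : ι) :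
    incr Y.path s t i = Y.path t i - Y.path s i := rfl

/-- Chen's relation reduces the defect to two products: a first-order remainder (order `2/q`) times
a path increment (`1/q`), and a signature increment (`1/q`) times a second-level entry (`2/q`). -/
theorem almostAdditive_sigGerm {j l : ι} (h1 : Y.SigBound (j :: w) C) (h2 : Y.SigBound w C')
    (hC : 0 ≤ C) (hC' : 0 ≤ C') :
    AlmostAdditive T (3 / midExp p) (C + C') Y.ctrl (Y.sigGerm (l :: j :: w)) := by
  intro s u t hs hsu hut ht
  have hq := Y.midExp_pos
  have hsu' : (s, u) ∈ simplex T := ⟨hs, hsu, hut.trans ht⟩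
  have hut' : (u, t) ∈ simplex T := ⟨hs.trans hsu, hut, ht⟩
  have hst' : (s, t) ∈ simplex T := ⟨hs, hsu.trans hut, ht⟩
  have n1 := Y.isControl_ctrl.nonneg _ _ hsu'
  have n2 := Y.isControl_ctrl.nonneg _ _ hut'
  have n3 := Y.isControl_ctrl.nonneg _ _ hst'
  have m1 : Y.ctrl s u ≤ Y.ctrl s t := Y.isControl_ctrl.mono hs le_rfl hsu hut ht
  have m2 : Y.ctrl u t ≤ Y.ctrl s t := Y.isControl_ctrl.mono hs hsu hut le_rfl ht
  have e : Y.sigGerm (l :: j :: w) s t - Y.sigGerm (l :: j :: w) s u -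
      Y.sigGerm (l :: j :: w) u t =
      -((incr (Y.sig (j :: w)) s u - Y.sigLead (j :: w) s u) * incr Y.path u t l) -
        incr (Y.sig w) s u * Y.lift u t (j, l) := by
    simp only [sigGerm, sigLead, sigCorr, Y.chen s u t hs hsu hut ht j l]
    simp only [incr, PiLp.sub_apply]
    ring
  rw [e]
  calc _ ≤ |incr (Y.sig (j :: w)) s u - Y.sigLead (j :: w) s u| * |incr Y.path u t l| +
        |incr (Y.sig w) s u| * |Y.lift u t (j, l)| := by
        refine (abs_sub _ _).trans_eq ?_
        rw [abs_neg, abs_mul, abs_mul]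
    _ ≤ (C * Y.ctrl s t ^ (2 / midExp p)) * Y.ctrl s t ^ (1 / midExp p) +
        (C' * Y.ctrl s t ^ (1 / midExp p)) * Y.ctrl s t ^ (2 / midExp p) := by
        gcongr
        · exact (h1.lead s u hsu').trans (by gcongr)
        · exact (Y.abs_incr_le_ctrl hut' l).trans (by gcongr)
        · exact (h2.incr_le s u hsu').trans (by gcongr)
        · exact (Y.abs_lift_le_ctrl hut' _).trans (by gcongr)
    _ = (C + C') * Y.ctrl s t ^ (3 / midExp p) := by
        rw [← rpow_one_mul_two n3 hq]; ring

theorem sig_zero (Y : RoughPath T p ι) (hT : 0 ≤ T) {l : ι} {w : List ι} :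
    Y.sig (l :: w) 0 = 0 := by
  cases w with
  | nil => simp [sig, incr]
  | cons j w =>
    simp only [sig]
    refine sew_zero ?_
    simp [incr, Y.lift_self le_rfl hT]

/-- A local approximation of a signature coordinate yields all other bounds. -/
theorem SigBound.of_germ {l : ι} {W D : ℝ} (hT : 0 ≤ T) (hW : Y.ctrl 0 T ≤ W)
    (hD : 0 ≤ D) (hC : 0 ≤ C) (hC' : 0 ≤ C')
    (hg : ∀ s t, (s, t) ∈ simplex T →
      |incr (Y.sig (l :: w)) s t - Y.sigGerm (l :: w) s t| ≤ D * Y.ctrl s t ^ (3 / midExp p))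
    (hw : ∀ t ∈ Icc 0 T, |Y.sig w t| ≤ C)
    (hc : ∀ s t, (s, t) ∈ simplex T →
      |Y.sigCorr (l :: w) s t| ≤ C' * Y.ctrl s t ^ (2 / midExp p)) :
    Y.SigBound (l :: w) (D + (D * W ^ (1 / midExp p) + C') +
      ((D * W ^ (1 / midExp p) + C') * W ^ (1 / midExp p) + C) +
      ((D * W ^ (1 / midExp p) + C') * W ^ (1 / midExp p) + C) * W ^ (1 / midExp p)) := by
  have hq := Y.midExp_pos
  set V := W ^ (1 / midExp p) with hV
  have hω : ∀ s t, (s, t) ∈ simplex T → 0 ≤ Y.ctrl s t ∧ Y.ctrl s t ≤ W := fun s t hst =>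
    ⟨Y.isControl_ctrl.nonneg _ _ hst,
      (Y.isControl_ctrl.mono le_rfl hst.1 hst.2.1 hst.2.2 le_rfl).trans hW⟩
  have hW0 : 0 ≤ W := (hω 0 T ⟨le_rfl, hT, le_rfl⟩).1.trans hW
  have hV0 : 0 ≤ V := Real.rpow_nonneg hW0 _
  have hlead : ∀ s t, (s, t) ∈ simplex T → |incr (Y.sig (l :: w)) s t - Y.sigLead (l :: w) s t| ≤
      (D * V + C') * Y.ctrl s t ^ (2 / midExp p) := by
    intro s t hst
    calc _ = |(incr (Y.sig (l :: w)) s t - Y.sigGerm (l :: w) s t) + Y.sigCorr (l :: w) s t| := by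
          rw [sigGerm]; congr 1; ring
      _ ≤ D * (V * Y.ctrl s t ^ (2 / midExp p)) + C' * Y.ctrl s t ^ (2 / midExp p) := by
          refine (abs_add_le _ _).trans (add_le_add ((hg s t hst).trans ?_) (hc s t hst))
          gcongr
          exact rpow_three_le (hω s t hst).1 (hω s t hst).2 hq
      _ = _ := by ring
  have hincr : ∀ s t, (s, t) ∈ simplex T → |incr (Y.sig (l :: w)) s t| ≤
      ((D * V + C') * V + C) * Y.ctrl s t ^ (1 / midExp p) := by
    intro s t hst
    calc _ = |(incr (Y.sig (l :: w)) s t - Y.sigLead (l :: w) s t) + Y.sigLead (l :: w) s t| := by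
          rw [sub_add_cancel]
      _ ≤ (D * V + C') * (V * Y.ctrl s t ^ (1 / midExp p)) + C * Y.ctrl s t ^ (1 / midExp p) := by
          refine (abs_add_le _ _).trans (add_le_add ((hlead s t hst).trans ?_) ?_)
          · gcongr
            exact rpow_two_le (hω s t hst).1 (hω s t hst).2 hq
          · rw [sigLead, abs_mul]
            exact mul_le_mul (hw s ⟨hst.1, hst.2.1.trans hst.2.2⟩) (Y.abs_incr_le_ctrl hst l)
              (abs_nonneg _) hC
      _ = _ := by ring
  have hA : 0 ≤ D * V + C' := by positivity
  have hB : 0 ≤ (D * V + C') * V + C := by positivity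
  have hE : 0 ≤ ((D * V + C') * V + C) * V := by positivity
  refine ⟨fun t ht => ?_, fun s t hst => (hg s t hst).trans ?_,
    fun s t hst => (hlead s t hst).trans ?_, fun s t hst => (hincr s t hst).trans ?_⟩
  · have h0t : (0, t) ∈ simplex T := ⟨le_rfl, ht.1, ht.2⟩
    have h := hincr 0 t h0t
    rw [incr, Y.sig_zero hT, sub_zero] at h
    have h2 : ((D * V + C') * V + C) * Y.ctrl 0 t ^ (1 / midExp p) ≤
        ((D * V + C') * V + C) * V := by
      gcongr
      exact rpow_one_le (hω 0 t h0t).1 (hω 0 t h0t).2 hq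
    linarith
  all_goals
    refine mul_le_mul_of_nonneg_right (by linarith) (Real.rpow_nonneg (hω s t hst).1 _)

/-- Uniform bounds for the signature on sets of rough paths with bounded control. -/
theorem exists_sigBound (T p : ℝ) (ι : Type) [Fintype ι] (hT : 0 ≤ T) {W : ℝ} (hW : 0 ≤ W) :
    ∀ w : List ι, ∃ C, 0 ≤ C ∧ ∀ Y : RoughPath T p ι, Y.ctrl 0 T ≤ W → Y.SigBound w C
  | [] => by
    refine ⟨1, zero_le_one, fun Y _ => ⟨fun t _ => by simp [sig], ?_, ?_, ?_⟩⟩ <;>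
    · intro s t hst
      have := Real.rpow_nonneg (Y.isControl_ctrl.nonneg s t hst)
      simp [sig, sigGerm, sigLead, sigCorr, incr, this]
  | [l] => by
    refine ⟨_, ?_, fun Y hY => SigBound.of_germ (D := 0) (C := 1) (C' := 0) hT hY le_rfl
      zero_le_one le_rfl (fun s t _ => ?_) (fun t _ => ?_) (fun s t _ => ?_)⟩
    · positivity
    · simp [sig, sigGerm, sigLead, sigCorr, incr]
    · simp [sig]
    · simp [sigCorr]
  | l :: j :: w => by
    obtain ⟨C₁, hC₁, h₁⟩ := exists_sigBound T p ι hT hW (j :: w)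
    obtain ⟨C₂, hC₂, h₂⟩ := exists_sigBound T p ι hT hW w
    -- The constant is fixed before any `Y` is given, while `p < 3`, and with it the sign of
    -- `sewConst`, is only known from a `Y`; hence the absolute value.
    refine ⟨_, ?_, fun Y hY => SigBound.of_germ (D := (C₁ + C₂) * |sewConst (3 / midExp p)|)
      (C := C₁) (C' := C₂) hT hY (by positivity) hC₁ hC₂ (fun s t hst => ?_) (h₁ Y hY).bound
      (fun s t hst => ?_)⟩
    · positivity
    · have h := (almostAdditive_sigGerm (l := l) (h₁ Y hY) (h₂ Y hY) hC₁ hC₂).abs_incr_sew_sub_le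
        Y.isControl_ctrl Y.vanishesOnDiag_ctrl Y.one_lt_three_div (by positivity)
        hst.1 hst.2.1 hst.2.2
      rw [abs_of_nonneg (sewConst_nonneg Y.one_lt_three_div), mul_assoc]
      exact h
    · rw [sigCorr, abs_mul]
      exact mul_le_mul ((h₂ Y hY).bound s ⟨hst.1, hst.2.1.trans hst.2.2⟩)
        (Y.abs_lift_le_ctrl hst _) (abs_nonneg _) hC₂

theorem exists_sigBound_self (Y : RoughPath T p ι) (hT : 0 ≤ T) (w : List ι) :
    ∃ C, 0 ≤ C ∧ Y.SigBound w C := by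
  obtain ⟨C, hC, h⟩ := exists_sigBound T p ι hT
    (Y.isControl_ctrl.nonneg 0 T ⟨le_rfl, hT, le_rfl⟩) w
  exact ⟨C, hC, h Y le_rfl⟩

/-- By Chen's relation the second level started at `0` has increments exactly equal to the germ that
was sewn, so the difference of the two paths is constant. -/
theorem sig_pair (Y : RoughPath T p ι) (hT : 0 ≤ T) {t : ℝ} (ht : t ∈ Icc 0 T) (i j : ι) :
    Y.sig [j, i] t = Y.lift 0 t (i, j) := by
  obtain ⟨C, hC, h⟩ := Y.exists_sigBound_self hT [j, i]
  have h1 := eq_of_abs_incr_le (F := fun t => Y.sig [j, i] t - Y.lift 0 t (i, j)) (C := C)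
    Y.isControl_ctrl Y.vanishesOnDiag_ctrl Y.one_lt_three_div (fun s t hst => ?_) ht.1 ht.2
  · simp only [Y.sig_zero hT, Y.lift_self le_rfl hT, PiLp.zero_apply] at h1
    linarith
  · have h2 := h.germ s t hst
    have h3 := Y.chen 0 s t le_rfl hst.1 hst.2.1 hst.2.2 i j
    simp only [sigGerm, sigLead, sigCorr] at h2
    convert h2 using 2
    simp only [incr, h3, sig, one_mul]
    ring

theorem SigBound.continuousOn (h : Y.SigBound w C) (hC : 0 ≤ C) :
    ContinuousOn (Y.sig w) (Icc 0 T) := by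
  have hq := Y.midExp_pos
  have hlim : Tendsto (fun x : ℝ => C * x ^ (1 / midExp p)) (𝓝[>] 0) (𝓝 0) := by
    have h1 : ContinuousAt (fun x : ℝ => C * x ^ (1 / midExp p)) 0 :=
      continuousAt_const.mul (Real.continuousAt_rpow_const _ _ (Or.inr (by positivity)))
    have h2 := h1.tendsto
    simp only [Real.zero_rpow (show 1 / midExp p ≠ 0 by positivity), mul_zero] at h2
    exact h2.mono_left nhdsWithin_le_nhds
  have key : ∀ ε > 0, ∃ δ > 0, ∀ s t, (s, t) ∈ simplex T → t - s < δ →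
      |incr (Y.sig w) s t| < ε := by
    intro ε hε
    obtain ⟨x, h1, h2⟩ := ((hlim.eventually_lt_const hε).and self_mem_nhdsWithin).exists
    obtain ⟨δ, hδ, h3⟩ := Y.vanishesOnDiag_ctrl x h2
    refine ⟨δ, hδ, fun s t hst hlt => (h.incr_le s t hst).trans_lt (lt_of_le_of_lt ?_ h1)⟩
    have := Y.isControl_ctrl.nonneg s t hst
    have := (h3 s t hst hlt).le
    gcongr
  rw [Metric.continuousOn_iff]
  intro b hb ε hε
  obtain ⟨δ, hδ, hδ'⟩ := key ε hε
  refine ⟨δ, hδ, fun a ha hab => ?_⟩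
  rw [Real.dist_eq] at hab ⊢
  rw [abs_lt] at hab
  rcases le_total a b with h | h
  · rw [abs_sub_comm]
    exact hδ' a b ⟨ha.1, h, hb.2⟩ (by linarith)
  · exact hδ' b a ⟨hb.1, h, ha.2⟩ (by linarith)

theorem continuousOn_sig (Y : RoughPath T p ι) (hT : 0 ≤ T) (w : List ι) :
    ContinuousOn (Y.sig w) (Icc 0 T) := by
  obtain ⟨C, hC, h⟩ := Y.exists_sigBound_self hT w
  exact h.continuousOn hC

/-! ### Continuity of the signature -/

theorem continuous_incr_path_apply {s t : ℝ} (hst : (s, t) ∈ simplex T) (i : ι) :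
    Continuous fun Y : RoughPath T p ι => incr Y.path s t i := by
  have h : LipschitzWith 1 fun Y : RoughPath T p ι => incr Y.path s t := fun Y Z => by
    rw [ENNReal.coe_one, one_mul, edist_eq_enorm_sub]
    exact Y.enorm_incr_sub_le_edist Z hst
  exact (EuclideanSpace.proj i).continuous.comp h.continuous

theorem continuous_lift_apply {s t : ℝ} (hst : (s, t) ∈ simplex T) (q : ι × ι) :
    Continuous fun Y : RoughPath T p ι => Y.lift s t q := by
  have h : LipschitzWith 1 fun Y : RoughPath T p ι => Y.lift s t := fun Y Z => by
    rw [ENNReal.coe_one, one_mul, edist_eq_enorm_sub]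
    exact Y.enorm_lift_sub_le_edist Z hst
  exact (EuclideanSpace.proj q).continuous.comp h.continuous

/-- Near a rough path, signature coordinates are uniformly approximated by Riemann sums. -/
theorem exists_abs_sig_sub_riemannSum_lt (Y : RoughPath T p ι) (hT : 0 ≤ T) {M : ℝ≥0∞}
    (hM : M ≠ ∞) (l : ι) (w : List ι) {t : ℝ} (ht : t ∈ Icc 0 T) {ε : ℝ} (hε : 0 < ε) :
    ∃ ρ > 0, ∃ n : ℕ, ∀ Z : RoughPath T p ι, Z.seminorm ≤ M → edist Z Y < ρ →
      |Z.sig (l :: w) t - riemannSum (Z.sigGerm (l :: w)) (uniformPts 0 t n) (n + 1)| < ε := by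
  obtain ⟨W, hW⟩ := exists_ctrl_le T p ι hM
  obtain ⟨C, hC, hb⟩ := exists_sigBound T p ι hT (le_max_right W 0) (l :: w)
  have hθ := Y.one_lt_three_div
  have hlim : Tendsto (fun x : ℝ => C * (x ^ (3 / midExp p - 1) * max W 0)) (𝓝[>] 0) (𝓝 0) := by
    have h1 : ContinuousAt (fun x : ℝ => C * (x ^ (3 / midExp p - 1) * max W 0)) 0 :=
      continuousAt_const.mul ((Real.continuousAt_rpow_const _ _ (Or.inr (by linarith))).mul
        continuousAt_const)
    have h2 := h1.tendsto
    simp only [Real.zero_rpow (show 3 / midExp p - 1 ≠ 0 by linarith), mul_zero, zero_mul] at h2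
    exact h2.mono_left nhdsWithin_le_nhds
  obtain ⟨x, h1, h2⟩ := ((hlim.eventually_lt_const hε).and self_mem_nhdsWithin).exists
  have hx : 0 < x := h2
  obtain ⟨ρ, hρ, δ, hδ, h3⟩ := Y.exists_ctrl_lt hM hx
  -- A single `n` serves every `Z` near `Y`, since `δ` does not depend on `Z`.
  obtain ⟨n, hn⟩ := (eventually_uniformPts_succ_sub_lt 0 t hδ).exists
  refine ⟨ρ, hρ, n, fun Z hZM hZY => ?_⟩
  have hZW : Z.ctrl 0 T ≤ max W 0 := (hW Z hZM).trans (le_max_left _ _)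
  have hu := isSubdivision_uniformPts ht.1 n
  have h4 := abs_sub_riemannSum_le le_rfl ht.2 (hb Z hZW).germ hu
  rw [Z.sig_zero hT, sub_zero] at h4
  refine h4.trans_lt (lt_of_le_of_lt ?_ h1)
  gcongr
  refine (Z.isControl_ctrl.riemannSum_rpow_le hθ le_rfl ht.2 hu hx.le fun k hk => ?_).trans ?_
  · exact (h3 Z hZM hZY _ _ ⟨hu.le_left k, hu.mono (Nat.le_succ k), (hu.le_right hk).trans ht.2⟩
      (hn k hk)).le
  · gcongr

/-- Signature coordinates are continuous on bounded sets of rough paths. -/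
theorem continuousOn_sig_apply (hT : 0 ≤ T) {M : ℝ≥0∞} (hM : M ≠ ∞) :
    ∀ w : List ι, ∀ t ∈ Icc 0 T,
      ContinuousOn (fun Y : RoughPath T p ι => Y.sig w t) {Y | Y.seminorm ≤ M}
  | [], t, _ => by
    simp only [sig]
    exact continuousOn_const
  | [l], t, ht => (continuous_incr_path_apply ⟨le_rfl, ht.1, ht.2⟩ l).continuousOn
  | l :: j :: w, t, ht => by
    intro Y hY
    -- The coordinate is locally a uniform limit of Riemann sums of fixed length, whose summands are
    -- continuous by recursion on shorter words and by the Lipschitz dependence of increments and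
    -- second level.
    refine continuousWithinAt_of_locally_uniform_approx_of_continuousWithinAt hY fun U hU => ?_
    obtain ⟨ε, hε, hεU⟩ := Metric.mem_uniformity_dist.1 hU
    obtain ⟨ρ, hρ, n, h⟩ := Y.exists_abs_sig_sub_riemannSum_lt hT hM l (j :: w) ht hε
    refine ⟨{Z | Z.seminorm ≤ M} ∩ Metric.eball Y ρ, inter_mem_nhdsWithin _
      (Metric.eball_mem_nhds Y hρ),
      fun Z => riemannSum (Z.sigGerm (l :: j :: w)) (uniformPts 0 t n) (n + 1), ?_, ?_⟩
    · have hu := isSubdivision_uniformPts ht.1 n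
      unfold riemannSum
      refine tendsto_finsetSum _ fun k hk => ?_
      have hk' := Finset.mem_range.1 hk
      have hk0 : uniformPts 0 t n k ∈ Icc 0 T :=
        ⟨hu.le_left k, (hu.le_right hk'.le).trans ht.2⟩
      have hst : (uniformPts 0 t n k, uniformPts 0 t n (k + 1)) ∈ simplex T :=
        ⟨hk0.1, hu.mono (Nat.le_succ k), (hu.le_right hk').trans ht.2⟩
      exact ((continuousOn_sig_apply hT hM (j :: w) _ hk0 Y hY).mul
          (continuous_incr_path_apply hst l).continuousWithinAt).add
        ((continuousOn_sig_apply hT hM w _ hk0 Y hY).mul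
          (continuous_lift_apply hst (j, l)).continuousWithinAt)
    · rintro Z ⟨hZM, hZY⟩
      exact hεU (by rw [Real.dist_eq]; exact h Z hZM hZY)

end RoughPath

end GammaSig

namespace GammaSig

namespace RoughPath

variable {T p : ℝ} {ι : Type} [Fintype ι]

/-! ### Two-parameter functions of order `3 / q` -/

/-- The two-parameter function `A` is of order `3 / q > 1` with respect to the control of `Y`. -/
def IsSmall (Y : RoughPath T p ι) (A : ℝ → ℝ → ℝ) : Prop :=
  ∃ C, ∀ s t, (s, t) ∈ simplex T → |A s t| ≤ C * Y.ctrl s t ^ (3 / midExp p)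

/-- The path `g` is bounded on `[0, T]`. -/
def BoundedPath (T : ℝ) (g : ℝ → ℝ) : Prop := ∃ C, ∀ t ∈ Icc 0 T, |g t| ≤ C

section IsSmall

variable {Y : RoughPath T p ι} {A B : ℝ → ℝ → ℝ} {g h : ℝ → ℝ}

theorem IsSmall.congr (hA : Y.IsSmall A) (h : ∀ s t, (s, t) ∈ simplex T → B s t = A s t) :
    Y.IsSmall B := by
  obtain ⟨C, hC⟩ := hA
  exact ⟨C, fun s t hst => by rw [h s t hst]; exact hC s t hst⟩

theorem isSmall_zero (Y : RoughPath T p ι) : Y.IsSmall fun _ _ => 0 :=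
  ⟨0, fun s t _ => by simp⟩

theorem IsSmall.add (hA : Y.IsSmall A) (hB : Y.IsSmall B) :
    Y.IsSmall fun s t => A s t + B s t := by
  obtain ⟨C, hC⟩ := hA
  obtain ⟨D, hD⟩ := hB
  refine ⟨C + D, fun s t hst => (abs_add_le _ _).trans ?_⟩
  rw [add_mul]
  exact add_le_add (hC s t hst) (hD s t hst)

theorem IsSmall.neg (hA : Y.IsSmall A) : Y.IsSmall fun s t => -A s t := by
  obtain ⟨C, hC⟩ := hA
  exact ⟨C, fun s t hst => by rw [abs_neg]; exact hC s t hst⟩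

theorem IsSmall.sub (hA : Y.IsSmall A) (hB : Y.IsSmall B) :
    Y.IsSmall fun s t => A s t - B s t :=
  (hA.add hB.neg).congr fun _ _ _ => sub_eq_add_neg _ _

theorem IsSmall.left_mul (hA : Y.IsSmall A) (hg : BoundedPath T g) :
    Y.IsSmall fun s t => g s * A s t := by
  obtain ⟨C, hC⟩ := hA
  obtain ⟨D, hD⟩ := hg
  refine ⟨D * C, fun s t hst => ?_⟩
  have h1 := hD s ⟨hst.1, hst.2.1.trans hst.2.2⟩
  rw [abs_mul, mul_assoc]
  exact mul_le_mul h1 (hC s t hst) (abs_nonneg _) ((abs_nonneg _).trans h1)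

theorem IsSmall.list_sum {α : Type*} (L : List α) {A : α → ℝ → ℝ → ℝ}
    (hA : ∀ a ∈ L, Y.IsSmall (A a)) : Y.IsSmall fun s t => (L.map fun a => A a s t).sum := by
  induction L with
  | nil => simpa using Y.isSmall_zero
  | cons a L ih =>
    simp only [List.map_cons, List.sum_cons]
    exact (hA a (by simp)).add (ih fun b hb => hA b (by simp [hb]))

/-- Products of functions of orders `1 / q` and `2 / q` are of order `3 / q`. -/
theorem isSmall_mul {C D : ℝ}
    (hA : ∀ s t, (s, t) ∈ simplex T → |A s t| ≤ C * Y.ctrl s t ^ (1 / midExp p))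
    (hB : ∀ s t, (s, t) ∈ simplex T → |B s t| ≤ D * Y.ctrl s t ^ (2 / midExp p)) :
    Y.IsSmall fun s t => A s t * B s t := by
  refine ⟨C * D, fun s t hst => ?_⟩
  have h1 := hA s t hst
  rw [abs_mul, ← rpow_one_mul_two (Y.isControl_ctrl.nonneg s t hst) Y.midExp_pos]
  calc _ ≤ (C * Y.ctrl s t ^ (1 / midExp p)) * (D * Y.ctrl s t ^ (2 / midExp p)) :=
        mul_le_mul h1 (hB s t hst) (abs_nonneg _) ((abs_nonneg _).trans h1)
    _ = _ := by ring

theorem IsSmall.eq_of_incr {F : ℝ → ℝ} (hF : Y.IsSmall (incr F)) {t : ℝ} (ht : t ∈ Icc 0 T) :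
    F t = F 0 := by
  obtain ⟨C, hC⟩ := hF
  exact eq_of_abs_incr_le Y.isControl_ctrl Y.vanishesOnDiag_ctrl Y.one_lt_three_div hC ht.1 ht.2

theorem boundedPath_sig (Y : RoughPath T p ι) (hT : 0 ≤ T) (w : List ι) :
    BoundedPath T (Y.sig w) := by
  obtain ⟨C, _, h⟩ := Y.exists_sigBound_self hT w
  exact ⟨C, h.bound⟩

theorem BoundedPath.mul (hg : BoundedPath T g) (hh : BoundedPath T h) :
    BoundedPath T fun t => g t * h t := by
  obtain ⟨C, hC⟩ := hg
  obtain ⟨D, hD⟩ := hh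
  refine ⟨C * D, fun t ht => ?_⟩
  rw [abs_mul]
  exact mul_le_mul (hC t ht) (hD t ht) (abs_nonneg _) ((abs_nonneg _).trans (hC t ht))

theorem isSmall_incr_sig_sub_sigGerm (Y : RoughPath T p ι) (hT : 0 ≤ T) (w : List ι) :
    Y.IsSmall fun s t => incr (Y.sig w) s t - Y.sigGerm w s t := by
  obtain ⟨C, _, h⟩ := Y.exists_sigBound_self hT w
  exact ⟨C, h.germ⟩

/-- The product of two increments of signature coordinates is locally given by the product of
their first-order approximations. -/
theorem isSmall_incr_sig_mul_incr_sig (Y : RoughPath T p ι) (hT : 0 ≤ T) (v w : List ι) :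
    Y.IsSmall fun s t => incr (Y.sig v) s t * incr (Y.sig w) s t -
      Y.sigLead v s t * Y.sigLead w s t := by
  obtain ⟨C, _, h⟩ := Y.exists_sigBound_self hT v
  obtain ⟨D, hD, h'⟩ := Y.exists_sigBound_self hT w
  obtain ⟨B, hB, hlead⟩ : ∃ B, 0 ≤ B ∧ ∀ s t, (s, t) ∈ simplex T →
      |Y.sigLead v s t| ≤ B * Y.ctrl s t ^ (1 / midExp p) := by
    cases v with
    | nil => exact ⟨0, le_rfl, fun s t _ => by simp [sigLead]⟩
    | cons l v =>
      obtain ⟨B, hB, hb⟩ := Y.exists_sigBound_self hT v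
      refine ⟨B, hB, fun s t hst => ?_⟩
      rw [sigLead, abs_mul]
      exact mul_le_mul (hb.bound s ⟨hst.1, hst.2.1.trans hst.2.2⟩) (Y.abs_incr_le_ctrl hst l)
        (abs_nonneg _) hB
  -- With increments `δ` and leading terms `λ`: `δv δw - λv λw = δw (δv - λv) + λv (δw - λw)`, each
  -- product of order `1/q + 2/q`.
  have h1 := isSmall_mul (A := fun s t => incr (Y.sig w) s t)
    (B := fun s t => incr (Y.sig v) s t - Y.sigLead v s t) h'.incr_le h.lead
  have h2 := isSmall_mul hlead h'.lead
  exact (h1.add h2).congr fun s t _ => by ring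

end IsSmall

end RoughPath

/-! ### Extended rough paths -/

/-- The letter of the bracket of two letters, if there is one. -/
def bracketLetter {d : ℕ} : HatIdx d → HatIdx d → Option (HatIdx d)
  | Sum.inr (Sum.inl i), Sum.inr (Sum.inl j) =>
      some (Sum.inr (Sum.inr ⟨(min i j, max i j), min_le_max⟩))
  | _, _ => none

/-- The letter does not belong to a coordinate of the underlying path. -/
def IsYoungLetter {d : ℕ} (a : HatIdx d) : Prop := ∀ i : Fin d, a ≠ HatIdx.coord i

theorem isYoungLetter_of_bracketLetter {d : ℕ} {a b c : HatIdx d}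
    (h : bracketLetter a b = some c) : IsYoungLetter c := by
  intro i hi
  subst hi
  rcases a with _ | _ | _ <;> rcases b with _ | _ | _ <;> simp [bracketLetter] at h

theorem bracketLetter_eq_none {d : ℕ} {a b : HatIdx d} (h : IsYoungLetter a ∨ IsYoungLetter b) :
    bracketLetter a b = none := by
  rcases a with _ | i | _ <;> rcases b with _ | j | _ <;> try rfl
  rcases h with h | h
  · exact absurd rfl (h i)
  · exact absurd rfl (h j)

theorem eq_coord_of_not_isYoungLetter {d : ℕ} {a : HatIdx d} (h : ¬ IsYoungLetter a) :
    ∃ i, a = HatIdx.coord i := by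
  simpa [IsYoungLetter] using h

/-- The uniform partition of `[s, t]` into `n + 1` pieces. -/
noncomputable def Partition.uniform {s t : ℝ} (hst : s < t) (n : ℕ) : Partition s t where
  N := n + 1
  pts := uniformPts s t n
  pts_zero := (isSubdivision_uniformPts hst.le n).zero
  pts_last := (isSubdivision_uniformPts hst.le n).last
  pts_lt k _ := by
    have h1 := uniformPts_succ_sub s t n k
    have h2 : 0 < (t - s) / (n + 1) := div_pos (sub_pos.2 hst) (by positivity)
    linarith

theorem Partition.mesh_uniform {s t : ℝ} (hst : s < t) (n : ℕ) :
    (Partition.uniform hst n).mesh = (t - s) / (n + 1) := by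
  have h : Nonempty (Fin (Partition.uniform hst n).N) := ⟨⟨0, Nat.succ_pos n⟩⟩
  simp only [Partition.mesh, Partition.uniform, uniformPts_succ_sub]
  exact ciSup_const

namespace IsExtension

open RoughPath

variable {T p : ℝ} {d : ℕ} {X : RoughPath T p (Fin d)} {Y : RoughPath T p (HatIdx d)}

theorem incr_time (h : IsExtension X Y) {s t : ℝ} (hst : (s, t) ∈ simplex T) :
    incr Y.path s t (Sum.inl ()) = t - s := by
  rw [incr, h.path_eq t ⟨hst.1.trans hst.2.1, hst.2.2⟩, h.path_eq s ⟨hst.1, hst.2.1.trans hst.2.2⟩]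
  simp [extendPath]

/-- The bracket is defined from time `0`; expanding the square of `X_{0,t}` and applying Chen's
relation cancels all cross terms, so the same formula holds on every `[s,t]`. -/
theorem incr_bracket (h : IsExtension X Y) {s t : ℝ} (hst : (s, t) ∈ simplex T)
    (q : {q : Fin d × Fin d // q.1 ≤ q.2}) :
    incr Y.path s t (Sum.inr (Sum.inr q)) =
      incr Y.path s t (HatIdx.coord q.1.1) * incr Y.path s t (HatIdx.coord q.1.2) -
        Y.lift s t (HatIdx.coord q.1.1, HatIdx.coord q.1.2) -
        Y.lift s t (HatIdx.coord q.1.2, HatIdx.coord q.1.1) := by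
  obtain ⟨⟨i, j⟩, hij⟩ := q
  have h0 : (0 : ℝ) ∈ Icc 0 T := ⟨le_rfl, hst.1.trans (hst.2.1.trans hst.2.2)⟩
  have ht : t ∈ Icc 0 T := ⟨hst.1.trans hst.2.1, hst.2.2⟩
  have hs : s ∈ Icc 0 T := ⟨hst.1, hst.2.1.trans hst.2.2⟩
  have hco : ∀ r ∈ Icc 0 T, ∀ k, X.path r k = Y.path r (HatIdx.coord k) := fun r hr k => by
    rw [h.path_eq r hr]; rfl
  have hli : ∀ r ∈ Icc 0 T, ∀ k l, X.lift 0 r (k, l) =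
      Y.lift 0 r (HatIdx.coord k, HatIdx.coord l) := fun r hr k l =>
    (h.lift_coord 0 r ⟨le_rfl, hr.1, hr.2⟩ k l).symm
  have hbr : ∀ r ∈ Icc 0 T, Y.path r (Sum.inr (Sum.inr ⟨(i, j), hij⟩)) =
      incr Y.path 0 r (HatIdx.coord i) * incr Y.path 0 r (HatIdx.coord j) -
        (Y.lift 0 r (HatIdx.coord i, HatIdx.coord j) +
          Y.lift 0 r (HatIdx.coord j, HatIdx.coord i)) := fun r hr => by
    rw [h.path_eq r hr]
    simp only [extendPath, bracket, Sum.elim_inr, Prod.swap_prod_mk, hli r hr, incr,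
      PiLp.sub_apply, hco r hr, hco 0 h0]
  have c1 := Y.chen 0 s t le_rfl hst.1 hst.2.1 hst.2.2 (HatIdx.coord i) (HatIdx.coord j)
  have c2 := Y.chen 0 s t le_rfl hst.1 hst.2.1 hst.2.2 (HatIdx.coord j) (HatIdx.coord i)
  have e : incr Y.path s t (Sum.inr (Sum.inr ⟨(i, j), hij⟩)) =
    Y.path t (Sum.inr (Sum.inr ⟨(i, j), hij⟩)) - Y.path s (Sum.inr (Sum.inr ⟨(i, j), hij⟩)) := rfl
  rw [e, hbr t ht, hbr s hs, c1, c2]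
  simp only [incr, PiLp.sub_apply]
  ring

/-- Time and bracket coordinates have finite `q / 2`-variation. -/
theorem exists_abs_incr_le (h : IsExtension X Y) : ∃ C, 0 ≤ C ∧
    ∀ b, IsYoungLetter b → ∀ s t, (s, t) ∈ simplex T →
      |incr Y.path s t b| ≤ C * Y.ctrl s t ^ (2 / midExp p) := by
  have hq := Y.midExp_pos
  have hq2 : 2 / midExp p ≤ 1 := by
    rw [div_le_one hq]
    linarith [Y.two_le, Y.lt_midExp]
  set W := |Y.ctrl 0 T| ^ (1 - 2 / midExp p) with hW
  have hW0 : 0 ≤ W := Real.rpow_nonneg (abs_nonneg _) _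
  -- `W` absorbs the excess power of the control for the time coordinate; `3` counts the three terms
  -- of a bracket increment.
  refine ⟨W + 3, by positivity, fun b hb s t hst => ?_⟩
  have n0 := Y.isControl_ctrl.nonneg s t hst
  have n2 := Real.rpow_nonneg n0 (2 / midExp p)
  rcases b with _ | i | q
  · rw [h.incr_time hst, abs_of_nonneg (sub_nonneg.2 hst.2.1)]
    have h1 : Y.ctrl s t ≤ W * Y.ctrl s t ^ (2 / midExp p) := by
      calc Y.ctrl s t = Y.ctrl s t ^ (1 - 2 / midExp p) * Y.ctrl s t ^ (2 / midExp p) := by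
            rw [← Real.rpow_add_of_nonneg n0 (by linarith) (by positivity), sub_add_cancel,
              Real.rpow_one]
        _ ≤ W * Y.ctrl s t ^ (2 / midExp p) := by
            gcongr
            refine Real.rpow_le_rpow n0 ?_ (by linarith)
            exact (Y.isControl_ctrl.mono le_rfl hst.1 hst.2.1 hst.2.2 le_rfl).trans (le_abs_self _)
    linarith [Y.sub_le_ctrl s t]
  · exact absurd rfl (hb i)
  · rw [h.incr_bracket hst]
    have a1 := Y.abs_incr_le_ctrl hst (HatIdx.coord q.1.1)
    have a2 := Y.abs_incr_le_ctrl hst (HatIdx.coord q.1.2)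
    have a3 := Y.abs_lift_le_ctrl hst (HatIdx.coord q.1.1, HatIdx.coord q.1.2)
    have a4 := Y.abs_lift_le_ctrl hst (HatIdx.coord q.1.2, HatIdx.coord q.1.1)
    have a5 := mul_le_mul a1 a2 (abs_nonneg _) ((abs_nonneg _).trans a1)
    rw [rpow_one_mul_one n0 hq, ← abs_mul] at a5
    refine (abs_sub _ _).trans ((add_le_add (abs_sub _ _) le_rfl).trans ?_)
    nlinarith [mul_nonneg hW0 n2]

/-- If one of the letters is a Young letter, then products of increments over adjacent intervals
are of order `3 / q`. -/
theorem exists_abs_mul_incr_le (h : IsExtension X Y) : ∃ C, 0 ≤ C ∧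
    ∀ a b, IsYoungLetter a ∨ IsYoungLetter b → ∀ s s' t' t, 0 ≤ s → s ≤ s' → s' ≤ t' → t' ≤ t →
      t ≤ T → ∀ r r', s ≤ r → r ≤ r' → r' ≤ t →
      |incr Y.path s' t' a * incr Y.path r r' b| ≤ C * Y.ctrl s t ^ (3 / midExp p) := by
  obtain ⟨C, hC, hy⟩ := h.exists_abs_incr_le
  have hq := Y.midExp_pos
  refine ⟨C, hC, fun a b hab s s' t' t h0 h1 h2 h3 h4 r r' k1 k2 k3 => ?_⟩
  have n0 := Y.isControl_ctrl.nonneg s t ⟨h0, h1.trans (h2.trans h3), h4⟩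
  have m1 : (s', t') ∈ simplex T := ⟨h0.trans h1, h2, h3.trans h4⟩
  have m2 : (r, r') ∈ simplex T := ⟨h0.trans k1, k2, k3.trans h4⟩
  have l1 := Y.isControl_ctrl.mono h0 h1 h2 h3 h4
  have l2 := Y.isControl_ctrl.mono h0 k1 k2 k3 h4
  have n1 := Y.isControl_ctrl.nonneg _ _ m1
  have n2 := Y.isControl_ctrl.nonneg _ _ m2
  rw [abs_mul, ← rpow_one_mul_two n0 hq]
  rcases hab with ha | hb
  · calc _ ≤ (C * Y.ctrl s t ^ (2 / midExp p)) * Y.ctrl s t ^ (1 / midExp p) := by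
          gcongr
          · exact (hy a ha _ _ m1).trans (by gcongr)
          · exact (Y.abs_incr_le_ctrl m2 b).trans (by gcongr)
      _ = _ := by ring
  · calc _ ≤ Y.ctrl s t ^ (1 / midExp p) * (C * Y.ctrl s t ^ (2 / midExp p)) := by
          gcongr
          · exact (Y.abs_incr_le_ctrl m1 a).trans (by gcongr)
          · exact (hy b hb _ _ m2).trans (by gcongr)
      _ = _ := by ring

theorem isSmall_incr_mul_incr (h : IsExtension X Y) {a b : HatIdx d}
    (hab : IsYoungLetter a ∨ IsYoungLetter b) :
    Y.IsSmall fun s t => incr Y.path s t a * incr Y.path s t b := by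
  obtain ⟨C, _, hC⟩ := h.exists_abs_mul_incr_le
  exact ⟨C, fun s t hst => hC a b hab s s t t hst.1 le_rfl hst.2.1 le_rfl hst.2.2 s t le_rfl
    hst.2.1 le_rfl⟩

/-- The Young entries of the second level are of order `3 / q`. -/
theorem isSmall_lift (h : IsExtension X Y) {a b : HatIdx d}
    (hab : IsYoungLetter a ∨ IsYoungLetter b) : Y.IsSmall fun s t => Y.lift s t (a, b) := by
  obtain ⟨C, hC0, hC⟩ := h.exists_abs_mul_incr_le
  refine ⟨C * sewConst (3 / midExp p), fun s t hst => ?_⟩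
  have n0 := Y.isControl_ctrl.nonneg s t hst
  rcases hst.2.1.eq_or_lt with heq | hlt
  · simp only at heq
    subst heq
    have e : Y.lift s s = 0 := Y.lift_self hst.1 hst.2.2
    simp only [e, PiLp.zero_apply, abs_zero]
    exact mul_nonneg (mul_nonneg hC0 (sewConst_nonneg Y.one_lt_three_div))
      (Real.rpow_nonneg n0 _)
  -- The defect of the left-point germ started at `s` is a product of increments over `[u,v]` and
  -- `[v,w]`. The maximal inequality thus bounds all Riemann sums over `[s,t]` by one constant,
  -- which passes to the Young integral.
  have hΞ : AlmostAdditive T (3 / midExp p) C Y.ctrl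
      (fun u v => incr Y.path s u a * incr Y.path u v b) := by
    intro u v w hu huv hvw hw
    have h1 := hC a b hab u u v w hu le_rfl huv hvw hw v w huv hvw le_rfl
    rw [← abs_neg]
    convert h1 using 2
    simp only [incr, PiLp.sub_apply]
    ring
  have hyoung := h.lift_young s t hst a b (by
    rintro ⟨i, j, rfl, rfl⟩
    rcases hab with hab | hab
    · exact hab i rfl
    · exact hab j rfl)
  refine le_of_forall_pos_le_add fun ε hε => ?_
  obtain ⟨δ, hδ, hP⟩ := hyoung ε hε
  obtain ⟨n, hn⟩ := (eventually_uniformPts_succ_sub_lt s t hδ).exists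
  have hmesh : (Partition.uniform hlt n).mesh < δ := by
    rw [Partition.mesh_uniform, ← uniformPts_succ_sub s t n 0]
    exact hn 0 (Nat.succ_pos n)
  have h1 := hP (Partition.uniform hlt n) hmesh
  have h2 := hΞ.abs_riemannSum_sub_le Y.isControl_ctrl Y.one_lt_three_div hC0 hst.1 hst.2.2
    (isSubdivision_uniformPts hlt.le n)
  -- The germ over the whole interval `[s,t]` vanishes, so the maximal inequality bounds the Riemann
  -- sum itself.
  have h3 : incr Y.path s s a = 0 := by simp [incr]
  rw [h3, zero_mul, sub_zero, ← mul_assoc] at h2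
  have h4 : ∑ k ∈ Finset.range (Partition.uniform hlt n).N,
      incr Y.path s ((Partition.uniform hlt n).pts k) a *
        incr (fun r => Y.path r b) ((Partition.uniform hlt n).pts k)
          ((Partition.uniform hlt n).pts (k + 1)) =
      riemannSum (fun u v => incr Y.path s u a * incr Y.path u v b) (uniformPts s t n) (n + 1) :=
    rfl
  rw [h4, abs_lt] at h1
  rw [abs_le] at h2 ⊢
  constructor <;> linarith

/-- The increment of the bracket of two letters. -/
noncomputable def _root_.GammaSig.bracketIncr (Y : RoughPath T p (HatIdx d)) (a b : HatIdx d)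
    (s t : ℝ) : ℝ :=
  match bracketLetter a b with
  | none => 0
  | some c => incr Y.path s t c

/-- Local integration by parts. With a Young letter every term is of order `3/q` separately; for two
path letters the identity is exact by the definition of the bracket. The surviving bracket is the
source of the third term of the quasi-shuffle. -/
theorem isSmall_product (h : IsExtension X Y) (a b : HatIdx d) :
    Y.IsSmall fun s t => incr Y.path s t a * incr Y.path s t b - Y.lift s t (a, b) -
      Y.lift s t (b, a) - bracketIncr Y a b s t := by
  by_cases hab : IsYoungLetter a ∨ IsYoungLetter b
  · simp only [bracketIncr, bracketLetter_eq_none hab]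
    exact (((h.isSmall_incr_mul_incr hab).sub (h.isSmall_lift hab)).sub
      (h.isSmall_lift hab.symm)).sub Y.isSmall_zero
  · push Not at hab
    obtain ⟨i, rfl⟩ := eq_coord_of_not_isYoungLetter hab.1
    obtain ⟨j, rfl⟩ := eq_coord_of_not_isYoungLetter hab.2
    refine Y.isSmall_zero.congr fun s t hst => ?_
    have h1 := h.incr_bracket hst ⟨(min i j, max i j), min_le_max⟩
    simp only [bracketIncr, bracketLetter]
    rw [h1]
    rcases le_total i j with hij | hij
    · simp only [min_eq_left hij, max_eq_right hij]
      ring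
    · simp only [min_eq_right hij, max_eq_left hij]
      ring

end IsExtension

end GammaSig

namespace GammaSig

/-! ### The quasi-shuffle product -/

/-- The words occurring in the quasi-shuffle product of two words (read backwards). -/
def quasiShuffle {ι : Type} (br : ι → ι → Option ι) : List ι → List ι → List (List ι)
  | [], v => [v]
  | i :: u, [] => [i :: u]
  | i :: u, j :: v =>
      (quasiShuffle br u (j :: v)).map (i :: ·) ++ ((quasiShuffle br (i :: u) v).map (j :: ·) ++
        (br i j).elim [] fun c => (quasiShuffle br u v).map (c :: ·))
  termination_by u v => u.length + v.length

namespace RoughPath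

variable {T p : ℝ} {ι : Type} [Fintype ι]

/-- The sum of the signature coordinates belonging to a list of words. -/
noncomputable def sigSum (Y : RoughPath T p ι) (L : List (List ι)) (t : ℝ) : ℝ :=
  (L.map fun w => Y.sig w t).sum

/-- The sum of the second-order corrections for the words of `L` extended by the letter `i`. -/
noncomputable def corrSum (Y : RoughPath T p ι) (i : ι) (L : List (List ι)) (s t : ℝ) : ℝ :=
  (L.map fun w => Y.sigCorr (i :: w) s t).sum

theorem sigSum_append (Y : RoughPath T p ι) (L L' : List (List ι)) (t : ℝ) :
    Y.sigSum (L ++ L') t = Y.sigSum L t + Y.sigSum L' t := by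
  simp [sigSum]

theorem corrSum_append (Y : RoughPath T p ι) (i : ι) (L L' : List (List ι)) (s t : ℝ) :
    Y.corrSum i (L ++ L') s t = Y.corrSum i L s t + Y.corrSum i L' s t := by
  simp [corrSum]

theorem corrSum_map_cons (Y : RoughPath T p ι) (i k : ι) (L : List (List ι)) (s t : ℝ) :
    Y.corrSum i (L.map (k :: ·)) s t = Y.sigSum L s * Y.lift s t (k, i) := by
  simp only [corrSum, sigSum, List.map_map, ← List.sum_map_mul_right]
  rfl

theorem sigSum_map_cons_zero (Y : RoughPath T p ι) (hT : 0 ≤ T) (i : ι) (L : List (List ι)) :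
    Y.sigSum (L.map (i :: ·)) 0 = 0 := by
  refine List.sum_eq_zero fun x hx => ?_
  simp only [List.map_map, List.mem_map, Function.comp] at hx
  obtain ⟨w, _, rfl⟩ := hx
  exact Y.sig_zero hT

theorem boundedPath_sigSum (Y : RoughPath T p ι) (hT : 0 ≤ T) (L : List (List ι)) :
    BoundedPath T (Y.sigSum L) := by
  induction L with
  | nil => exact ⟨0, fun t _ => by simp [sigSum]⟩
  | cons w L ih =>
    obtain ⟨C, hC⟩ := ih
    obtain ⟨D, hD⟩ := Y.boundedPath_sig hT w
    refine ⟨D + C, fun t ht => ?_⟩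
    have : Y.sigSum (w :: L) t = Y.sig w t + Y.sigSum L t := by simp [sigSum]
    rw [this]
    exact (abs_add_le _ _).trans (add_le_add (hD t ht) (hC t ht))

theorem isSmall_incr_sigSum_map_cons (Y : RoughPath T p ι) (hT : 0 ≤ T) (i : ι)
    (L : List (List ι)) :
    Y.IsSmall fun s t => incr (Y.sigSum (L.map (i :: ·))) s t -
      Y.sigSum L s * incr Y.path s t i - Y.corrSum i L s t := by
  induction L with
  | nil => exact Y.isSmall_zero.congr fun s t _ => by simp [sigSum, corrSum, incr]
  | cons w L ih =>
    refine (ih.add (Y.isSmall_incr_sig_sub_sigGerm hT (i :: w))).congr fun s t _ => ?_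
    simp only [sigSum, corrSum, sigGerm, sigLead, incr, List.map_cons, List.sum_cons]
    ring

end RoughPath

namespace IsExtension

open RoughPath

variable {T p : ℝ} {d : ℕ} {X : RoughPath T p (Fin d)} {Y : RoughPath T p (HatIdx d)}

theorem isSmall_sigCorr (h : IsExtension X Y) (hT : 0 ≤ T) {c : HatIdx d} (hc : IsYoungLetter c)
    (w : List (HatIdx d)) : Y.IsSmall (Y.sigCorr (c :: w)) := by
  cases w with
  | nil => exact Y.isSmall_zero
  | cons k w => exact (h.isSmall_lift (Or.inr hc)).left_mul (Y.boundedPath_sig hT w)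

theorem isSmall_corrSum (h : IsExtension X Y) (hT : 0 ≤ T) {c : HatIdx d} (hc : IsYoungLetter c)
    (L : List (List (HatIdx d))) : Y.IsSmall (Y.corrSum c L) :=
  IsSmall.list_sum L fun w _ => h.isSmall_sigCorr hT hc w

/-- Prefixing a bracket letter leaves only a second-level entry with a Young letter, which is of
order `3/q`. -/
theorem isSmall_corrSum_bracket (h : IsExtension X Y) (hT : 0 ≤ T) (i k j : HatIdx d)
    (L : List (List (HatIdx d))) :
    Y.IsSmall (Y.corrSum i ((bracketLetter k j).elim [] fun c => L.map (c :: ·))) := by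
  rcases hc : bracketLetter k j with _ | c
  · exact Y.isSmall_zero
  · have hy := isYoungLetter_of_bracketLetter hc
    exact ((h.isSmall_lift (b := i) (Or.inl hy)).left_mul (Y.boundedPath_sigSum hT L)).congr
      fun s t _ => Y.corrSum_map_cons i c L s t

theorem isSmall_incr_bracket (h : IsExtension X Y) (hT : 0 ≤ T) (i j : HatIdx d)
    (L : List (List (HatIdx d))) :
    Y.IsSmall fun s t =>
      incr (Y.sigSum ((bracketLetter i j).elim [] fun c => L.map (c :: ·))) s t -
        Y.sigSum L s * bracketIncr Y i j s t := by
  unfold bracketIncr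
  rcases hc : bracketLetter i j with _ | c
  · exact Y.isSmall_zero.congr fun s t _ => by simp [sigSum, incr]
  · have hy := isYoungLetter_of_bracketLetter hc
    exact ((Y.isSmall_incr_sigSum_map_cons hT c L).add (h.isSmall_corrSum hT hy L)).congr
      fun s t _ => by simp

theorem sigSum_bracket_zero (hT : 0 ≤ T) (i j : HatIdx d) (L : List (List (HatIdx d))) :
    Y.sigSum ((bracketLetter i j).elim [] fun c => L.map (c :: ·)) 0 = 0 := by
  rcases bracketLetter i j with _ | c
  · rfl
  · exact Y.sigSum_map_cons_zero hT c L

/-- The product formula holds for the words `u` and `v`. -/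
def _root_.GammaSig.ProductFormula (Y : RoughPath T p (HatIdx d)) (u v : List (HatIdx d)) : Prop :=
  ∀ t ∈ Icc 0 T, Y.sig u t * Y.sig v t = Y.sigSum (quasiShuffle bracketLetter u v) t

/-- The correction depends on the next letter of each word. Expanding the quasi-shuffle once more
sorts the words by that letter: those from `u` and from `j` factor by the product formula for
shorter words, and the bracket ones are negligible. The other block is treated symmetrically. -/
theorem isSmall_corrSum_left (h : IsExtension X Y) (hT : 0 ≤ T) (i j : HatIdx d)
    (u v : List (HatIdx d)) (h1 : ∀ u', u'.length < u.length → ProductFormula Y u' (j :: v))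
    (h2 : ProductFormula Y u v) :
    Y.IsSmall fun s t => Y.corrSum i (quasiShuffle bracketLetter u (j :: v)) s t -
      Y.sig (j :: v) s * Y.sigCorr (i :: u) s t - Y.sig u s * Y.sig v s * Y.lift s t (j, i) := by
  cases u with
  | nil =>
    refine Y.isSmall_zero.congr fun s t _ => ?_
    simp [quasiShuffle, corrSum, sigCorr, sig]
  | cons k u =>
    refine (h.isSmall_corrSum_bracket hT i k j (quasiShuffle bracketLetter u v)).congr
      fun s t hst => ?_
    have hs : s ∈ Icc 0 T := ⟨hst.1, hst.2.1.trans hst.2.2⟩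
    have e1 := h1 u (by simp) s hs
    have e2 := h2 s hs
    rw [quasiShuffle, corrSum_append, corrSum_append, corrSum_map_cons, corrSum_map_cons, ← e1,
      ← e2, sigCorr]
    ring

theorem isSmall_corrSum_right (h : IsExtension X Y) (hT : 0 ≤ T) (i j : HatIdx d)
    (u v : List (HatIdx d)) (h1 : ∀ v', v'.length < v.length → ProductFormula Y (i :: u) v')
    (h2 : ProductFormula Y u v) :
    Y.IsSmall fun s t => Y.corrSum j (quasiShuffle bracketLetter (i :: u) v) s t -
      Y.sig (i :: u) s * Y.sigCorr (j :: v) s t - Y.sig u s * Y.sig v s * Y.lift s t (i, j) := by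
  cases v with
  | nil =>
    refine Y.isSmall_zero.congr fun s t _ => ?_
    simp [quasiShuffle, corrSum, sigCorr, sig]
  | cons k v =>
    refine (h.isSmall_corrSum_bracket hT j i k (quasiShuffle bracketLetter u v)).congr
      fun s t hst => ?_
    have hs : s ∈ Icc 0 T := ⟨hst.1, hst.2.1.trans hst.2.2⟩
    have e1 := h1 v (by simp) s hs
    have e2 := h2 s hs
    rw [quasiShuffle, corrSum_append, corrSum_append, corrSum_map_cons, corrSum_map_cons, ← e1,
      ← e2, sigCorr]
    ring

/-- Products of signature coordinates of extended rough paths are given by the quasi-shuffle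
product. -/
theorem productFormula (h : IsExtension X Y) (hT : 0 ≤ T) :
    ∀ (n : ℕ) (u v : List (HatIdx d)), u.length + v.length ≤ n → ProductFormula Y u v := by
  intro n
  induction n with
  | zero =>
    intro u v huv t _
    obtain rfl : u = [] := List.length_eq_zero_iff.1 (by omega)
    simp [quasiShuffle, sigSum, sig]
  | succ n ih =>
    intro u v huv
    rcases u with _ | ⟨i, u⟩
    · intro t _
      simp [quasiShuffle, sigSum, sig]
    rcases v with _ | ⟨j, v⟩
    · intro t _
      simp [quasiShuffle, sigSum, sig]
    simp only [List.length_cons] at huv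
    have hL := ih u (j :: v) (by simp only [List.length_cons]; omega)
    have hR := ih (i :: u) v (by simp only [List.length_cons]; omega)
    have hB := ih u v (by omega)
    have s1 := Y.isSmall_incr_sigSum_map_cons hT i (quasiShuffle bracketLetter u (j :: v))
    have s2 := Y.isSmall_incr_sigSum_map_cons hT j (quasiShuffle bracketLetter (i :: u) v)
    have s3 := h.isSmall_incr_bracket hT i j (quasiShuffle bracketLetter u v)
    have s4 := h.isSmall_corrSum_left hT i j u v
      (fun u' hu' => ih u' (j :: v) (by simp only [List.length_cons]; omega)) hB
    have s5 := h.isSmall_corrSum_right hT i j u v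
      (fun v' hv' => ih (i :: u) v' (by simp only [List.length_cons]; omega)) hB
    have s6 := (Y.isSmall_incr_sig_sub_sigGerm hT (i :: u)).left_mul
      (Y.boundedPath_sig hT (j :: v))
    have s7 := (Y.isSmall_incr_sig_sub_sigGerm hT (j :: v)).left_mul
      (Y.boundedPath_sig hT (i :: u))
    have s8 := Y.isSmall_incr_sig_mul_incr_sig hT (i :: u) (j :: v)
    have s9 := (h.isSmall_product i j).left_mul
      ((Y.boundedPath_sig hT u).mul (Y.boundedPath_sig hT v))
    -- The increment of a product is `sig v δ(sig u) + sig u δ(sig v) + δ(sig u) δ(sig v)`. Here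
    -- `s6`, `s7` replace single increments by germs, `s8` the product of increments by leading
    -- terms, and `s9` splits the resulting product of path increments. On the quasi-shuffle side
    -- `s1`–`s3` expand the three blocks and `s4`, `s5` evaluate their corrections; everything below
    -- order `3/q` cancels.
    have key : Y.IsSmall (incr fun t => Y.sig (i :: u) t * Y.sig (j :: v) t -
        (Y.sigSum ((quasiShuffle bracketLetter u (j :: v)).map (i :: ·)) t +
          (Y.sigSum ((quasiShuffle bracketLetter (i :: u) v).map (j :: ·)) t +
            Y.sigSum ((bracketLetter i j).elim [] fun c =>
              (quasiShuffle bracketLetter u v).map (c :: ·)) t))) := by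
      refine (((((s6.add s7).add s8).add s9).sub (((s1.add s2).add s3))).sub
        (s4.add s5)).congr fun s t hst => ?_
      have hs : s ∈ Icc 0 T := ⟨hst.1, hst.2.1.trans hst.2.2⟩
      have e1 := hL s hs
      have e2 := hR s hs
      have e3 := hB s hs
      simp only [← e1, ← e2, ← e3, sigGerm, sigLead]
      simp only [incr]
      ring
    intro t ht
    have e := key.eq_of_incr ht
    simp only [Y.sig_zero hT, Y.sigSum_map_cons_zero hT, sigSum_bracket_zero hT] at e
    rw [quasiShuffle, sigSum_append, sigSum_append]
    linarith

theorem sig_mul_sig (h : IsExtension X Y) (hT : 0 ≤ T) (u v : List (HatIdx d)) {t : ℝ}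
    (ht : t ∈ Icc 0 T) :
    Y.sig u t * Y.sig v t = Y.sigSum (quasiShuffle bracketLetter u v) t :=
  h.productFormula hT _ u v le_rfl t ht

/-! ### Separation of points -/

/-- Appending the time letter integrates a signature coordinate with respect to time. -/
theorem sig_time_cons (h : IsExtension X Y) (hT : 0 ≤ T) (w : List (HatIdx d)) {t : ℝ}
    (ht : t ∈ Icc 0 T) : Y.sig (Sum.inl () :: w) t = ∫ r in (0 : ℝ)..t, Y.sig w r := by
  have hy : IsYoungLetter (Sum.inl () : HatIdx d) := fun i => by simp
  have hcont := Y.continuousOn_sig hT w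
  have hint : ∀ a b, a ∈ Icc 0 T → b ∈ Icc 0 T →
      IntervalIntegrable (Y.sig w) MeasureTheory.volume a b := fun a b ha hb =>
    (hcont.mono (uIcc_subset_Icc ha hb)).intervalIntegrable
  have h0 : (0 : ℝ) ∈ Icc 0 T := ⟨le_rfl, hT⟩
  obtain ⟨C, hC, hb⟩ := Y.exists_sigBound_self hT w
  obtain ⟨D, hD, hD'⟩ := h.exists_abs_incr_le
  -- Freezing the integrand at `s` costs an increment of order `1/q` times an interval length of
  -- order `2/q`. The integral then has the same expansion as the signature coordinate.
  have s1 : Y.IsSmall fun s t => (∫ r in s..t, Y.sig w r) - Y.sig w s * (t - s) := by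
    refine ⟨C * D, fun s t hst => ?_⟩
    have hs : s ∈ Icc 0 T := ⟨hst.1, hst.2.1.trans hst.2.2⟩
    have ht : t ∈ Icc 0 T := ⟨hst.1.trans hst.2.1, hst.2.2⟩
    have n0 := Y.isControl_ctrl.nonneg s t hst
    have e : (∫ r in s..t, Y.sig w r) - Y.sig w s * (t - s) =
        ∫ r in s..t, (Y.sig w r - Y.sig w s) := by
      rw [intervalIntegral.integral_sub (hint s t hs ht) intervalIntegrable_const,
        intervalIntegral.integral_const, smul_eq_mul, mul_comm]
    have k1 := intervalIntegral.norm_integral_le_of_norm_le_const (a := s) (b := t)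
      (C := C * Y.ctrl s t ^ (1 / midExp p)) (f := fun r => Y.sig w r - Y.sig w s) (fun r hr => by
        rw [uIoc_of_le hst.2.1] at hr
        have hsr : (s, r) ∈ simplex T := ⟨hst.1, hr.1.le, hr.2.trans hst.2.2⟩
        refine (hb.incr_le s r hsr).trans ?_
        have := Y.isControl_ctrl.nonneg s r hsr
        have := Y.isControl_ctrl.mono hst.1 le_rfl hr.1.le hr.2 hst.2.2
        have := Y.midExp_pos
        gcongr)
    have k2 := hD' _ hy s t hst
    rw [h.incr_time hst] at k2
    simp only [e]
    rw [← Real.norm_eq_abs]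
    refine k1.trans ?_
    rw [← rpow_one_mul_two n0 Y.midExp_pos]
    calc _ ≤ C * Y.ctrl s t ^ (1 / midExp p) * (D * Y.ctrl s t ^ (2 / midExp p)) := by gcongr
      _ = _ := by ring
  have key : Y.IsSmall (incr fun t => Y.sig (Sum.inl () :: w) t - ∫ r in (0 : ℝ)..t, Y.sig w r) := by
    refine (((Y.isSmall_incr_sig_sub_sigGerm hT (Sum.inl () :: w)).add
      (h.isSmall_sigCorr hT hy w)).sub s1).congr fun s t hst => ?_
    have hs : s ∈ Icc 0 T := ⟨hst.1, hst.2.1.trans hst.2.2⟩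
    have ht : t ∈ Icc 0 T := ⟨hst.1.trans hst.2.1, hst.2.2⟩
    rw [← intervalIntegral.integral_interval_sub_left (hint 0 t h0 ht) (hint 0 s h0 hs)]
    simp only [sigGerm, sigLead, h.incr_time hst]
    simp only [incr]
    ring
  have e := key.eq_of_incr ht
  simp only [Y.sig_zero hT, intervalIntegral.integral_same] at e
  linarith

end IsExtension

/-- A continuous function all of whose iterated integrals vanish at the right end point is zero. -/
theorem eq_zero_of_iterated_integrals {T : ℝ} (hT : 0 < T) {h : ℕ → ℝ → ℝ}
    (hc : ∀ k, ContinuousOn (h k) (Icc 0 T))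
    (hi : ∀ k, ∀ t ∈ Icc 0 T, h (k + 1) t = ∫ r in (0 : ℝ)..t, h k r) (hz : ∀ k, h k T = 0) :
    ∀ t ∈ Icc 0 T, h 0 t = 0 := by
  have hu : uIcc 0 T = Icc 0 T := uIcc_of_le hT.le
  have hint : ∀ k, IntervalIntegrable (h k) MeasureTheory.volume 0 T := fun k =>
    ContinuousOn.intervalIntegrable (by rw [hu]; exact hc k)
  have hTm : T ∈ Icc 0 T := ⟨hT.le, le_rfl⟩
  -- Integration by parts lowers `m` and raises `k`. The boundary terms vanish because `T - r` is
  -- zero at `T` and `h (k + 1)` is zero at `0`; the case `m = 0` is the terminal condition.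
  have hmom : ∀ m k, ∫ r in (0 : ℝ)..T, (T - r) ^ m * h k r = 0 := by
    intro m
    induction m with
    | zero =>
      intro k
      simp only [pow_zero, one_mul]
      rw [← hi k T hTm, hz]
    | succ m ih =>
      intro k
      have h1 := intervalIntegral.integral_mul_deriv_eq_deriv_mul_of_hasDerivAt (a := 0) (b := T)
        (u := fun r => (T - r) ^ (m + 1)) (u' := fun r => -((m + 1) * (T - r) ^ m))
        (v := h (k + 1)) (v' := h k) (by fun_prop) (by rw [hu]; exact hc (k + 1)) ?_ ?_
        (Continuous.intervalIntegrable (by fun_prop) _ _) (hint k)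
      · have h2 : h (k + 1) 0 = 0 := by
          rw [hi k 0 ⟨le_rfl, hT.le⟩, intervalIntegral.integral_same]
        have h3 : ∫ r in (0 : ℝ)..T, -((m + 1) * (T - r) ^ m) * h (k + 1) r =
            ∫ r in (0 : ℝ)..T, (-((m : ℝ) + 1)) * ((T - r) ^ m * h (k + 1) r) :=
          intervalIntegral.integral_congr fun r _ => by ring
        rw [h1, h2, hz, h3, intervalIntegral.integral_const_mul, ih]
        ring
      · intro x _
        have h4 := (((hasDerivAt_id' x).const_sub T).fun_pow (m + 1))
        convert h4 using 1
        push_cast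
        simp
      · intro x hx
        rw [min_eq_left hT.le, max_eq_right hT.le] at hx
        have hmem : Icc 0 T ∈ 𝓝 x := Icc_mem_nhds hx.1 hx.2
        have h5 : HasDerivAt (fun t => ∫ r in (0 : ℝ)..t, h k r) (h k x) x := by
          refine intervalIntegral.integral_hasDerivAt_right
            ((hint k).mono_set ?_) ?_ ((hc k).continuousAt hmem)
          · rw [hu, uIcc_of_le hx.1.le]
            exact Icc_subset_Icc_right hx.2.le
          · exact (hc k).stronglyMeasurableAtFilter_nhdsWithin measurableSet_Icc x |>.filter_mono
              (by rw [nhdsWithin_eq_nhds.2 hmem])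
        exact h5.congr_of_eventuallyEq (by
          filter_upwards [hmem] with y hy using hi k y hy)
  have hpoly : ∀ P : Polynomial ℝ, ∫ r in (0 : ℝ)..T, P.eval (T - r) * h 0 r = 0 := by
    intro P
    have h1 : ∀ r, P.eval (T - r) * h 0 r =
        ∑ i ∈ Finset.range (P.natDegree + 1), P.coeff i * ((T - r) ^ i * h 0 r) := fun r => by
      rw [Polynomial.eval_eq_sum_range, Finset.sum_mul]
      exact Finset.sum_congr rfl fun i _ => by ring
    simp only [h1]
    rw [intervalIntegral.integral_finsetSum]
    · refine Finset.sum_eq_zero fun i _ => ?_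
      rw [intervalIntegral.integral_const_mul, hmom, mul_zero]
    · intro i _
      refine ContinuousOn.intervalIntegrable ?_
      rw [hu]
      exact continuousOn_const.mul ((by fun_prop : ContinuousOn (fun r => (T - r) ^ i) _).mul (hc 0))
  obtain ⟨B, hB⟩ := isCompact_Icc.exists_bound_of_continuousOn (hc 0)
  have hB0 : 0 ≤ B := (norm_nonneg _).trans (hB T hTm)
  have hsq : ∫ r in (0 : ℝ)..T, h 0 r * h 0 r ≤ 0 := by
    refine le_of_forall_pos_le_add fun ε hε => ?_
    -- Replacing one factor of the square by a polynomial in `T - r`, whose integral against `h 0`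
    -- is zero, costs at most this accuracy times `B * T`. The `+ 1` keeps the denominator positive.
    have hε' : 0 < ε / (B * T + 1) := by positivity
    obtain ⟨P, hP⟩ := exists_polynomial_near_of_continuousOn 0 T (fun x => h 0 (T - x))
      ((hc 0).comp (by fun_prop) fun x hx => ⟨by linarith [hx.2], by linarith [hx.1]⟩) _ hε'
    have hc1 : ContinuousOn (fun r => h 0 r * h 0 r) (uIcc 0 T) := by
      rw [hu]; exact (hc 0).mul (hc 0)
    have hc2 : ContinuousOn (fun r => P.eval (T - r) * h 0 r) (uIcc 0 T) := by
      rw [hu]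
      exact (P.continuous.comp (continuous_const.sub continuous_id)).continuousOn.mul (hc 0)
    have h1 : ∫ r in (0 : ℝ)..T, h 0 r * h 0 r =
        ∫ r in (0 : ℝ)..T, (h 0 r * h 0 r - P.eval (T - r) * h 0 r) := by
      rw [intervalIntegral.integral_sub hc1.intervalIntegrable hc2.intervalIntegrable, hpoly,
        sub_zero]
    have h2 := intervalIntegral.norm_integral_le_of_norm_le_const (a := 0) (b := T)
      (C := ε / (B * T + 1) * B) (f := fun r => h 0 r * h 0 r - P.eval (T - r) * h 0 r)
      (fun r hr => by
        rw [uIoc_of_le hT.le] at hr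
        have hr' := hP (T - r) ⟨by linarith [hr.2], by linarith [hr.1]⟩
        simp only [sub_sub_cancel] at hr'
        rw [← sub_mul, norm_mul, Real.norm_eq_abs, abs_sub_comm]
        exact mul_le_mul hr'.le (hB r ⟨hr.1.le, hr.2⟩) (norm_nonneg _) hε'.le)
    rw [← h1, Real.norm_eq_abs, sub_zero, abs_of_pos hT] at h2
    have h3 : ε / (B * T + 1) * B * T ≤ ε := by
      rw [div_mul_eq_mul_div, div_mul_eq_mul_div, div_le_iff₀ (by positivity)]
      nlinarith
    linarith [le_abs_self (∫ r in (0 : ℝ)..T, h 0 r * h 0 r)]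
  intro t ht
  by_contra hne
  have := intervalIntegral.integral_pos (f := fun r => h 0 r * h 0 r) hT ((hc 0).mul (hc 0))
    (fun x _ => mul_self_nonneg _) ⟨t, ht, mul_self_pos.2 hne⟩
  linarith

theorem pVar_eq_zero {E : Type*} [NormedAddCommGroup E] {r T : ℝ} (hr : 0 < r) {A : ℝ → ℝ → E}
    (hA : ∀ s t, (s, t) ∈ simplex T → A s t = 0) : pVar r A 0 T = 0 := by
  rw [pVar, ENNReal.rpow_eq_zero_iff_of_pos (by positivity), ENNReal.iSup_eq_zero]
  refine fun P => Finset.sum_eq_zero fun k hk => ?_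
  have hk' := Finset.mem_range.1 hk
  rw [hA _ _ ⟨P.left_le hk'.le, (P.pts_lt k hk').le, P.le_right hk'⟩, enorm_zero,
    ENNReal.zero_rpow_of_pos hr]

/-- Words of length one and two give the increments and the second level started at `0`, and Chen's
relation transfers them to every `[s,t]`. The distance sees nothing else. -/
theorem RoughPath.edist_eq_zero_of_sig {T p : ℝ} {ι : Type} [Fintype ι] {Y Z : RoughPath T p ι}
    (hT : 0 ≤ T) (h : ∀ w, ∀ t ∈ Icc 0 T, Y.sig w t = Z.sig w t) : edist Y Z = 0 := by
  have hp := Y.two_le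
  have h1 : ∀ t ∈ Icc 0 T, ∀ i, incr Y.path 0 t i = incr Z.path 0 t i := fun t ht i => h [i] t ht
  have h2 : ∀ s t, (s, t) ∈ simplex T → ∀ i, incr Y.path s t i = incr Z.path s t i := by
    intro s t hst i
    have a := h1 t ⟨hst.1.trans hst.2.1, hst.2.2⟩ i
    have b := h1 s ⟨hst.1, hst.2.1.trans hst.2.2⟩ i
    simp only [incr, PiLp.sub_apply] at a b ⊢
    linarith
  have h3 : ∀ t ∈ Icc 0 T, ∀ i j, Y.lift 0 t (i, j) = Z.lift 0 t (i, j) := fun t ht i j => by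
    rw [← Y.sig_pair hT ht, ← Z.sig_pair hT ht, h _ t ht]
  rw [edist_def, pVar_eq_zero (by linarith) fun s t hst => ?_,
    pVar_eq_zero (by linarith) fun s t hst => ?_, add_zero]
  · ext ⟨i, j⟩
    have a := h3 t ⟨hst.1.trans hst.2.1, hst.2.2⟩ i j
    have hs : s ∈ Icc 0 T := ⟨hst.1, hst.2.1.trans hst.2.2⟩
    rw [Y.chen 0 s t le_rfl hst.1 hst.2.1 hst.2.2, Z.chen 0 s t le_rfl hst.1 hst.2.1 hst.2.2,
      h3 s hs, h1 s hs, h2 s t hst] at a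
    simp only [PiLp.sub_apply, PiLp.zero_apply]
    linarith
  · ext i
    simp only [PiLp.sub_apply, PiLp.zero_apply, h2 s t hst, sub_self]

/-- Extended rough paths are determined, up to distance zero, by the terminal value of their
signature. -/
theorem edist_eq_zero_of_sig_terminal {T p : ℝ} {d : ℕ} (hT : 0 < T)
    {Y Z : RoughPath T p (HatIdx d)} (hY : Y ∈ extendedRoughPaths T p d)
    (hZ : Z ∈ extendedRoughPaths T p d) (h : ∀ w, Y.sig w T = Z.sig w T) : edist Y Z = 0 := by
  obtain ⟨_, hY⟩ := hY
  obtain ⟨_, hZ⟩ := hZ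
  refine RoughPath.edist_eq_zero_of_sig hT.le fun w t ht => sub_eq_zero.1 ?_
  -- In reversed words the time letters stand in front, so `g k` is the `k`-fold iterated integral
  -- of the difference of the coordinates at `w`.
  let g : ℕ → ℝ → ℝ := fun k t => Y.sig (List.replicate k (Sum.inl ()) ++ w) t -
    Z.sig (List.replicate k (Sum.inl ()) ++ w) t
  refine eq_zero_of_iterated_integrals (h := g) hT
    (fun k => (Y.continuousOn_sig hT.le _).sub (Z.continuousOn_sig hT.le _)) (fun k t ht => ?_)
    (fun k => by simp only [g, h, sub_self]) t ht
  have hsub : uIcc 0 t ⊆ Icc 0 T := uIcc_subset_Icc ⟨le_rfl, hT.le⟩ ht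
  simp only [g, List.replicate_succ, List.cons_append]
  rw [hY.sig_time_cons hT.le _ ht, hZ.sig_time_cons hT.le _ ht, intervalIntegral.integral_sub]
  · exact ((Y.continuousOn_sig hT.le _).mono hsub).intervalIntegrable
  · exact ((Z.continuousOn_sig hT.le _).mono hsub).intervalIntegrable

end GammaSig

namespace GammaSig

/-! ### Grids -/

section Grid

variable {T : ℝ}

theorem Partition.sub_le_mesh {s t : ℝ} (P : Partition s t) {k : ℕ} (hk : k < P.N) :
    P.pts (k + 1) - P.pts k ≤ P.mesh :=
  le_ciSup (f := fun k : Fin P.N => P.pts (k + 1) - P.pts k) (Set.finite_range _).bddAbove ⟨k, hk⟩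

/-- The points of a partition of `[0, T]`, stopped at time `t`. -/
noncomputable def Partition.stopped (P : Partition 0 T) (t : ℝ) (k : ℕ) : ℝ :=
  min (P.pts (min k P.N)) t

theorem Partition.stopped_eq (P : Partition 0 T) (t : ℝ) {k : ℕ} (hk : k ≤ P.N) :
    P.stopped t k = min (P.pts k) t := by
  rw [Partition.stopped, min_eq_left hk]

/-- Monotonicity over all indices needs the index cut at `P.N` in `stopped`, since the points of a
partition beyond `N` are arbitrary. -/
theorem Partition.isSubdivision_stopped (P : Partition 0 T) {t : ℝ} (ht : t ∈ Icc 0 T) :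
    IsSubdivision (P.stopped t) P.N 0 t where
  zero := by rw [P.stopped_eq t (Nat.zero_le _), P.pts_zero, min_eq_left ht.1]
  last := by rw [P.stopped_eq t le_rfl, P.pts_last, min_eq_right ht.2]
  mono := fun i j hij =>
    min_le_min (P.pts_le (min_le_min hij le_rfl) (min_le_right _ _)) le_rfl

theorem Partition.isSubdivision_pts_stopped (P : Partition 0 T) (hT : 0 ≤ T) :
    IsSubdivision (P.stopped T) P.N 0 T := P.isSubdivision_stopped ⟨hT, le_rfl⟩

theorem Partition.stopped_right (P : Partition 0 T) {k : ℕ} (hk : k ≤ P.N) :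
    P.stopped T k = P.pts k := by
  rw [P.stopped_eq T hk, min_eq_left (P.le_right hk)]

theorem eventually_stopped_sub_lt {π : ℕ → Partition 0 T}
    (hπ : Tendsto (fun n => (π n).mesh) atTop (𝓝 0)) (t : ℝ) {δ : ℝ} (hδ : 0 < δ) :
    ∀ᶠ n in atTop, ∀ k < (π n).N, (π n).stopped t (k + 1) - (π n).stopped t k < δ := by
  filter_upwards [hπ.eventually_lt_const hδ] with n hn k hk
  have h1 := (π n).sub_le_mesh hk
  have h2 := (π n).pts_lt k hk
  rw [(π n).stopped_eq t hk, (π n).stopped_eq t hk.le]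
  rcases le_total ((π n).pts k) t with h | h
  · rw [min_eq_left h]
    linarith [min_le_left ((π n).pts (k + 1)) t]
  · rw [min_eq_right h, min_eq_right (h.trans h2.le), sub_self]
    exact hδ

/-- Every time in `[0, T]` lies in one of the intervals of a partition. -/
theorem Partition.exists_mem_interval (P : Partition 0 T) (hT : 0 < T) {t : ℝ}
    (ht : t ∈ Icc 0 T) : ∃ m < P.N, P.pts m ≤ t ∧ t ≤ P.pts (m + 1) := by
  by_contra hcon
  push Not at hcon
  have key : ∀ k ≤ P.N, P.pts k ≤ t := by
    intro k
    induction k with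
    | zero => intro _; rw [P.pts_zero]; exact ht.1
    | succ k ih => intro hk; exact (hcon k hk (ih (by omega))).le
  have hN : P.N ≠ 0 := fun h => by
    have h1 := P.pts_last
    rw [h, P.pts_zero] at h1
    exact hT.ne h1
  have h1 := hcon (P.N - 1) (by omega) (key _ (by omega))
  rw [Nat.sub_add_cancel (by omega), P.pts_last] at h1
  exact absurd ht.2 (not_le.2 h1)

theorem gammaSum_congr (γ : ℝ) (P : Partition 0 T) {F F' G G' : ℝ → ℝ}
    (hF : ∀ t ∈ Icc 0 T, F t = F' t) (hG : ∀ t ∈ Icc 0 T, G t = G' t) {t : ℝ}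
    (ht : t ∈ Icc 0 T) : gammaSum γ P F G t = gammaSum γ P F' G' t := by
  unfold gammaSum
  refine Finset.sum_congr rfl fun k hk => ?_
  have hk' := Finset.mem_range.1 hk
  have h1 : P.pts k ∈ Icc 0 T := ⟨P.left_le hk'.le, P.le_right hk'.le⟩
  have h2 : P.pts (k + 1) ∈ Icc 0 T := ⟨P.left_le hk', P.le_right hk'⟩
  simp only [incr, hF _ h1, hF _ h2, hG _ ⟨le_min h1.1 ht.1, (min_le_left _ _).trans h1.2⟩,
    hG _ ⟨le_min h2.1 ht.1, (min_le_left _ _).trans h2.2⟩]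

/-- The weights of a constant integrand do not see `γ`, and the integrator telescopes. This converts
between integrating `X` and integrating `X_{0,·}`. -/
theorem gammaSum_add_const (γ : ℝ) (P : Partition 0 T) (F G : ℝ → ℝ) (a : ℝ) {t : ℝ}
    (ht : t ∈ Icc 0 T) :
    gammaSum γ P (fun r => F r + a) G t = gammaSum γ P F G t + a * incr G 0 t := by
  have h := riemannSum_incr G (P.isSubdivision_stopped ht)
  rw [incr, ← h]
  unfold gammaSum riemannSum
  rw [Finset.mul_sum, ← Finset.sum_add_distrib]
  refine Finset.sum_congr rfl fun k hk => ?_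
  have hk' := Finset.mem_range.1 hk
  rw [P.stopped_eq t hk', P.stopped_eq t hk'.le]
  simp only [incr]
  ring

/-- The increment of a `γ`-Riemann sum within one interval of the partition. -/
theorem gammaSum_sub (γ : ℝ) (P : Partition 0 T) (F G : ℝ → ℝ) {k : ℕ} (hk : k < P.N) {s s' : ℝ}
    (h1 : P.pts k ≤ s) (h2 : s ≤ s') (h3 : s' ≤ P.pts (k + 1)) :
    gammaSum γ P F G s' - gammaSum γ P F G s =
      (F (P.pts k) + γ * incr F (P.pts k) (P.pts (k + 1))) * incr G s s' := by
  unfold gammaSum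
  rw [← Finset.sum_sub_distrib, Finset.sum_eq_single_of_mem k (Finset.mem_range.2 hk)]
  · rw [min_eq_left h1, min_eq_left (h1.trans h2), min_eq_right h3, min_eq_right (h2.trans h3)]
    simp only [incr]
    ring
  · intro m hm hmk
    have hm' := Finset.mem_range.1 hm
    rcases lt_or_gt_of_ne hmk with h | h
    · have e1 : P.pts (m + 1) ≤ P.pts k := P.pts_le h hk.le
      have e2 : P.pts m ≤ P.pts k := P.pts_le h.le hk.le
      rw [min_eq_left (e2.trans h1), min_eq_left (e1.trans h1), min_eq_left (e2.trans (h1.trans h2)),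
        min_eq_left (e1.trans (h1.trans h2)), sub_self]
    · have e1 : P.pts (k + 1) ≤ P.pts m := P.pts_le h hm'.le
      have e2 : P.pts (k + 1) ≤ P.pts (m + 1) := P.pts_le (by omega) hm'
      rw [min_eq_right (h3.trans e1), min_eq_right (h3.trans e2),
        min_eq_right ((h2.trans h3).trans e1), min_eq_right ((h2.trans h3).trans e2)]
      simp [incr]

end Grid

/-! ### A discrete Young estimate -/

/-- The germ `H i * (E j - E i)` has defect `-(H j - H i) * (E k - E j)`, of order `1/q + 2/q > 1`
with respect to the control `ω + κ`; the maximal inequality applies. -/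
theorem abs_sum_mul_sub_le {q A B : ℝ} (hq0 : 0 < q) (hq3 : q < 3) (hA : 0 ≤ A) (hB : 0 ≤ B)
    {m : ℕ} {ω κ : ℕ → ℕ → ℝ} {H E : ℕ → ℝ}
    (hω0 : ∀ i j, i ≤ j → j ≤ m → 0 ≤ ω i j)
    (hω : ∀ i j k, i ≤ j → j ≤ k → k ≤ m → ω i j + ω j k ≤ ω i k)
    (hκ0 : ∀ i j, i ≤ j → j ≤ m → 0 ≤ κ i j)
    (hκ : ∀ i j k, i ≤ j → j ≤ k → k ≤ m → κ i j + κ j k ≤ κ i k)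
    (hH : ∀ i j, i ≤ j → j ≤ m → |H j - H i| ≤ A * ω i j ^ (1 / q))
    (hE : ∀ i j, i ≤ j → j ≤ m → |E j - E i| ≤ B * κ i j ^ (2 / q)) :
    |∑ k ∈ Finset.range m, H k * (E (k + 1) - E k) - H 0 * (E m - E 0)| ≤
      A * B * (sewConst (3 / q) * (ω 0 m + κ 0 m) ^ (3 / q)) := by
  have h := abs_sum_Ico_sub_le (θ := 3 / q) (C := A * B) (N := m)
    (ω := fun i j => ω i j + κ i j) (Ξ := fun i j => H i * (E j - E i))
    ((one_lt_div hq0).2 hq3) (by positivity)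
    (fun i j hij hj => add_nonneg (hω0 i j hij hj) (hκ0 i j hij hj))
    (fun i j k hij hjk hk => by linarith [hω i j k hij hjk hk, hκ i j k hij hjk hk])
    (fun i j k hij hjk hk => ?_) m 0 m (Nat.zero_le m) le_rfl le_rfl
  · simpa only [Nat.Ico_zero_eq_range] using h
  · have a1 := hH i j hij (hjk.trans hk)
    have a2 := hE j k hjk hk
    have n1 := hω0 i j hij (hjk.trans hk)
    have n2 := hκ0 j k hjk hk
    have n3 := hω0 i k (hij.trans hjk) hk
    have n4 := hκ0 i k (hij.trans hjk) hk
    have n5 := hω0 j k hjk hk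
    have n6 := hκ0 i j hij (hjk.trans hk)
    have m1 := hω i j k hij hjk hk
    have m2 := hκ i j k hij hjk hk
    have e : H i * (E k - E i) - H i * (E j - E i) - H j * (E k - E j) =
        -((H j - H i) * (E k - E j)) := by ring
    rw [e, abs_neg, abs_mul]
    calc _ ≤ (A * ω i j ^ (1 / q)) * (B * κ j k ^ (2 / q)) :=
          mul_le_mul a1 a2 (abs_nonneg _) ((abs_nonneg _).trans a1)
      _ ≤ (A * (ω i k + κ i k) ^ (1 / q)) * (B * (ω i k + κ i k) ^ (2 / q)) := by
          gcongr <;> linarith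
      _ = A * B * (ω i k + κ i k) ^ (3 / q) := by
          rw [← rpow_one_mul_two (add_nonneg n3 n4) hq0]; ring

/-- Interpolation between a uniform bound and a bound of order `2 / p`. -/
theorem abs_le_interpolate {p q x η κ : ℝ} (hp : 0 < p) (hpq : p < q) (hκ : 0 ≤ κ)
    (h1 : |x| ≤ η) (h2 : |x| ≤ 2 * κ ^ (2 / p)) :
    |x| ≤ η ^ (1 - p / q) * 2 ^ (p / q) * κ ^ (2 / q) := by
  have hq : 0 < q := hp.trans hpq
  have hpq' : p / q ≤ 1 := (div_le_one hq).2 hpq.le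
  have hx := abs_nonneg x
  calc |x| = |x| ^ (1 - p / q) * |x| ^ (p / q) := by
        rw [← Real.rpow_add_of_nonneg hx (by linarith) (by positivity), sub_add_cancel,
          Real.rpow_one]
    _ ≤ η ^ (1 - p / q) * (2 * κ ^ (2 / p)) ^ (p / q) := by
        have : 0 ≤ 1 - p / q := by linarith
        have : 0 ≤ η := hx.trans h1
        gcongr
    _ = η ^ (1 - p / q) * 2 ^ (p / q) * κ ^ (2 / q) := by
        rw [Real.mul_rpow zero_le_two (Real.rpow_nonneg hκ _), ← Real.rpow_mul hκ, mul_assoc]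
        congr 3
        field_simp

namespace RoughPath

variable {T p : ℝ} {ι : Type} [Fintype ι] {Y : RoughPath T p ι} {w : List ι} {C : ℝ}

/-- Riemann sums of a signature coordinate against paths which vanish uniformly and have bounded
`p / 2`-variation along the partitions vanish in the limit. -/
theorem SigBound.tendsto_sum_mul_incr (hb : Y.SigBound w C) (hC : 0 ≤ C) (hT : 0 < T)
    {π : ℕ → Partition 0 T} {E : ℕ → ℝ → ℝ} {κ : ℝ → ℝ → ℝ} (hκ : IsControl T κ)
    (hE : ∀ η > 0, ∀ᶠ n in atTop, ∀ t ∈ Icc 0 T, |E n t| ≤ η)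
    (hEκ : ∀ n i j, i ≤ j → j ≤ (π n).N →
      |E n ((π n).pts j) - E n ((π n).pts i)| ≤ 2 * κ ((π n).pts i) ((π n).pts j) ^ (2 / p))
    {t : ℝ} (ht : t ∈ Icc 0 T) :
    Tendsto (fun n => ∑ k ∈ Finset.range (π n).N, Y.sig w ((π n).pts k) *
      incr (E n) (min ((π n).pts k) t) (min ((π n).pts (k + 1)) t)) atTop (𝓝 0) := by
  have hp0 : 0 < p := by linarith [Y.two_le]
  have hq := Y.midExp_pos
  have hpq := Y.lt_midExp
  have hpq' : 0 < 1 - p / midExp p := by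
    have := (div_lt_one hq).2 hpq
    linarith
  set W := (Y.ctrl 0 T + κ 0 T) ^ (3 / midExp p) with hW
  set K := sewConst (3 / midExp p) with hK
  have hK0 : 0 ≤ K := sewConst_nonneg Y.one_lt_three_div
  -- The final bound as a function of the uniform error `η`. The first term is the discrete Young
  -- estimate with the interpolated constant; `4 * C * η` covers the germ of the whole range and the
  -- last, incomplete interval, at `2 * C * η` each.
  have hlim : Tendsto (fun η : ℝ => C * ((2 * η) ^ (1 - p / midExp p) * 2 ^ (p / midExp p)) *
      (K * W) + 4 * C * η) (𝓝[>] 0) (𝓝 0) := by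
    have h1 : ContinuousAt (fun η : ℝ => C * ((2 * η) ^ (1 - p / midExp p) *
        2 ^ (p / midExp p)) * (K * W) + 4 * C * η) 0 := by
      refine ContinuousAt.add (ContinuousAt.mul (ContinuousAt.mul continuousAt_const
        (ContinuousAt.mul ?_ continuousAt_const)) continuousAt_const) (by fun_prop)
      exact ContinuousAt.rpow_const (by fun_prop) (Or.inr hpq'.le)
    have h2 := h1.tendsto
    simp only [mul_zero, Real.zero_rpow hpq'.ne', zero_mul, add_zero] at h2
    exact h2.mono_left nhdsWithin_le_nhds
  rw [Metric.tendsto_nhds]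
  intro r hr
  obtain ⟨η, hη, hη'⟩ := ((hlim.eventually_lt_const hr).and self_mem_nhdsWithin).exists
  have hη0 : 0 < η := hη'
  filter_upwards [hE η hη0] with n hn
  rw [Real.dist_eq, sub_zero]
  refine lt_of_le_of_lt ?_ hη
  set P := π n with hP
  have hpt : ∀ i ≤ P.N, P.pts i ∈ Icc 0 T := fun i hi => ⟨P.left_le hi, P.le_right hi⟩
  obtain ⟨m, hm, hmt, htm⟩ := P.exists_mem_interval hT ht
  have hsx : ∀ i j, i ≤ j → j ≤ m → (P.pts i, P.pts j) ∈ simplex T := fun i j hij hj =>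
    ⟨P.left_le (by omega), P.pts_le hij (by omega), P.le_right (by omega)⟩
  -- Intervals before the `m`-th are complete, the `m`-th is cut at `t`, and later ones contribute
  -- zero.
  have hsplit : ∑ k ∈ Finset.range P.N, Y.sig w (P.pts k) *
      incr (E n) (min (P.pts k) t) (min (P.pts (k + 1)) t) =
      ∑ k ∈ Finset.range m, Y.sig w (P.pts k) * (E n (P.pts (k + 1)) - E n (P.pts k)) +
        Y.sig w (P.pts m) * (E n t - E n (P.pts m)) := by
    rw [← Finset.sum_subset (Finset.range_subset_range.2 (show m + 1 ≤ P.N from hm)),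
      Finset.sum_range_succ, min_eq_left hmt, min_eq_right htm]
    · congr 1
      refine Finset.sum_congr rfl fun k hk => ?_
      have hk' := Finset.mem_range.1 hk
      rw [min_eq_left ((P.pts_le hk'.le hm.le).trans hmt),
        min_eq_left ((P.pts_le hk' hm.le).trans hmt), incr]
    · intro k hk hkm
      have hk' := Finset.mem_range.1 hk
      have hkm' : m + 1 ≤ k := by simpa using hkm
      rw [min_eq_right (htm.trans (P.pts_le hkm' hk'.le)),
        min_eq_right (htm.trans (P.pts_le (by omega) hk')), incr, sub_self, mul_zero]
  have hE2 : ∀ a ∈ Icc 0 T, ∀ b ∈ Icc 0 T, |E n b - E n a| ≤ 2 * η := fun a ha b hb => by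
    linarith [abs_sub (E n b) (E n a), hn a ha, hn b hb]
  have hmain := abs_sum_mul_sub_le (m := m) (q := midExp p) (A := C)
    (B := (2 * η) ^ (1 - p / midExp p) * 2 ^ (p / midExp p))
    (ω := fun i j => Y.ctrl (P.pts i) (P.pts j)) (κ := fun i j => κ (P.pts i) (P.pts j))
    (H := fun i => Y.sig w (P.pts i)) (E := fun i => E n (P.pts i))
    hq Y.midExp_lt hC (by positivity)
    (fun i j hij hj => Y.isControl_ctrl.nonneg _ _ (hsx i j hij hj))
    (fun i j k hij hjk hk => Y.isControl_ctrl.superadd _ _ _ (hsx i j hij (hjk.trans hk)).1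
      (hsx i j hij (hjk.trans hk)).2.1 (hsx j k hjk hk).2.1 (hsx j k hjk hk).2.2)
    (fun i j hij hj => hκ.nonneg _ _ (hsx i j hij hj))
    (fun i j k hij hjk hk => hκ.superadd _ _ _ (hsx i j hij (hjk.trans hk)).1
      (hsx i j hij (hjk.trans hk)).2.1 (hsx j k hjk hk).2.1 (hsx j k hjk hk).2.2)
    (fun i j hij hj => hb.incr_le _ _ (hsx i j hij hj))
    (fun i j hij hj => abs_le_interpolate hp0 hpq (hκ.nonneg _ _ (hsx i j hij hj))
      (hE2 _ (hpt i (by omega)) _ (hpt j (by omega))) (hEκ n i j hij (show j ≤ P.N by omega)))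
  have h0m := hsx 0 m (Nat.zero_le m) le_rfl
  have hmono : (Y.ctrl (P.pts 0) (P.pts m) + κ (P.pts 0) (P.pts m)) ^ (3 / midExp p) ≤ W := by
    have e1 := Y.isControl_ctrl.mono le_rfl h0m.1 h0m.2.1 h0m.2.2 le_rfl
    have e2 := hκ.mono le_rfl h0m.1 h0m.2.1 h0m.2.2 le_rfl
    simp only at e1 e2
    exact Real.rpow_le_rpow (add_nonneg (Y.isControl_ctrl.nonneg _ _ h0m) (hκ.nonneg _ _ h0m))
      (by linarith) (by positivity)
  have hb1 : |Y.sig w (P.pts 0) * (E n (P.pts m) - E n (P.pts 0))| ≤ C * (2 * η) := by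
    rw [abs_mul]
    exact mul_le_mul (hb.bound _ (hpt 0 (Nat.zero_le _)))
      (hE2 _ (hpt 0 (Nat.zero_le _)) _ (hpt m hm.le)) (abs_nonneg _) hC
  have hb2 : |Y.sig w (P.pts m) * (E n t - E n (P.pts m))| ≤ C * (2 * η) := by
    rw [abs_mul]
    exact mul_le_mul (hb.bound _ (hpt m hm.le)) (hE2 _ (hpt m hm.le) _ ht) (abs_nonneg _) hC
  have hmain' : _ ≤ C * ((2 * η) ^ (1 - p / midExp p) * 2 ^ (p / midExp p)) * (K * W) :=
    hmain.trans (by gcongr)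
  rw [hsplit]
  rw [abs_le] at hmain' hb1 hb2 ⊢
  constructor <;> linarith

/-! ### `γ`-integrals of signature coordinates -/

/-- The `l`-th coordinate of the path over a stopped interval is controlled by the whole
interval. -/
theorem abs_incr_min_le (Y : RoughPath T p ι) {a b t : ℝ} (hab : (a, b) ∈ simplex T) (l : ι) :
    |incr Y.path (min a t) (min b t) l| ≤ Y.ctrl a b ^ (1 / midExp p) := by
  have hq := Y.midExp_pos
  have n0 := Y.isControl_ctrl.nonneg a b hab
  rcases le_total a t with h | h
  · have h1 : a ≤ min b t := le_min hab.2.1 h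
    have h2 : (a, min b t) ∈ simplex T := ⟨hab.1, h1, (min_le_left _ _).trans hab.2.2⟩
    rw [min_eq_left h]
    refine (Y.abs_incr_le_ctrl h2 l).trans ?_
    have := Y.isControl_ctrl.nonneg _ _ h2
    have := Y.isControl_ctrl.mono hab.1 le_rfl h1 (min_le_left _ _) hab.2.2
    gcongr
  · rw [min_eq_right h, min_eq_right (h.trans hab.2.1)]
    simp only [incr, sub_self, PiLp.zero_apply, abs_zero]
    positivity

/-- Contributions of order `3/q` per partition interval are negligible as the mesh tends to zero. -/
theorem tendsto_sum_of_abs_le (Y : RoughPath T p ι) (hT : 0 ≤ T) {π : ℕ → Partition 0 T}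
    (hπ : Tendsto (fun n => (π n).mesh) atTop (𝓝 0)) {D : ℝ} {x : ℕ → ℕ → ℝ}
    (hx : ∀ n, ∀ k < (π n).N,
      |x n k| ≤ D * Y.ctrl ((π n).pts k) ((π n).pts (k + 1)) ^ (3 / midExp p)) :
    Tendsto (fun n => ∑ k ∈ Finset.range (π n).N, x n k) atTop (𝓝 0) := by
  have h := (Y.isControl_ctrl.tendsto_riemannSum_rpow Y.vanishesOnDiag_ctrl Y.one_lt_three_div
    le_rfl le_rfl (fun n => (π n).isSubdivision_pts_stopped hT)
    (fun δ hδ => eventually_stopped_sub_lt hπ T hδ)).const_mul D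
  rw [mul_zero] at h
  refine squeeze_zero_norm (fun n => ?_) h
  rw [Real.norm_eq_abs, riemannSum, Finset.mul_sum]
  refine (Finset.abs_sum_le_sum_abs _ _).trans (Finset.sum_le_sum fun k hk => ?_)
  have hk' := Finset.mem_range.1 hk
  rw [(π n).stopped_right hk', (π n).stopped_right hk'.le]
  exact hx n k hk'

/-- The defect of the second-level `γ`-Riemann sums, weighted by a signature coordinate. -/
noncomputable def gammaDefect (Y : RoughPath T p ι) (γ : ℝ) (P : Partition 0 T) (w : List ι)
    (j l : ι) (t : ℝ) : ℝ :=
  ∑ k ∈ Finset.range P.N, Y.sig w (P.pts k) *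
    (γ * incr Y.path (P.pts k) (P.pts (k + 1)) j *
      incr Y.path (min (P.pts k) t) (min (P.pts (k + 1)) t) l -
      Y.lift (min (P.pts k) t) (min (P.pts (k + 1)) t) (j, l))

/-- If the weighted second-level defect vanishes, then `γ`-Riemann sums of signature coordinates
converge to signature coordinates. -/
theorem tendsto_gammaSum_sig (Y : RoughPath T p ι) (hT : 0 ≤ T) {γ : ℝ} {π : ℕ → Partition 0 T}
    (hπ : Tendsto (fun n => (π n).mesh) atTop (𝓝 0)) (j l : ι) (w : List ι) {t : ℝ}
    (ht : t ∈ Icc 0 T)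
    (hdef : Tendsto (fun n => Y.gammaDefect γ (π n) w j l t) atTop (𝓝 0)) :
    Tendsto (fun n => gammaSum γ (π n) (Y.sig (j :: w)) (fun r => Y.path r l) t) atTop
      (𝓝 (Y.sig (l :: j :: w) t)) := by
  obtain ⟨C, hC, hb⟩ := Y.exists_sigBound_self hT (l :: j :: w)
  obtain ⟨D, hD, hb'⟩ := Y.exists_sigBound_self hT (j :: w)
  have hq := Y.midExp_pos
  have hsx : ∀ n, ∀ k < (π n).N, ((π n).pts k, (π n).pts (k + 1)) ∈ simplex T := fun n k hk =>
    ⟨(π n).left_le hk.le, ((π n).pts_lt k hk).le, (π n).le_right hk⟩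
  have h1 : Tendsto (fun n => riemannSum (Y.sigGerm (l :: j :: w)) ((π n).stopped t) (π n).N)
      atTop (𝓝 (Y.sig (l :: j :: w) t)) := by
    have h := (Y.isControl_ctrl.tendsto_riemannSum_rpow Y.vanishesOnDiag_ctrl Y.one_lt_three_div
      le_rfl ht.2 (fun n => (π n).isSubdivision_stopped ht)
      (fun δ hδ => eventually_stopped_sub_lt hπ t hδ)).const_mul C
    rw [mul_zero] at h
    have h' := squeeze_zero_norm (fun n => by
      have e := abs_sub_riemannSum_le le_rfl ht.2 hb.germ ((π n).isSubdivision_stopped ht)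
      rw [Y.sig_zero hT, sub_zero, ← Real.norm_eq_abs] at e
      exact e) h
    simpa using h'.const_sub (Y.sig (l :: j :: w) t)
  have h2 : Tendsto (fun n => ∑ k ∈ Finset.range (π n).N,
      γ * ((incr (Y.sig (j :: w)) ((π n).pts k) ((π n).pts (k + 1)) -
        Y.sigLead (j :: w) ((π n).pts k) ((π n).pts (k + 1))) *
        incr Y.path (min ((π n).pts k) t) (min ((π n).pts (k + 1)) t) l)) atTop (𝓝 0) := by
    refine Y.tendsto_sum_of_abs_le hT hπ (D := |γ| * D) fun n k hk => ?_
    have hs := hsx n k hk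
    have n0 := Y.isControl_ctrl.nonneg _ _ hs
    rw [abs_mul, abs_mul, mul_assoc, ← rpow_one_mul_two n0 hq]
    refine mul_le_mul_of_nonneg_left ?_ (abs_nonneg _)
    calc _ ≤ (D * Y.ctrl ((π n).pts k) ((π n).pts (k + 1)) ^ (2 / midExp p)) *
          Y.ctrl ((π n).pts k) ((π n).pts (k + 1)) ^ (1 / midExp p) :=
          mul_le_mul (hb'.lead _ _ hs) (Y.abs_incr_min_le hs l) (abs_nonneg _) (by positivity)
      _ = _ := by ring
  have h3 := (h1.add h2).add hdef
  rw [add_zero, add_zero] at h3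
  -- Termwise identity: the second level in the germ cancels against the defect, and the first-order
  -- part of the γ-correction removed in `h2` is restored by the defect.
  refine h3.congr fun n => ?_
  unfold gammaSum gammaDefect riemannSum
  rw [← Finset.sum_add_distrib, ← Finset.sum_add_distrib]
  refine Finset.sum_congr rfl fun k hk => ?_
  have hk' := Finset.mem_range.1 hk
  have hs := hsx n k hk'
  rw [(π n).stopped_eq t hk', (π n).stopped_eq t hk'.le]
  simp only [sigGerm, sigLead, sigCorr]
  rcases le_total ((π n).pts k) t with h | h
  · rw [min_eq_left h]
    simp only [incr, PiLp.sub_apply]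
    ring
  · rw [min_eq_right h, min_eq_right (h.trans hs.2.1), Y.lift_self ht.1 ht.2]
    simp [incr]

end RoughPath

end GammaSig

/-! ### Identification of the γ-signature with the rough path signature -/

namespace GammaSig

open RoughPath

variable {T p γ : ℝ} {d : ℕ}

/-- The weighted second-level defect vanishes in the limit if one of the letters is a Young
letter. -/
theorem IsExtension.tendsto_gammaDefect {X : RoughPath T p (Fin d)} {Y : RoughPath T p (HatIdx d)}
    (h : IsExtension X Y) (hT : 0 ≤ T) {π : ℕ → Partition 0 T}
    (hπ : Tendsto (fun n => (π n).mesh) atTop (𝓝 0)) (w : List (HatIdx d)) {j l : HatIdx d}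
    (hjl : IsYoungLetter j ∨ IsYoungLetter l) {t : ℝ} (ht : t ∈ Icc 0 T) :
    Tendsto (fun n => Y.gammaDefect γ (π n) w j l t) atTop (𝓝 0) := by
  obtain ⟨B, hB, hb⟩ := Y.exists_sigBound_self hT w
  obtain ⟨C, hC, hc⟩ := h.exists_abs_mul_incr_le
  obtain ⟨D, hd⟩ := h.isSmall_lift hjl
  refine Y.tendsto_sum_of_abs_le hT hπ (D := B * (|γ| * C + |D|)) fun n k hk => ?_
  set a := (π n).pts k
  set b := (π n).pts (k + 1)
  have hab : (a, b) ∈ simplex T :=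
    ⟨(π n).left_le hk.le, ((π n).pts_lt k hk).le, (π n).le_right hk⟩
  have n0 := Y.isControl_ctrl.nonneg a b hab
  have n1 := Real.rpow_nonneg n0 (3 / midExp p)
  rw [abs_mul, mul_assoc B]
  refine mul_le_mul (hb.bound a ⟨hab.1, hab.2.1.trans hab.2.2⟩) ?_ (abs_nonneg _) hB
  rcases le_total a t with hat | hat
  · have h1 : a ≤ min b t := le_min hab.2.1 hat
    have h2 : (a, min b t) ∈ simplex T := ⟨hab.1, h1, (min_le_left _ _).trans hab.2.2⟩
    rw [min_eq_left hat, mul_assoc γ, add_mul]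
    refine (abs_sub _ _).trans (add_le_add ?_ ((hd _ _ h2).trans ?_))
    · rw [abs_mul, mul_assoc]
      exact mul_le_mul_of_nonneg_left (hc j l hjl a a b b hab.1 le_rfl hab.2.1 le_rfl hab.2.2
        a (min b t) le_rfl h1 (min_le_left _ _)) (abs_nonneg _)
    · have n2 := Y.isControl_ctrl.nonneg _ _ h2
      have n3 := Y.isControl_ctrl.mono hab.1 le_rfl h1 (min_le_left b t) hab.2.2
      exact mul_le_mul (le_abs_self D) (Real.rpow_le_rpow n2 n3 (by
        have := Y.midExp_pos; positivity)) (Real.rpow_nonneg n2 _) (abs_nonneg _)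
  · rw [min_eq_right hat, min_eq_right (hat.trans hab.2.1), Y.lift_self ht.1 ht.2]
    simp only [incr, sub_self, PiLp.zero_apply, mul_zero, abs_zero]
    positivity

/-- The rough path `Y` is the second-level `γ`-lift of the extension of a path with Property
`γ`-(RIE). -/
structure IsGammaLift (γ : ℝ) (π : ℕ → Partition 0 T) (X : ℝ → EuclideanSpace ℝ (Fin d))
    (Y : RoughPath T p (HatIdx d)) : Prop where
  rie : GammaRIE γ p π X
  path_coord : ∀ t ∈ Icc 0 T, ∀ i, Y.path t (HatIdx.coord i) = X t i
  lift_eq : ∀ s t, (s, t) ∈ simplex T → Y.lift s t = gammaLift γ π Y.path s t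
  isExtension : ∃ X', IsExtension X' Y
  mesh : Tendsto (fun n => (π n).mesh) atTop (𝓝 0)

namespace IsGammaLift

variable {π : ℕ → Partition 0 T} {X : ℝ → EuclideanSpace ℝ (Fin d)} {Y : RoughPath T p (HatIdx d)}

theorem gammaSum_coord (h : IsGammaLift γ π X Y) (n : ℕ) (i j : Fin d) {t : ℝ}
    (ht : t ∈ Icc 0 T) :
    gammaSum γ (π n) (fun r => Y.path r (HatIdx.coord i)) (fun r => Y.path r (HatIdx.coord j)) t =
      gammaTensorSum γ (π n) X t (i, j) :=
  gammaSum_congr γ (π n) (fun r hr => h.path_coord r hr i) (fun r hr => h.path_coord r hr j) ht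

/-- Property γ-(RIE) supplies some uniform limit; it has to be identified with the pointwise limit
`gammaIntegral` used in the lift. -/
theorem exists_uniform (h : IsGammaLift γ π X Y) (i j : Fin d) :
    ∀ η > 0, ∀ᶠ n in atTop, ∀ t ∈ Icc 0 T,
      |gammaSum γ (π n) (fun r => Y.path r (HatIdx.coord i))
          (fun r => Y.path r (HatIdx.coord j)) t -
        gammaIntegral γ π (fun r => Y.path r (HatIdx.coord i))
          (fun r => Y.path r (HatIdx.coord j)) t| ≤ η := by
  obtain ⟨I, hI⟩ := h.rie.converge
  have hlim : ∀ t ∈ Icc 0 T, gammaIntegral γ π (fun r => Y.path r (HatIdx.coord i))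
      (fun r => Y.path r (HatIdx.coord j)) t = I t (i, j) := fun t ht => by
    refine Tendsto.limUnder_eq ?_
    simp only [h.gammaSum_coord _ i j ht]
    exact ((EuclideanSpace.proj (i, j)).continuous.tendsto _).comp (hI.tendsto_at ht)
  intro η hη
  filter_upwards [Metric.tendstoUniformlyOn_iff.1 hI η hη] with n hn t ht
  rw [hlim t ht, h.gammaSum_coord n i j ht]
  have h1 := hn t ht
  rw [dist_comm, dist_eq_norm] at h1
  exact (abs_apply_le_norm (gammaTensorSum γ (π n) X t - I t) (i, j)).trans h1.le

theorem lift_apply (h : IsGammaLift γ π X Y) {s t : ℝ} (hst : (s, t) ∈ simplex T)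
    (a b : HatIdx d) :
    Y.lift s t (a, b) = gammaIntegral γ π (fun r => Y.path r a) (fun r => Y.path r b) t -
      gammaIntegral γ π (fun r => Y.path r a) (fun r => Y.path r b) s -
        Y.path s a * incr Y.path s t b := by
  rw [h.lift_eq s t hst]
  rfl

/-- The error of the second-level `γ`-Riemann sums has uniformly bounded `p / 2`-variation along
the partitions. -/
theorem exists_control (h : IsGammaLift γ π X Y) (i j : Fin d) :
    ∃ κ, IsControl T κ ∧ ∀ n k l, k ≤ l → l ≤ (π n).N →
      |(gammaSum γ (π n) (fun r => Y.path r (HatIdx.coord i))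
            (fun r => Y.path r (HatIdx.coord j)) ((π n).pts l) -
          gammaIntegral γ π (fun r => Y.path r (HatIdx.coord i))
            (fun r => Y.path r (HatIdx.coord j)) ((π n).pts l)) -
        (gammaSum γ (π n) (fun r => Y.path r (HatIdx.coord i))
            (fun r => Y.path r (HatIdx.coord j)) ((π n).pts k) -
          gammaIntegral γ π (fun r => Y.path r (HatIdx.coord i))
            (fun r => Y.path r (HatIdx.coord j)) ((π n).pts k))| ≤
        2 * κ ((π n).pts k) ((π n).pts l) ^ (2 / p) := by
  obtain ⟨c, hc, C, -, hC⟩ := h.rie.control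
  have hp := Y.two_le
  have hp0 : 0 < p / 2 := by linarith
  have hfin : varCtrl (p / 2) Y.lift 0 T ≠ ∞ := by
    rw [varCtrl_eq_pVar_rpow hp0]
    exact ENNReal.rpow_ne_top_of_nonneg hp0.le Y.pVar_lift_lt_top.ne
  have hV := isControl_varCtrl hfin
  -- Subtracting `X_{t_k} ⊗ X_{t_k,t_l}` from both increments leaves the quantity bounded in γ-(RIE)
  -- for the sums and the second level of `Y` for the limit. Each is at most `κ ^ (2 / p)`, hence
  -- the factor `2`.
  have hκ : IsControl T (fun s t => |C| * c s t + (varCtrl (p / 2) Y.lift s t).toReal) :=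
    { nonneg := fun s t hst => add_nonneg (mul_nonneg (abs_nonneg _) (hc.nonneg s t hst))
        (hV.nonneg s t hst)
      superadd := fun s u t h0 h1 h2 h3 => by
        have e1 := hV.superadd s u t h0 h1 h2 h3
        have e2 := mul_le_mul_of_nonneg_left (hc.superadd s u t h0 h1 h2 h3) (abs_nonneg C)
        linarith }
  refine ⟨_, hκ, fun n k l hkl hl => ?_⟩
  set P := π n with hP
  have hst : (P.pts k, P.pts l) ∈ simplex T :=
    ⟨P.left_le (hkl.trans hl), P.pts_le hkl hl, P.le_right hl⟩
  -- The bound in γ-(RIE) is only available for `k < l`.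
  rcases hkl.eq_or_lt with rfl | hkl
  · rw [sub_self, abs_zero]
    exact mul_nonneg zero_le_two (Real.rpow_nonneg (hκ.nonneg _ _ hst) _)
  have hk : P.pts k ∈ Icc 0 T := ⟨hst.1, hst.2.1.trans hst.2.2⟩
  have hl' : P.pts l ∈ Icc 0 T := ⟨hst.1.trans hst.2.1, hst.2.2⟩
  have n1 := mul_nonneg (abs_nonneg C) (hc.nonneg _ _ hst)
  have n2 := hV.nonneg _ _ hst
  have h1 := (abs_apply_le_norm _ (HatIdx.coord i, HatIdx.coord j)).trans
    (norm_le_varCtrl_rpow hp0 hfin hst (Y.lift_self hk.1 hk.2))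
  rw [one_div_div, h.lift_apply hst] at h1
  have h2 := hC n k l hkl hl
  rw [← hP] at h2
  have h3 := (abs_apply_le_norm _ (i, j)).trans ((Real.le_rpow_inv_iff_of_pos (norm_nonneg _)
    (mul_nonneg (abs_nonneg C) (hc.nonneg _ _ hst)) hp0).2
    (h2.trans (mul_le_mul_of_nonneg_right (le_abs_self C) (hc.nonneg _ _ hst))))
  rw [inv_div] at h3
  have e3 : (incr (gammaTensorSum γ P X) (P.pts k) (P.pts l) -
      WithLp.toLp 2 (fun q : Fin d × Fin d => X (P.pts k) q.1 * incr X (P.pts k) (P.pts l) q.2))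
        (i, j) = gammaTensorSum γ P X (P.pts l) (i, j) - gammaTensorSum γ P X (P.pts k) (i, j) -
        X (P.pts k) i * (X (P.pts l) j - X (P.pts k) j) := rfl
  rw [e3, ← h.gammaSum_coord n i j hk, ← h.gammaSum_coord n i j hl', ← h.path_coord _ hk,
    ← h.path_coord _ hk, ← h.path_coord _ hl'] at h3
  have hp2 : 0 ≤ 2 / p := by positivity
  have m1 : (varCtrl (p / 2) Y.lift (P.pts k) (P.pts l)).toReal ^ (2 / p) ≤
      (|C| * c (P.pts k) (P.pts l) + (varCtrl (p / 2) Y.lift (P.pts k) (P.pts l)).toReal) ^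
        (2 / p) := Real.rpow_le_rpow n2 (by linarith) hp2
  have m2 : (|C| * c (P.pts k) (P.pts l)) ^ (2 / p) ≤
      (|C| * c (P.pts k) (P.pts l) + (varCtrl (p / 2) Y.lift (P.pts k) (P.pts l)).toReal) ^
        (2 / p) := Real.rpow_le_rpow n1 (by linarith) hp2
  rw [incr_path_apply, abs_le] at h1
  rw [abs_le] at h3 ⊢
  constructor <;> linarith

/-- The weighted second-level defect vanishes in the limit. -/
theorem tendsto_gammaDefect (h : IsGammaLift γ π X Y) (hT : 0 < T) (w : List (HatIdx d))
    (a b : HatIdx d) {t : ℝ} (ht : t ∈ Icc 0 T) :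
    Tendsto (fun n => Y.gammaDefect γ (π n) w a b t) atTop (𝓝 0) := by
  by_cases hab : IsYoungLetter a ∨ IsYoungLetter b
  · obtain ⟨X', hX'⟩ := h.isExtension
    exact hX'.tendsto_gammaDefect hT.le h.mesh w hab ht
  push Not at hab
  obtain ⟨i, rfl⟩ := eq_coord_of_not_isYoungLetter hab.1
  obtain ⟨j, rfl⟩ := eq_coord_of_not_isYoungLetter hab.2
  obtain ⟨C, hC, hb⟩ := Y.exists_sigBound_self hT.le w
  obtain ⟨κ, hκ, hκ'⟩ := h.exists_control i j
  have hlim := hb.tendsto_sum_mul_incr hC hT (π := π)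
    (E := fun n t => gammaSum γ (π n) (fun r => Y.path r (HatIdx.coord i))
        (fun r => Y.path r (HatIdx.coord j)) t -
      gammaIntegral γ π (fun r => Y.path r (HatIdx.coord i))
        (fun r => Y.path r (HatIdx.coord j)) t) hκ (h.exists_uniform i j) hκ' ht
  -- On one interval the γ-sum grows by `(X_{t_k} + γ X_{t_k,t_{k+1}})` times the increment of the
  -- integrator, and the γ-integral by the second level plus `X_{t_k}` times that increment. The
  -- difference is exactly the defect.
  refine hlim.congr fun n => Finset.sum_congr rfl fun k hk => ?_
  have hk' := Finset.mem_range.1 hk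
  set P := π n
  congr 1
  have hlt := P.pts_lt k hk'
  rcases le_total (P.pts k) t with hat | hat
  · have h1 : P.pts k ≤ min (P.pts (k + 1)) t := le_min hlt.le hat
    have hst : (P.pts k, min (P.pts (k + 1)) t) ∈ simplex T :=
      ⟨P.left_le hk'.le, h1, (min_le_left _ _).trans (P.le_right hk')⟩
    have e := gammaSum_sub γ P (fun r => Y.path r (HatIdx.coord i))
      (fun r => Y.path r (HatIdx.coord j)) hk' le_rfl h1 (min_le_left _ _)
    rw [min_eq_left hat, h.lift_apply hst]
    simp only [incr, PiLp.sub_apply] at e ⊢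
    linear_combination e
  · rw [min_eq_right hat, min_eq_right (hat.trans hlt.le), Y.lift_self ht.1 ht.2]
    simp [incr]

theorem tendsto_gammaSum_sig (h : IsGammaLift γ π X Y) (hT : 0 < T) (a b : HatIdx d)
    (w : List (HatIdx d)) {t : ℝ} (ht : t ∈ Icc 0 T) :
    Tendsto (fun n => gammaSum γ (π n) (Y.sig (a :: w)) (fun r => Y.path r b) t) atTop
      (𝓝 (Y.sig (b :: a :: w) t)) :=
  Y.tendsto_gammaSum_sig hT.le h.mesh a b w ht (h.tendsto_gammaDefect hT w a b ht)

/-- The coordinate of a one-letter word is the path minus its initial value; the shift contributes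
the second summand of the limit, which the γ-signature subtracts at level two. -/
theorem tendsto_gammaSum_path (h : IsGammaLift γ π X Y) (hT : 0 < T) (a b : HatIdx d)
    {t : ℝ} (ht : t ∈ Icc 0 T) :
    Tendsto (fun n => gammaSum γ (π n) (fun r => Y.path r a) (fun r => Y.path r b) t) atTop
      (𝓝 (Y.sig [b, a] t + Y.path 0 a * incr Y.path 0 t b)) := by
  refine ((h.tendsto_gammaSum_sig hT a b [] ht).add_const _).congr fun n => ?_
  have e := gammaSum_add_const γ (π n) (Y.sig [a]) (fun r => Y.path r b) (Y.path 0 a) ht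
  refine Eq.trans ?_ e.symm |>.trans ?_
  · rfl
  refine congrArg (fun F => gammaSum γ (π n) F _ t) (funext fun r => ?_)
  simp [sig, incr]

/-- The `γ`-signature coincides with the signature of the rough path. -/
theorem gammaSigRev_eq (h : IsGammaLift γ π X Y) (hT : 0 < T) :
    ∀ (w : List (HatIdx d)), ∀ t ∈ Icc 0 T, gammaSigRev γ π Y.path w t = Y.sig w t
  | [], _, _ => rfl
  | [_], _, _ => rfl
  | [b, a], t, ht => by
    rw [gammaSigRev, gammaIntegral, (h.tendsto_gammaSum_path hT a b ht).limUnder_eq]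
    ring
  | l :: j :: i :: w, t, ht => by
    rw [gammaSigRev, gammaIntegral]
    refine Tendsto.limUnder_eq ?_
    refine (h.tendsto_gammaSum_sig hT j l (i :: w) ht).congr fun n => ?_
    exact gammaSum_congr γ (π n) (fun r hr => (h.gammaSigRev_eq hT (j :: i :: w) r hr).symm)
      (fun _ _ => rfl) ht

theorem gammaSig_eq (h : IsGammaLift γ π X Y) (hT : 0 < T) (I : List (HatIdx d)) {t : ℝ}
    (ht : t ∈ Icc 0 T) : gammaSig γ π Y.path I t = Y.sig I.reverse t :=
  h.gammaSigRev_eq hT I.reverse t ht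

theorem gammaSigExists (h : IsGammaLift γ π X Y) (hT : 0 < T) : GammaSigExists γ π Y.path := by
  refine ⟨fun i j t ht => ⟨_, h.tendsto_gammaSum_path hT i j ht⟩, fun I i hI t ht => ?_⟩
  obtain ⟨a, w, haw⟩ : ∃ a w, I.reverse = a :: w := by
    rcases hw : I.reverse with _ | ⟨a, w⟩
    · rw [List.reverse_eq_nil_iff] at hw
      simp [hw] at hI
    · exact ⟨a, w, rfl⟩
  refine ⟨_, (h.tendsto_gammaSum_sig hT a i w ht).congr fun n => ?_⟩
  refine gammaSum_congr γ (π n) (fun r hr => ?_) (fun _ _ => rfl) ht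
  rw [h.gammaSig_eq hT I hr, haw]

end IsGammaLift

/-- The path coordinates and the γ-lift come from the description of the subset; the Young entries
come from `K` consisting of extended rough paths. -/
theorem exists_isGammaLift {π : ℕ → Partition 0 T}
    (hπ : Tendsto (fun n => (π n).mesh) atTop (𝓝 0)) {L : ℝ}
    {K : Set (RoughPath T p (HatIdx d))} (hK : K ⊆ extendedRoughPaths T p d)
    {Y : RoughPath T p (HatIdx d)} (hY : Y ∈ gammaSubset γ π L K) :
    ∃ X, IsGammaLift γ π X Y := by
  obtain ⟨hYK, X, hX, hpath, hlift, -⟩ := hY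
  exact ⟨X, hX, fun t ht i => by rw [hpath t ht]; rfl, hlift, hK hYK, hπ⟩

/-! ### Density of linear functionals of the signature -/

/-- Linear functionals of the signature are uniformly dense in the continuous functions on a
compact and bounded set of extended rough paths. -/
theorem exists_pairing_sig_near (hT : 0 < T) {K : Set (RoughPath T p (HatIdx d))}
    (hK : K ⊆ extendedRoughPaths T p d) (hKc : IsCompact K) {M : ℝ≥0∞} (hM : M ≠ ∞)
    (hKb : ∀ Y ∈ K, Y.seminorm ≤ M) {f : RoughPath T p (HatIdx d) → ℝ} (hf : ContinuousOn f K)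
    {ε : ℝ} (hε : 0 < ε) :
    ∃ l : List (HatIdx d) →₀ ℝ, ∀ Y ∈ K, |f Y - pairing l (fun I => Y.sig I.reverse T)| < ε := by
  have hTm : T ∈ Icc 0 T := ⟨hT.le, le_rfl⟩
  have hcs : CompactSpace K := isCompact_iff_compactSpace.1 hKc
  -- The rough path distance is only a pseudometric, so Stone–Weierstrass is applied on the
  -- separation quotient, through which all continuous functions factor.
  have hcq : CompactSpace (SeparationQuotient K) := by
    refine ⟨?_⟩
    rw [← SeparationQuotient.surjective_mk.range_eq]
    exact isCompact_range SeparationQuotient.continuous_mk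
  have hins : ∀ {g : K → ℝ}, Continuous g → ∀ x y : K, Inseparable x y → g x = g y :=
    fun hg x y hxy => (hxy.map hg).eq
  have hcont : ∀ I : List (HatIdx d), Continuous fun Y : K => Y.1.sig I.reverse T := fun I =>
    continuousOn_iff_continuous_domRestrict.1
      ((continuousOn_sig_apply hT.le hM I.reverse T hTm).mono fun Y hY => hKb Y hY)
  have hf' : Continuous fun Y : K => f Y := continuousOn_iff_continuous_domRestrict.1 hf
  let φ : List (HatIdx d) → C(SeparationQuotient K, ℝ) := fun I =>
    ⟨SeparationQuotient.lift (fun Y : K => Y.1.sig I.reverse T) (hins (hcont I)),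
      SeparationQuotient.continuous_lift (hcont I)⟩
  have hφ : ∀ I (Y : K), φ I (SeparationQuotient.mk Y) = Y.1.sig I.reverse T := fun I Y => rfl
  let F : C(SeparationQuotient K, ℝ) :=
    ⟨SeparationQuotient.lift (fun Y : K => f Y) (hins hf'), SeparationQuotient.continuous_lift hf'⟩
  let S : Submodule ℝ C(SeparationQuotient K, ℝ) := Submodule.span ℝ (Set.range φ)
  have hone : (1 : C(SeparationQuotient K, ℝ)) ∈ S := by
    refine Submodule.subset_span ⟨[], ?_⟩
    ext x
    obtain ⟨Y, rfl⟩ := SeparationQuotient.surjective_mk x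
    rfl
  -- By bilinearity it suffices to multiply two coordinates, and the quasi-shuffle formula expands
  -- their product at time `T` into coordinates.
  have hmul : ∀ g h, g ∈ S → h ∈ S → g * h ∈ S := by
    have hS : S * S ≤ S := by
      rw [Submodule.span_mul_span, Submodule.span_le]
      rintro _ ⟨_, ⟨I, rfl⟩, _, ⟨J, rfl⟩, rfl⟩
      have e : φ I * φ J =
          ((quasiShuffle bracketLetter I.reverse J.reverse).map fun w => φ w.reverse).sum := by
        ext x
        obtain ⟨Y, rfl⟩ := SeparationQuotient.surjective_mk x
        obtain ⟨X, hX⟩ := hK Y.2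
        have h1 := hX.sig_mul_sig hT.le I.reverse J.reverse hTm
        have h2 : ∀ L : List (List (HatIdx d)),
            (L.map fun w => φ w.reverse).sum (SeparationQuotient.mk Y) = Y.1.sigSum L T := by
          intro L
          induction L with
          | nil => rfl
          | cons w L ih =>
            rw [List.map_cons, List.sum_cons, ContinuousMap.add_apply, ih, hφ,
              List.reverse_reverse]
            rfl
        rw [ContinuousMap.mul_apply, hφ, hφ, h1, h2]
      simp only [e]
      refine list_sum_mem fun x hx => ?_
      obtain ⟨w, _, rfl⟩ := List.mem_map.1 hx
      exact Submodule.subset_span ⟨_, rfl⟩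
    exact fun g h hg hh => hS (Submodule.mul_mem_mul hg hh)
  let A : Subalgebra ℝ C(SeparationQuotient K, ℝ) := S.toSubalgebra hone hmul
  have hsep : A.SeparatesPoints := by
    intro x y hxy
    obtain ⟨Y, rfl⟩ := SeparationQuotient.surjective_mk x
    obtain ⟨Z, rfl⟩ := SeparationQuotient.surjective_mk y
    by_contra hcon
    push Not at hcon
    refine hxy (SeparationQuotient.mk_eq_mk.2 ?_)
    rw [EMetric.inseparable_iff]
    refine edist_eq_zero_of_sig_terminal hT (hK Y.2) (hK Z.2) fun w => ?_
    have h1 := hcon (φ w.reverse)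
      ⟨φ w.reverse, Submodule.subset_span ⟨_, rfl⟩, rfl⟩
    rwa [hφ, hφ, List.reverse_reverse] at h1
  obtain ⟨g, hg⟩ := ContinuousMap.exists_mem_subalgebra_near_continuousMap_of_separatesPoints
    A hsep F ε hε
  obtain ⟨l, hl⟩ := (Finsupp.mem_span_range_iff_exists_finsupp).1 (show g.1 ∈ S from g.2)
  refine ⟨l, fun Y hY => ?_⟩
  have h1 := (ContinuousMap.norm_lt_iff _ hε).1 hg (SeparationQuotient.mk ⟨Y, hY⟩)
  have h2 : g.1 (SeparationQuotient.mk ⟨Y, hY⟩) = pairing l (fun I => Y.sig I.reverse T) := by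
    rw [← hl, Finsupp.sum, ContinuousMap.sum_apply]
    rfl
  rw [Real.norm_eq_abs, ContinuousMap.sub_apply, abs_sub_comm, h2] at h1
  exact h1

end GammaSig

/-! ### The approximation theorem -/

open GammaSig in
theorem mainTheorem4 (T : ℝ) (hT : 0 < T) (d : ℕ) (γ : ℝ) (hγ : γ ∈ Set.Icc (0 : ℝ) 1)
    (hγ' : γ ≠ 1 / 2) (p : ℝ) (hp : p ∈ Set.Ioo (2 : ℝ) 3)
    (π : ℕ → Partition 0 T)
    (hπ : Filter.Tendsto (fun n => (π n).mesh) Filter.atTop (nhds 0))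
    (K : Set (RoughPath T p (HatIdx d))) (hK : K ⊆ extendedRoughPaths T p d)
    (hKc : IsCompact K) (hKb : ∃ M : ℝ, ∀ Y ∈ K, Y.seminorm ≤ ENNReal.ofReal M)
    (f : RoughPath T p (HatIdx d) → ℝ) (hf : ContinuousOn f K)
    (L : ℝ) (hL : 0 < L) :
    (∀ Y ∈ gammaSubset γ π L K, GammaSigExists γ π Y.path) ∧
    ∀ ε : ℝ, 0 < ε → ∃ l : List (HatIdx d) →₀ ℝ,
      (⨆ Y ∈ gammaSubset γ π L K,
        ENNReal.ofReal |f Y - pairing l (fun I => gammaSig γ π Y.path I T)|)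
          < ENNReal.ofReal ε := by
  refine ⟨fun Y hY => ?_, fun ε hε => ?_⟩
  · obtain ⟨X, hX⟩ := exists_isGammaLift hπ hK hY
    exact hX.gammaSigExists hT
  · obtain ⟨M, hM⟩ := hKb
    -- Accuracy `ε / 2` keeps the inequality strict after passing to the supremum.
    obtain ⟨l, hl⟩ := exists_pairing_sig_near hT hK hKc ENNReal.ofReal_ne_top hM hf (half_pos hε)
    refine ⟨l, lt_of_le_of_lt (iSup₂_le fun Y hY => ?_)
      ((ENNReal.ofReal_lt_ofReal_iff hε).2 (half_lt_self hε))⟩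
    obtain ⟨X, hX⟩ := exists_isGammaLift hπ hK hY
    simp only [hX.gammaSig_eq hT _ (show T ∈ Set.Icc 0 T from ⟨hT.le, le_rfl⟩)]
    exact ENNReal.ofReal_le_ofReal (hl Y hY.1).le
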